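/- **Setting.** Let $M=(\mathcal S,\mathcal A,H,\{P_h\},\{r_h\})$ be a finite-horizon MDP with steps $h=1,\dots,H$, finite action set $\mathcal A$, rewards $r_h\in[0,1]$ and a fixed initial state; $\mathbb P_hf(s,a)=\mathbb E[f(s_{h+1})\mid s_h=s,a_h=a]$, and $\operatorname{SubOpt}(\pi)=V_1^{\pi^*}-V_1^{\pi}$ at the initial state, where $\pi^*$ is an optimal policy. Let $\gamma\in[0,1]$. The observed agent uses the policy $\pi_{b,h}(a\mid s)=e^{Q_h^{\pi_b,\gamma}(s,a)}/\sum_{a'}e^{Q_h^{\pi_b,\gamma}(s,a')}$, where $Q_h^{\pi_b,\gamma}=r_h+\gamma\,\mathbb P_hV_{h+1}^{\pi_b,\gamma}$, $V_h^{\pi_b,\gamma}(s)=\langle\pi_{b,h}(\cdot\mid s),Q_h^{\pi_b,\gamma}(s,\cdot)\rangle$ and $V_{H+1}^{\pi_b,\gamma}=0$. The data are $n$ independent trajectories $(s_h^i,a_h^i)_{h\le H}$, $i\le n$, generated by $\pi_b$; rewards are not observed. Let $\phi:\mathcal S\times\mathcal A\to\mathbb R^d$, $d\ge1$, be a known feature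 map and $\Theta\subset\mathbb R^d$ a known parameter set. Put $\Lambda_h=\sum_{i=1}^n\phi(s_h^i,a_h^i)\phi(s_h^i,a_h^i)^\top$ and $\Sigma_h=\mathbb E_{\pi_b}[\phi(s_h,a_h)\phi(s_h,a_h)^\top]$. **Algorithm** (parameters $\lambda,\beta$). (1) $\widehat\theta_h\in\operatorname{argmax}_{\theta\in\Theta}\frac1n\sum_i\big[\phi(s_h^i,a_h^i)\cdot\theta-\log\sum_{a'}e^{\phi(s_h^i,a')\cdot\theta}\big]$, $\widehat Q_h=\phi\cdot\widehat\theta_h$, and $\widehat V_h(s)=\langle\widehat Q_h(s,\cdot),\widehat\pi_h(\cdot\mid s)\rangle$ with $\widehat\pi_h$ the softmax of $\widehat Q_h$ and $\widehat V_{H+1}=0$. (2) $\widehat r_h=\phi\cdot\widehat w_h$, where $\widehat w_h$ minimizes $\sum_i\big(\phi(s_h^i,a_h^i)\cdot w+\gamma\widehat V_{h+1}(s_{h+1}^i)-\widehat Q_h(s_h^i,a_h^i)\big)^2+\lambda\|w\|_2^2$. (3) With $\widetilde V_{H+1}=0$, for $h=H,\dots,1$: $\widetilde{\mathbb P}_h\widetilde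 V_{h+1}=\phi\cdot\widetilde u_h$, where $\widetilde u_h$ minimizes $\sum_i\big(\phi(s_h^i,a_h^i)\cdot u-\widetilde V_{h+1}(s_{h+1}^i)\big)^2+\lambda\|u\|_2^2$; $\Gamma_h(s,a)=\beta\big(\phi(s,a)^\top(\Lambda_h+\lambda I)^{-1}\phi(s,a)\big)^{1/2}$; $\widetilde Q_h=\min\{\widehat r_h+\widetilde{\mathbb P}_h\widetilde V_{h+1}-\Gamma_h,\,H-h+1\}_+$; $\widetilde\pi_h(\cdot\mid s)\in\operatorname{argmax}_{p}\langle\widetilde Q_h(s,\cdot),p\rangle$ over distributions $p$ on $\mathcal A$; $\widetilde V_h(s)=\langle\widetilde Q_h(s,\cdot),\widetilde\pi_h(\cdot\mid s)\rangle$. **Assumptions** ($\kappa,c^\dagger>0$ are constants). (a) *Model class and identification*: $\phi\cdot\theta$ takes values in $[0,H]$ for every $\theta\in\Theta$; for every $h$ there is $\theta_h\in\Theta$ with $Q_h^{\pi_b,\gamma}=\phi\cdot\theta_h$; there is $a_0\in\mathcal A$ with $\phi(s,a_0)\cdot\theta=0$ for all $s$ and all $\theta\in\Theta$. (b) *Regularity*: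 $\|\theta\|_2\le H\sqrt d$ for $\theta\in\Theta$; $r_h=\phi\cdot w_h$ with $\|w_h\|_2\le\sqrt d$; $\|\phi(s,a)\|_2\le1$; and $\log N(\Theta,\|\cdot\|_\infty,1/m)\le\kappa\,d\log m$ for all integers $m\ge2$, $N$ being the covering number. (c) *Linear transitions*: for every $h$ and every $V:\mathcal S\to[0,H-h]$ there is $u_h\in\mathbb R^d$ with $\|u_h\|_2\le(H-h+1)\sqrt d$ and $\mathbb P_hV=\phi\cdot u_h$. (d) *Single-policy coverage*: with probability at least $1-\delta/2$, $\Lambda_h\succeq c^\dagger\,n\,\mathbb E_{\pi^*}[\phi(s_h,a_h)\phi(s_h,a_h)^\top]$ for all $h$. **Theorem.** For every $\kappa$ there is a constant $C_0>0$, depending only on $\kappa$, such that for every $C\ge C_0$ and every $c^\dagger>0$ there is a constant $c>0$, depending only on $\kappa,C,c^\dagger$, with the following property. Let (a)–(d) hold, $\delta\in(0,1)$ and $nH\ge2\delta$ (so that $\log(nH/\delta)\ge\log 2$). Take $\lambda=1$ and $\beta=C\,He^H|\mathcal A|\,d\sqrt{\log(nH/\delta)}$. Then, with probability at least $1-\delta$,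 for every output of the algorithm: (i) the $\Gamma_h$ are uncertainty quantifiers: $\big|(\widehat r_h+\widetilde{\mathbb P}_h\widetilde V_{h+1})(s,a)-(r_h+\mathbb P_h\widetilde V_{h+1})(s,a)\big|\le\Gamma_h(s,a)$ for all $h,s,a$; (ii) $\operatorname{SubOpt}(\{\widetilde\pi_h\})\le c\,(1+\gamma)\,|\mathcal A|\,d^{3/2}H^2e^H n^{-1/2}\sqrt{\xi}$, where $\xi=\log(dHn/\delta)$; and, for every $r$ such that $\operatorname{rank}(\Sigma_h)\le r$ for all $h$, also $\operatorname{SubOpt}(\{\widetilde\pi_h\})\le c\,(1+\gamma)\,|\mathcal A|\,r^{1/2}d\,H^2e^H n^{-1/2}\sqrt{\xi}$. -/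

import Mathlib

open MeasureTheory ProbabilityTheory
open scoped NNReal ENNReal

/-- The softmax (logit) distribution `a ↦ exp (q a) / ∑ a', exp (q a')`. -/
noncomputable def softmax {A : Type*} [Fintype A] (q : A → ℝ) (a : A) : ℝ :=
  Real.exp (q a) / ∑ a', Real.exp (q a')

/-- A finite-horizon Markov decision process with `H` steps, numbered `0, …, H - 1`, state space
`S`, finite action set `A`, Markov transition kernels, rewards in `[0, 1]` and a fixed initial
state.  Only the data of the steps `h < H` are ever relevant. -/
structure EpisodicMDP (S A : Type*) [MeasurableSpace S] [MeasurableSpace A] (H : ℕ) where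
  /-- the transition kernels -/
  P : ℕ → Kernel (S × A) S
  markov : ∀ h, IsMarkovKernel (P h)
  /-- the rewards -/
  r : ℕ → S → A → ℝ
  measurable_r : ∀ h a, Measurable fun s => r h s a
  r_mem : ∀ h < H, ∀ s a, r h s a ∈ Set.Icc (0 : ℝ) 1
  /-- the initial state -/
  s₀ : S

/-- A (randomized, Markov, non-stationary) policy: `prob h s a` is the probability of choosing
action `a` in state `s` at step `h`. -/
structure Policy (S A : Type*) [MeasurableSpace S] [Fintype A] where
  /-- the action probabilities -/
  prob : ℕ → S → A → ℝ
  mem_stdSimplex : ∀ h s, prob h s ∈ stdSimplex ℝ A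
  measurable_prob : ∀ h a, Measurable fun s => prob h s a

section MDP

variable {S A : Type*} [MeasurableSpace S] [MeasurableSpace A] {H : ℕ}

namespace EpisodicMDP

/-- The transition operator `(ℙ_h f)(s, a) = E[f(s_{h+1}) | s_h = s, a_h = a]`. -/
noncomputable def transition (M : EpisodicMDP S A H) (h : ℕ) (f : S → ℝ) (s : S) (a : A) : ℝ :=
  ∫ s', f s' ∂(M.P h (s, a))

theorem measurable_transition (M : EpisodicMDP S A H) (h : ℕ) {f : S → ℝ} (hf : Measurable f)
    (a : A) : Measurable fun s => M.transition h f s a := by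
  have := M.markov h
  have h1 : StronglyMeasurable fun p : S × A => ∫ s', f s' ∂(M.P h p) :=
    StronglyMeasurable.integral_kernel hf.stronglyMeasurable
  exact h1.measurable.comp (measurable_id.prodMk measurable_const)

variable [Fintype A]

/-- The law of the `k` successive state-action pairs `(s_h, a_h), …, (s_{h+k-1}, a_{h+k-1})` when
`s_h = s` and the policy `π` is followed. -/
noncomputable def trajLaw (M : EpisodicMDP S A H) (π : Policy S A) :
    (k h : ℕ) → S → Measure (Fin k → S × A)
  | 0, _, _ => Measure.dirac Fin.elim0
  | k + 1, h, s => ∑ a, ENNReal.ofReal (π.prob h s a) •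
      ((M.P h (s, a)).bind (trajLaw M π k (h + 1))).map
        (fun τ => (Fin.cons (s, a) τ : Fin (k + 1) → S × A))

/-- The value function `V_h^π(s) = E_π[∑_{t = h}^{H-1} r_t(s_t, a_t) | s_h = s]`. -/
noncomputable def value (M : EpisodicMDP S A H) (π : Policy S A) (h : ℕ) (s : S) : ℝ :=
  ∫ τ, ∑ j : Fin (H - h), M.r (h + j) (τ j).1 (τ j).2 ∂(M.trajLaw π (H - h) h s)

/-- `π` is optimal, from the initial state, among all policies. -/
def IsOptimal (M : EpisodicMDP S A H) (π : Policy S A) : Prop :=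
  ∀ π' : Policy S A, M.value π' 0 M.s₀ ≤ M.value π 0 M.s₀

/-- The suboptimality of `π` relative to the optimal policy `πstar`. -/
noncomputable def subOpt (M : EpisodicMDP S A H) (πstar π : Policy S A) : ℝ :=
  M.value πstar 0 M.s₀ - M.value π 0 M.s₀

/-- The agent's discounted state value function at step `h` with `k` steps to go.  It vanishes if
`k = 0`; otherwise it is `⟨softmax Q, Q⟩`, where `Q = r_h + γ ℙ_h V_{h+1}`. -/
noncomputable def agentVAux (M : EpisodicMDP S A H) (γ : ℝ) : (k h : ℕ) → S → ℝ
  | 0, _, _ => 0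
  | k + 1, h, s =>
      ∑ a, softmax (fun a' => M.r h s a' + γ * M.transition h (agentVAux M γ k (h + 1)) s a') a *
        (M.r h s a + γ * M.transition h (agentVAux M γ k (h + 1)) s a)

/-- The agent's state value function `V_h^{π_b,γ}`, with `V_H^{π_b,γ} = 0`. -/
noncomputable def agentV (M : EpisodicMDP S A H) (γ : ℝ) (h : ℕ) : S → ℝ :=
  M.agentVAux γ (H - h) h

/-- The agent's action value function `Q_h^{π_b,γ} = r_h + γ ℙ_h V_{h+1}^{π_b,γ}`. -/
noncomputable def agentQ (M : EpisodicMDP S A H) (γ : ℝ) (h : ℕ) (s : S) (a : A) : ℝ :=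
  M.r h s a + γ * M.transition h (M.agentV γ (h + 1)) s a

theorem measurable_agentVAux (M : EpisodicMDP S A H) (γ : ℝ) (k h : ℕ) :
    Measurable (M.agentVAux γ k h) := by
  induction k generalizing h with
  | zero => exact measurable_const
  | succ k ih =>
    have hq : ∀ a, Measurable fun s =>
        M.r h s a + γ * M.transition h (M.agentVAux γ k (h + 1)) s a := fun a =>
      (M.measurable_r h a).add ((M.measurable_transition h (ih (h + 1)) a).const_mul γ)
    have heq : M.agentVAux γ (k + 1) h = fun s => ∑ a,
        softmax (fun a' => M.r h s a' + γ * M.transition h (M.agentVAux γ k (h + 1)) s a') a *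
          (M.r h s a + γ * M.transition h (M.agentVAux γ k (h + 1)) s a) := rfl
    rw [heq]
    unfold softmax
    fun_prop

theorem measurable_agentQ (M : EpisodicMDP S A H) (γ : ℝ) (h : ℕ) (a : A) :
    Measurable fun s => M.agentQ γ h s a :=
  (M.measurable_r h a).add
    ((M.measurable_transition h (M.measurable_agentVAux γ _ _) a).const_mul γ)

/-- The behavior policy of the dynamic discrete choice model: the softmax of `Q_h^{π_b,γ}`. -/
noncomputable def behavior [Nonempty A] (M : EpisodicMDP S A H) (γ : ℝ) : Policy S A where
  prob h s := softmax (M.agentQ γ h s)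
  mem_stdSimplex h s := by
    have hpos : 0 < ∑ a', Real.exp (M.agentQ γ h s a') :=
      Finset.sum_pos (fun _ _ => Real.exp_pos _) Finset.univ_nonempty
    refine ⟨fun a => div_nonneg (Real.exp_pos _).le hpos.le, ?_⟩
    simp only [softmax]
    rw [← Finset.sum_div, div_self hpos.ne']
  measurable_prob h a := by
    have := M.measurable_agentQ γ h
    unfold softmax
    fun_prop

/-- The feature covariance matrix `E_π[φ(s_h, a_h) φ(s_h, a_h)ᵀ]`. -/
noncomputable def featureCov {d : ℕ} (M : EpisodicMDP S A H)
    (φ : S → A → EuclideanSpace ℝ (Fin d)) (π : Policy S A) (h : Fin H) :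
    Matrix (Fin d) (Fin d) ℝ :=
  Matrix.of fun i j =>
    ∫ τ, φ (τ h).1 (τ h).2 i * φ (τ h).1 (τ h).2 j ∂(M.trajLaw π H 0 M.s₀)

/-- The trajectories `D 1, …, D n` are independent and each of them is generated by `π`. -/
def IsIIDSample {Ω : Type*} [MeasurableSpace Ω] {n : ℕ} (M : EpisodicMDP S A H) (π : Policy S A)
    (μ : Measure Ω) (D : Ω → Fin n → Fin H → S × A) : Prop :=
  (∀ i, Measurable fun ω => D ω i) ∧ iIndepFun (fun i ω => D ω i) μ ∧
    ∀ i, μ.map (fun ω => D ω i) = M.trajLaw π H 0 M.s₀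

end EpisodicMDP

/-! ### The algorithm

It only has access to the feature map `φ`, the parameter set `Θ`, the discount factor `γ`, the
tuning parameters `lam`, `β` and the dataset `D`. -/

section Algorithm

variable [Fintype A] {d n : ℕ}

/-- `V_{h+1}` as a function of the state, with the convention `V_H = 0`. -/
noncomputable def nextV (V : Fin H → S → ℝ) (h : Fin H) (s : S) : ℝ :=
  if hh : (h : ℕ) + 1 < H then V ⟨h + 1, hh⟩ s else 0

/-- `V_{h+1}(s_{h+1})` along the trajectory `τ`, with the convention `V_H = 0`. -/
noncomputable def nextVAlong (V : Fin H → S → ℝ) (τ : Fin H → S × A) (h : Fin H) : ℝ :=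
  if hh : (h : ℕ) + 1 < H then V ⟨h + 1, hh⟩ (τ ⟨h + 1, hh⟩).1 else 0

/-- The linear function `(s, a) ↦ φ(s, a) · θ`. -/
noncomputable def linFun (φ : S → A → EuclideanSpace ℝ (Fin d)) (θ : EuclideanSpace ℝ (Fin d))
    (s : S) (a : A) : ℝ :=
  inner ℝ (φ s a) θ

/-- The log-likelihood of the choices at step `h`. -/
noncomputable def logLik (φ : S → A → EuclideanSpace ℝ (Fin d)) (D : Fin n → Fin H → S × A)
    (h : Fin H) (θ : EuclideanSpace ℝ (Fin d)) : ℝ :=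
  (1 / (n : ℝ)) * ∑ i, (linFun φ θ (D i h).1 (D i h).2 -
    Real.log (∑ a', Real.exp (linFun φ θ (D i h).1 a')))

/-- The estimated agent value functions `V̂_h = ⟨Q̂_h, softmax Q̂_h⟩`, `Q̂_h = φ · θ̂_h`. -/
noncomputable def estV (φ : S → A → EuclideanSpace ℝ (Fin d))
    (θhat : Fin H → EuclideanSpace ℝ (Fin d)) (h : Fin H) (s : S) : ℝ :=
  ∑ a, linFun φ (θhat h) s a * softmax (linFun φ (θhat h) s) a

/-- The regularized mean squared Bellman error whose minimizer gives the estimated reward. -/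
noncomputable def rewardLoss (φ : S → A → EuclideanSpace ℝ (Fin d)) (γ lam : ℝ)
    (D : Fin n → Fin H → S × A) (θhat : Fin H → EuclideanSpace ℝ (Fin d)) (h : Fin H)
    (w : EuclideanSpace ℝ (Fin d)) : ℝ :=
  (∑ i, (linFun φ w (D i h).1 (D i h).2 + γ * nextVAlong (estV φ θhat) (D i) h -
    linFun φ (θhat h) (D i h).1 (D i h).2) ^ 2) + lam * ‖w‖ ^ 2

/-- The regularized squared error whose minimizer gives the estimate of `ℙ_h V_{h+1}`. -/
noncomputable def transitionLoss (φ : S → A → EuclideanSpace ℝ (Fin d)) (lam : ℝ)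
    (D : Fin n → Fin H → S × A) (V : Fin H → S → ℝ) (h : Fin H)
    (u : EuclideanSpace ℝ (Fin d)) : ℝ :=
  (∑ i, (linFun φ u (D i h).1 (D i h).2 - nextVAlong V (D i) h) ^ 2) + lam * ‖u‖ ^ 2

/-- The empirical matrix `Λ_h = ∑_i φ(s_h^i, a_h^i) φ(s_h^i, a_h^i)ᵀ`. -/
noncomputable def gramMatrix (φ : S → A → EuclideanSpace ℝ (Fin d))
    (D : Fin n → Fin H → S × A) (h : Fin H) : Matrix (Fin d) (Fin d) ℝ :=
  ∑ i, Matrix.vecMulVec (φ (D i h).1 (D i h).2).ofLp (φ (D i h).1 (D i h).2).ofLp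

/-- The elliptical penalty `Γ_h(s, a) = β (φ(s, a)ᵀ (Λ_h + lam I)⁻¹ φ(s, a))^{1/2}`. -/
noncomputable def penalty (φ : S → A → EuclideanSpace ℝ (Fin d)) (lam β : ℝ)
    (D : Fin n → Fin H → S × A) (h : Fin H) (s : S) (a : A) : ℝ :=
  β * √((φ s a).ofLp ⬝ᵥ
    ((gramMatrix φ D h + lam • (1 : Matrix (Fin d) (Fin d) ℝ))⁻¹).mulVec (φ s a).ofLp)

/-- The pessimistic action value function
`Q̃_h = min {r̂_h + ℙ̃_h Ṽ_{h+1} - Γ_h, H - h}_+`, with `r̂_h = φ · ŵ_h`, `ℙ̃_h Ṽ_{h+1} = φ · ũ_h`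
(there are `H - h` steps to go, as the first step is numbered `0`). -/
noncomputable def pessQ (φ : S → A → EuclideanSpace ℝ (Fin d)) (lam β : ℝ)
    (D : Fin n → Fin H → S × A) (what utilde : Fin H → EuclideanSpace ℝ (Fin d))
    (h : Fin H) (s : S) (a : A) : ℝ :=
  max (min (linFun φ (what h) s a + linFun φ (utilde h) s a - penalty φ lam β D h s a)
    ((H : ℝ) - (h : ℕ))) 0

/-- The pessimistic state value function `Ṽ_h = ⟨Q̃_h, π̃_h⟩`. -/
noncomputable def pessV (φ : S → A → EuclideanSpace ℝ (Fin d)) (lam β : ℝ)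
    (D : Fin n → Fin H → S × A) (what utilde : Fin H → EuclideanSpace ℝ (Fin d))
    (π : Policy S A) (h : Fin H) (s : S) : ℝ :=
  ∑ a, pessQ φ lam β D what utilde h s a * π.prob h s a

/-- `(θhat, what, utilde, π)` is an output of the whole procedure (maximum likelihood, reward
regression, pessimistic value iteration) on the dataset `D`.  Every choice of maximizers is
allowed. -/
structure IsDCPPOOutput (φ : S → A → EuclideanSpace ℝ (Fin d))
    (Θ : Set (EuclideanSpace ℝ (Fin d))) (γ lam β : ℝ) (D : Fin n → Fin H → S × A)
    (θhat what utilde : Fin H → EuclideanSpace ℝ (Fin d)) (π : Policy S A) : Prop where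
  mle_mem : ∀ h, θhat h ∈ Θ
  mle : ∀ h, IsMaxOn (logLik φ D h) Θ (θhat h)
  reward : ∀ h, IsMinOn (rewardLoss φ γ lam D θhat h) Set.univ (what h)
  transition : ∀ h, IsMinOn
    (transitionLoss φ lam D (pessV φ lam β D what utilde π) h) Set.univ (utilde h)
  greedy : ∀ (h : Fin H) (s : S), IsMaxOn
    (fun p : A → ℝ => ∑ a, pessQ φ lam β D what utilde h s a * p a)
    (stdSimplex ℝ A) (π.prob h s)

/-- The penalties `Γ_h` are uncertainty quantifiers:
`|(r̂_h + ℙ̃_h Ṽ_{h+1}) - (r_h + ℙ_h Ṽ_{h+1})| ≤ Γ_h` at every step and state-action pair. -/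
def IsUncertaintyQuantifier (M : EpisodicMDP S A H) (φ : S → A → EuclideanSpace ℝ (Fin d))
    (lam β : ℝ) (D : Fin n → Fin H → S × A) (what utilde : Fin H → EuclideanSpace ℝ (Fin d))
    (π : Policy S A) : Prop :=
  ∀ (h : Fin H) (s : S) (a : A),
    |(linFun φ (what h) s a + linFun φ (utilde h) s a) -
      (M.r h s a + M.transition h (nextV (pessV φ lam β D what utilde π) h) s a)|
      ≤ penalty φ lam β D h s a

end Algorithm

/-! ### Assumptions -/

section Assumptions

variable [Fintype A] {d : ℕ}

/-- The linear model class `{φ · θ : θ ∈ Θ}` of functions with values in `[0, H]` contains the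
agent's action value functions. -/
structure LinearClass (M : EpisodicMDP S A H) (φ : S → A → EuclideanSpace ℝ (Fin d))
    (Θ : Set (EuclideanSpace ℝ (Fin d))) (γ : ℝ) : Prop where
  range : ∀ θ ∈ Θ, ∀ s a, linFun φ θ s a ∈ Set.Icc (0 : ℝ) H
  realizable : ∀ h < H, ∃ θ ∈ Θ, M.agentQ γ h = linFun φ θ

/-- Model identification: some action has value `0` in every state, for every member of the
model class. -/
def Identified (φ : S → A → EuclideanSpace ℝ (Fin d))
    (Θ : Set (EuclideanSpace ℝ (Fin d))) : Prop :=
  ∃ a₀ : A, ∀ θ ∈ Θ, ∀ s, linFun φ θ s a₀ = 0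

/-- Regularity conditions, with constant `κ` in the covering number bound
`log N(Θ, ‖·‖_∞, 1/m) ≤ κ d log m`. -/
structure Regular (M : EpisodicMDP S A H) (φ : S → A → EuclideanSpace ℝ (Fin d))
    (Θ : Set (EuclideanSpace ℝ (Fin d))) (κ : ℝ) : Prop where
  norm_param : ∀ θ ∈ Θ, ‖θ‖ ≤ H * √(d : ℝ)
  reward : ∀ h < H, ∃ w : EuclideanSpace ℝ (Fin d), ‖w‖ ≤ √(d : ℝ) ∧ M.r h = linFun φ w
  norm_feature : ∀ s a, ‖φ s a‖ ≤ 1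
  covering : ∀ m : ℕ, 2 ≤ m →
    ENNReal.log (Metric.externalCoveringNumber ((m : ℝ≥0)⁻¹)
      ((fun θ : EuclideanSpace ℝ (Fin d) => (θ.ofLp : Fin d → ℝ)) '' Θ) : ℝ≥0∞)
      ≤ ((κ * d * Real.log m : ℝ) : EReal)

/-- Linear transitions: for `V : S → [0, H - h - 1]`, one has `ℙ_h V = φ · u` for some `u` with
`‖u‖ ≤ (H - h) √d` (the first step being numbered `0`). -/
def LinearTransition (M : EpisodicMDP S A H) (φ : S → A → EuclideanSpace ℝ (Fin d)) : Prop :=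
  ∀ h < H, ∀ V : S → ℝ, Measurable V → (∀ s, V s ∈ Set.Icc (0 : ℝ) ((H : ℝ) - h - 1)) →
    ∃ u : EuclideanSpace ℝ (Fin d), ‖u‖ ≤ ((H : ℝ) - h) * √(d : ℝ) ∧
      M.transition h V = linFun φ u

/-- Single-policy coverage: with probability at least `1 - δ / 2`,
`Λ_h ⪰ cdag n E_π[φ(s_h, a_h) φ(s_h, a_h)ᵀ]` for all `h`. -/
def Coverage {Ω : Type*} [MeasurableSpace Ω] {n : ℕ} (M : EpisodicMDP S A H)
    (φ : S → A → EuclideanSpace ℝ (Fin d)) (π : Policy S A) (μ : Measure Ω)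
    (D : Ω → Fin n → Fin H → S × A) (cdag δ : ℝ) : Prop :=
  μ {ω | ¬ ∀ h : Fin H,
    (gramMatrix φ (D ω) h - (cdag * n) • M.featureCov φ π h).PosSemidef} ≤
    ENNReal.ofReal (δ / 2)

end Assumptions

end MDP

/-- The penalty parameter `β = C H e^H |A| d √(log (n H / δ))`. -/
noncomputable def dcppoBeta (C : ℝ) (H cardA d n : ℕ) (δ : ℝ) : ℝ :=
  C * (H * Real.exp H * cardA * d * √(Real.log (n * H / δ)))

/-!
Two parts: a deterministic regret bound for pessimistic value iteration, and a high-probability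
proof that the penalties dominate the regression errors.

**From uncertainty quantification to suboptimality.** Pessimism, by backward induction along the
trajectories of `πstar`, bounds the suboptimality by `2 ∑_h E_{πstar} Γ_h`
(`EpisodicMDP.subOpt_le_expSum`). By Jensen's inequality
`E_{πstar} Γ_h ≤ β √(tr ((Λ_h + 1)⁻¹ Σ⋆_h))`, where `Σ⋆_h` is the feature covariance under `πstar`,
and under the coverage assumption the trace is at most `rank Σ⋆_h / (cdag n)`
(`trace_mul_inv_le_rank_div`). The behavior policy charges every action, so the law of a trajectory
under `πstar` is absolutely continuous with respect to the law under the behavior policy, whence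
`rank Σ⋆_h ≤ rank Σ_h` (`EpisodicMDP.rank_featureCov_le`).

**From residuals to uncertainty quantification.** Let `v = ŵ_h + ũ_h - w_h - u_h` be the error of
the two ridge regressions with respect to the parameters of `r_h` and of `ℙ_h Ṽ_{h+1}`. The two
regressions have the same Gram matrix, so the sum of the normal equations gives
`∑_i (φ_i · v)² + ‖v‖² = ∑_i (φ_i · v) e_i - v · (w_h + u_h)` with residuals
`e_i = (Q̂_h - Q_h) - γ ℙ_h (V̂_{h+1} - V_{h+1}) + (G(s_{h+1}^i) - ℙ_h G)`, where
`G = Ṽ_{h+1} - γ V̂_{h+1}`. Hence it suffices that `∑_i y_i e_i ≤ ½ ∑_i y_i² + R` for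
`y_i = φ_i · v` (`isUncertaintyQuantifier_of_residual`). If `n ≤ d²`, the bound `|e_i| ≤ 2 H` is
enough. Otherwise `d ≤ n`, and the bias and the noise are controlled on a set of regular datasets,
`GoodData`.

**Bias.** For a fixed parameter `θ`, half the log-likelihood ratio at step `h`, plus the squared
Hellinger distance of the two choice probabilities, has exponential moment at most `1`. The
Hellinger distance may be taken at `s_h`, or at step `h + 1` in conditional expectation given
`(s_h, a_h)`. A union bound over a net of `Θ` and the maximality of the likelihood bound the
in-sample squared errors of the estimated choice probabilities, and of their predictions one step
ahead. Since the values of the action `a₀` vanish, logits in `[0, H]` are `|A| e^H`-Lipschitz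
functions of the choice probabilities (`abs_sub_le_of_softmax`), which transfers the bounds to
`Q̂_h` and `ℙ_h V̂_{h+1}`.

**Noise.** For fixed `v` and `G`, Hoeffding's lemma shows that
`y (G(s_{h+1}) - ℙ_h G) / (2 H²) - y² / (8 H²)`, with `y = φ · v`, has exponential moment at most
`1`. The function `G` and the direction `v` depend on the data only through `2 d + d²` bounded real
numbers (two vectors and the entries of a matrix `(Λ + 1)⁻¹`) and a point of `Θ`. A union bound over
a grid of mesh `(β n³)⁻²`, times a net of `Θ`, costs a logarithm of order
`(1 + κ) d² (log (n H / δ) + log C + H + log |A|)` (`sum_mul_noise_le`), which `β² / H²` dominates for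
large `C` (`constant_le`). The quadratic compensator `y² / (8 H²)` is absorbed by the left-hand
side of the normal equation, so that no self-normalized martingale inequality is needed.
-/

/-! ### The law of the trajectories -/

section TrajLaw

variable {S A : Type*} [MeasurableSpace S] [MeasurableSpace A] [Fintype A] {H : ℕ}

theorem measurable_fin_cons_pair {X : Type*} [MeasurableSpace X] (k : ℕ) : Measurable
    fun x : X × (Fin k → X) => (Fin.cons x.1 x.2 : Fin (k + 1) → X) := by
  refine measurable_pi_lambda _ fun i => ?_
  refine Fin.cases ?_ (fun j => ?_) i
  · simpa using measurable_fst
  · simpa [Function.comp_def] using (measurable_pi_apply j).comp measurable_snd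

theorem measurable_fin_cons {X : Type*} [MeasurableSpace X] (k : ℕ) (x : X) :
    Measurable fun τ : Fin k → X => (Fin.cons x τ : Fin (k + 1) → X) :=
  (measurable_fin_cons_pair k).comp (measurable_const.prodMk measurable_id)

theorem abs_sum_fin_le {k : ℕ} {g : Fin k → ℝ} {B : ℝ} (hg : ∀ j, |g j| ≤ B) :
    |∑ j, g j| ≤ k * B := by
  refine (Finset.abs_sum_le_sum_abs _ _).trans ((Finset.sum_le_sum fun j _ => hg j).trans ?_)
  simp

omit [MeasurableSpace A] in
theorem Policy.sum_ofReal_prob (π : Policy S A) (h : ℕ) (s : S) :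
    ∑ a, ENNReal.ofReal (π.prob h s a) = 1 := by
  rw [← ENNReal.ofReal_sum_of_nonneg fun a _ => (π.mem_stdSimplex h s).1 a,
    (π.mem_stdSimplex h s).2, ENNReal.ofReal_one]

namespace EpisodicMDP

variable (M : EpisodicMDP S A H) (π : Policy S A)

theorem measurable_trajLaw_and_isProbabilityMeasure (k h : ℕ) :
    Measurable (M.trajLaw π k h) ∧ ∀ s, IsProbabilityMeasure (M.trajLaw π k h s) := by
  induction k generalizing h with
  | zero => exact ⟨measurable_const, fun s => by rw [trajLaw]; infer_instance⟩
  | succ k ih =>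
    obtain ⟨hm, hp⟩ := ih (h + 1)
    have hP := M.markov h
    have hform : ∀ B, MeasurableSet B → ∀ s, M.trajLaw π (k + 1) h s B = ∑ a,
        ENNReal.ofReal (π.prob h s a) * ∫⁻ s', M.trajLaw π k (h + 1) s'
          {τ | (Fin.cons (s, a) τ : Fin (k + 1) → S × A) ∈ B} ∂(M.P h (s, a)) := by
      intro B hB s
      simp only [trajLaw, Measure.coe_finsetSum, Finset.sum_apply, Measure.smul_apply,
        smul_eq_mul]
      refine Finset.sum_congr rfl fun a _ => ?_
      have hc := measurable_fin_cons (X := S × A) k (s, a)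
      rw [Measure.map_apply hc hB, Measure.bind_apply (hc hB) hm.aemeasurable]
      rfl
    constructor
    · refine Measure.measurable_of_measurable_coe _ fun B hB => ?_
      simp only [hform B hB]
      refine Finset.measurable_sum _ fun a _ => ?_
      refine (ENNReal.measurable_ofReal.comp (π.measurable_prob h a)).mul ?_
      let κ : Kernel S (Fin k → S × A) := ⟨M.trajLaw π k (h + 1), hm⟩
      have hκ : IsMarkovKernel κ := ⟨hp⟩
      let P' : Kernel S S := (M.P h).comap (fun s => (s, a)) (by fun_prop)
      let κ' : Kernel (S × S) (Fin k → S × A) := κ.comap Prod.snd measurable_snd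
      have hset : MeasurableSet {p : (S × S) × (Fin k → S × A) |
          (Fin.cons (p.1.1, a) p.2 : Fin (k + 1) → S × A) ∈ B} := by
        refine (measurable_fin_cons_pair (X := S × A) k).comp
          (?_ : Measurable fun p : (S × S) × (Fin k → S × A) => ((p.1.1, a), p.2)) hB
        fun_prop
      have h1 := Kernel.measurable_kernel_prodMk_left (κ := κ') hset
      exact Measurable.lintegral_kernel_prod_right' (κ := P') h1
    · intro s
      constructor
      rw [hform _ MeasurableSet.univ]
      simp [π.sum_ofReal_prob]

theorem measurable_trajLaw (k h : ℕ) : Measurable (M.trajLaw π k h) :=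
  (M.measurable_trajLaw_and_isProbabilityMeasure π k h).1

instance isProbabilityMeasure_trajLaw (k h : ℕ) (s : S) :
    IsProbabilityMeasure (M.trajLaw π k h s) :=
  (M.measurable_trajLaw_and_isProbabilityMeasure π k h).2 s

theorem lintegral_trajLaw_succ (k h : ℕ) (s : S) {F : (Fin (k + 1) → S × A) → ℝ≥0∞}
    (hF : Measurable F) :
    ∫⁻ τ, F τ ∂(M.trajLaw π (k + 1) h s) = ∑ a, ENNReal.ofReal (π.prob h s a) *
      ∫⁻ s', ∫⁻ τ, F (Fin.cons (s, a) τ) ∂(M.trajLaw π k (h + 1) s') ∂(M.P h (s, a)) := by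
  rw [trajLaw, lintegral_finsetSum_measure]
  refine Finset.sum_congr rfl fun a _ => ?_
  have hc := measurable_fin_cons (X := S × A) k (s, a)
  rw [lintegral_smul_measure, lintegral_map hF hc, smul_eq_mul]
  congr 1
  exact Measure.lintegral_bind (M.measurable_trajLaw π k (h + 1)).aemeasurable
      (hF.comp hc).aemeasurable

theorem integral_trajLaw_succ (k h : ℕ) (s : S) {F : (Fin (k + 1) → S × A) → ℝ}
    (hF : Measurable F) {B : ℝ} (hB : ∀ τ, |F τ| ≤ B) :
    ∫ τ, F τ ∂(M.trajLaw π (k + 1) h s) = ∑ a, π.prob h s a *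
      ∫ s', ∫ τ, F (Fin.cons (s, a) τ) ∂(M.trajLaw π k (h + 1) s') ∂(M.P h (s, a)) := by
  have hP := M.markov h
  have hm := M.measurable_trajLaw π k (h + 1)
  have hc := fun a => measurable_fin_cons (X := S × A) k (s, a)
  let κ : Kernel S (Fin k → S × A) := ⟨M.trajLaw π k (h + 1), hm⟩
  have hκ : IsMarkovKernel κ := ⟨fun s => M.isProbabilityMeasure_trajLaw π k (h + 1) s⟩
  have hbind : ∀ a, IsProbabilityMeasure ((M.P h (s, a)).bind (M.trajLaw π k (h + 1))) :=
    fun a => inferInstanceAs (IsProbabilityMeasure ((M.P h (s, a)).bind κ))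
  rw [trajLaw, integral_finsetSum_measure]
  · refine Finset.sum_congr rfl fun a _ => ?_
    rw [integral_smul_measure, integral_map (hc a).aemeasurable hF.aestronglyMeasurable,
      ENNReal.toReal_ofReal ((π.mem_stdSimplex h s).1 a), smul_eq_mul]
    congr 1
    refine Kernel.integral_comp (η := κ) (κ := Kernel.const Unit (M.P h (s, a))) (a := ()) ?_
    have hbind' := hbind a
    change Integrable _ ((M.P h (s, a)).bind (M.trajLaw π k (h + 1)))
    exact Integrable.of_bound (hF.comp (hc a)).aestronglyMeasurable B
      (Filter.Eventually.of_forall fun τ => by simpa using hB _)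
  · intro a _
    have hmap : IsProbabilityMeasure (((M.P h (s, a)).bind (M.trajLaw π k (h + 1))).map
        fun τ => (Fin.cons (s, a) τ : Fin (k + 1) → S × A)) :=
      Measure.isProbabilityMeasure_map (hc a).aemeasurable
    refine Integrable.smul_measure ?_ ENNReal.ofReal_ne_top
    exact Integrable.of_bound hF.aestronglyMeasurable B
      (Filter.Eventually.of_forall fun τ => by simpa using hB _)

/-- The Markov property, in the form used for exponential moments: a bound by `1` of the
integral of a functional of the trajectory after `j` steps, whatever the state at that time, is a
bound of its integral over the whole trajectory. -/
theorem lintegral_trajLaw_le_one_of_tail {k : ℕ} {F : (Fin k → S × A) → ℝ≥0∞} (hF : Measurable F)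
    (j h : ℕ) (G : (Fin (k + j) → S × A) → ℝ≥0∞)
    (hG : ∀ τ, G τ = F fun i => τ ⟨i + j, by omega⟩)
    (hle : ∀ s, ∫⁻ τ, F τ ∂(M.trajLaw π k (h + j) s) ≤ 1) (s : S) :
    ∫⁻ τ, G τ ∂(M.trajLaw π (k + j) h s) ≤ 1 := by
  induction j generalizing h s with
  | zero => simpa [hG] using hle s
  | succ j ih =>
    have hGm : Measurable G := by
      rw [show G = fun τ => F fun i => τ ⟨i + (j + 1), by omega⟩ from funext hG]
      exact hF.comp (measurable_pi_lambda _ fun i => measurable_pi_apply _)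
    have h1 := M.lintegral_trajLaw_succ π (k + j) h s hGm
    refine h1.trans_le ?_
    have hP := M.markov h
    calc _ ≤ ∑ a, ENNReal.ofReal (π.prob h s a) * 1 := by
          refine Finset.sum_le_sum fun a _ => mul_le_mul_right ?_ _
          refine (lintegral_mono (g := fun _ => 1) fun s' => ?_).trans (by simp)
          refine ih (h + 1) (fun τ => G (Fin.cons (s, a) τ)) (fun τ => ?_) (fun s => ?_) s'
          · rw [hG]; rfl
          · have := hle s
            rwa [show h + 1 + j = h + (j + 1) by omega]
      _ = 1 := by simp [π.sum_ofReal_prob]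

/-- The law of the trajectories of a policy is absolutely continuous with respect to that of any
policy that chooses every action with positive probability. -/
theorem trajLaw_absolutelyContinuous (π' : Policy S A) (k h : ℕ)
    (hpos : ∀ j < k, ∀ s a, 0 < π'.prob (h + j) s a) (s : S) :
    M.trajLaw π k h s ≪ M.trajLaw π' k h s := by
  induction k generalizing h s with
  | zero => rw [trajLaw, trajLaw]
  | succ k ih =>
    refine Measure.AbsolutelyContinuous.mk fun B hB h0 => ?_
    rw [← lintegral_indicator_one hB,
      lintegral_trajLaw_succ _ _ _ _ _ (measurable_one.indicator hB)] at h0 ⊢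
    rw [Finset.sum_eq_zero_iff] at h0 ⊢
    intro a ha
    have hp := hpos 0 (by omega) s a
    have h1 := (mul_eq_zero.1 (h0 a ha)).resolve_left
      (by simpa using hp)
    have hc := measurable_fin_cons (X := S × A) k (s, a)
    have hs : MeasurableSet {τ : Fin k → S × A | (Fin.cons (s, a) τ : Fin (k + 1) → S × A) ∈ B} :=
      hc hB
    have key : ∀ (π : Policy S A) s', ∫⁻ τ, B.indicator (1 : (Fin (k + 1) → S × A) → ℝ≥0∞)
        (Fin.cons (s, a) τ) ∂(M.trajLaw π k (h + 1) s') = M.trajLaw π k (h + 1) s'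
          {τ : Fin k → S × A | (Fin.cons (s, a) τ : Fin (k + 1) → S × A) ∈ B} := by
      intro π s'
      rw [← lintegral_indicator_one hs]
      rfl
    simp only [key] at h1 ⊢
    have h1' := (lintegral_eq_zero_iff
      ((Measure.measurable_coe hs).comp (M.measurable_trajLaw π' k (h + 1)))).1 h1
    refine mul_eq_zero.2 (Or.inr ?_)
    refine (lintegral_congr_ae (g := 0) ?_).trans (by simp)
    filter_upwards [h1'] with s' hs'
    exact ih (h + 1) (fun j hj s a => by
      have := hpos (j + 1) (by omega) s a
      rwa [show h + 1 + j = h + (j + 1) by omega]) s' hs'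

/-! ### Additive functionals of the trajectory -/

/-- The expectation of `∑_{t = h}^{h + k - 1} f_t(s_t, a_t)` when `s_h = s` and `π` is
followed. -/
noncomputable def expSum (f : ℕ → S → A → ℝ) (k h : ℕ) (s : S) : ℝ :=
  ∫ τ, ∑ j : Fin k, f (h + j) (τ j).1 (τ j).2 ∂(M.trajLaw π k h s)

theorem value_eq_expSum (h : ℕ) (s : S) : M.value π h s = M.expSum π M.r (H - h) h s := rfl

variable [MeasurableSingletonClass A]

theorem measurable_expSum {f : ℕ → S → A → ℝ} (hf : ∀ t a, Measurable fun s => f t s a)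
    (k h : ℕ) : Measurable (M.expSum π f k h) := by
  let κ : Kernel S (Fin k → S × A) := ⟨M.trajLaw π k h, M.measurable_trajLaw π k h⟩
  have hκ : IsMarkovKernel κ := ⟨fun s => M.isProbabilityMeasure_trajLaw π k h s⟩
  have hm : ∀ t, Measurable fun p : S × A => f t p.1 p.2 := fun t =>
    measurable_from_prod_countable_left fun a => hf t a
  have hF : Measurable fun τ : Fin k → S × A => ∑ j : Fin k, f (h + j) (τ j).1 (τ j).2 :=
    Finset.measurable_sum _ fun j _ => (hm _).comp (measurable_pi_apply j)
  exact (hF.stronglyMeasurable.integral_kernel (κ := κ)).measurable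

omit [MeasurableSingletonClass A] in
theorem abs_expSum_le {f : ℕ → S → A → ℝ} {B : ℝ} (k h : ℕ)
    (hB : ∀ j < k, ∀ s a, |f (h + j) s a| ≤ B) (s : S) : |M.expSum π f k h s| ≤ k * B := by
  have := norm_integral_le_of_norm_le_const (μ := M.trajLaw π k h s) (C := k * B)
    (f := fun τ => ∑ j : Fin k, f (h + j) (τ j).1 (τ j).2)
    (Filter.Eventually.of_forall fun τ => abs_sum_fin_le fun j => hB j j.2 _ _)
  simpa [expSum] using this

/-- The Bellman equation. -/
theorem expSum_succ {f : ℕ → S → A → ℝ} (hf : ∀ t a, Measurable fun s => f t s a) {B : ℝ}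
    (k h : ℕ) (hB : ∀ j < k + 1, ∀ s a, |f (h + j) s a| ≤ B) (s : S) :
    M.expSum π f (k + 1) h s = ∑ a, π.prob h s a *
      (f h s a + M.transition h (M.expSum π f k (h + 1)) s a) := by
  have hP := M.markov h
  have hm : ∀ t, Measurable fun p : S × A => f t p.1 p.2 := fun t =>
    measurable_from_prod_countable_left fun a => hf t a
  have hB' : ∀ j < k, ∀ s a, |f (h + 1 + j) s a| ≤ B := fun j hj s a => by
    have := hB (j + 1) (by omega) s a
    rwa [show h + 1 + j = h + (j + 1) by omega]
  have hF : Measurable fun τ : Fin (k + 1) → S × A =>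
      ∑ j : Fin (k + 1), f (h + j) (τ j).1 (τ j).2 :=
    Finset.measurable_sum _ fun j _ => (hm _).comp (measurable_pi_apply j)
  rw [expSum, M.integral_trajLaw_succ π k h s (B := (k + 1) * B) hF]
  · refine Finset.sum_congr rfl fun a _ => ?_
    congr 1
    have h1 : ∀ s', ∫ τ, ∑ j : Fin (k + 1), f (h + j)
        ((Fin.cons (s, a) τ : Fin (k + 1) → S × A) j).1
        ((Fin.cons (s, a) τ : Fin (k + 1) → S × A) j).2 ∂(M.trajLaw π k (h + 1) s')
        = f h s a + M.expSum π f k (h + 1) s' := by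
      intro s'
      simp only [Fin.sum_univ_succ, Fin.cons_zero, Fin.cons_succ, Fin.val_zero, Fin.val_succ,
        add_zero]
      rw [integral_add (integrable_const _)]
      · simp only [integral_const, probReal_univ, one_smul, expSum]
        congr 1
        refine integral_congr_ae (Filter.Eventually.of_forall fun τ => ?_)
        exact Finset.sum_congr rfl fun j _ => by rw [show h + ((j : ℕ) + 1) = h + 1 + j by omega]
      · refine Integrable.of_bound (Finset.measurable_sum _ fun j _ =>
          (hm _).comp (measurable_pi_apply j)).aestronglyMeasurable (k * B)
          (Filter.Eventually.of_forall fun τ => abs_sum_fin_le fun j =>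
            hB (j + 1) (by have := j.2; omega) _ _)
    simp only [h1]
    rw [integral_add (integrable_const _)]
    · simp [transition]
    · exact Integrable.of_bound (M.measurable_expSum π hf k (h + 1)).aestronglyMeasurable (k * B)
        (Filter.Eventually.of_forall fun s' => M.abs_expSum_le π k (h + 1) hB' s')
  · intro τ
    exact_mod_cast abs_sum_fin_le fun j => hB j j.2 _ _

end EpisodicMDP
end TrajLaw

/-! ### Positive definite matrices -/

section LinearAlgebra

open Matrix

variable {ι : Type*} [Fintype ι] [DecidableEq ι]

omit [DecidableEq ι] in
theorem inner_eq_dotProduct (x y : EuclideanSpace ℝ ι) :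
    inner ℝ x y = x.ofLp ⬝ᵥ y.ofLp := by
  simp [PiLp.inner_apply, dotProduct, mul_comm]

open scoped MatrixOrder in
/-- After conjugation by a square root of `M⁻¹`, the matrix `N` becomes a positive semidefinite
matrix with eigenvalues at most `1 / a`. -/
theorem trace_mul_inv_le_rank_div {M N : Matrix ι ι ℝ} (hM : M.PosDef) (hN : N.PosSemidef)
    {a : ℝ} (ha : 0 < a) (hMN : (M - a • N).PosSemidef) :
    (N * M⁻¹).trace ≤ N.rank / a := by
  obtain ⟨B, hB⟩ := CStarAlgebra.nonneg_iff_eq_star_mul_self.mp hM.inv.posSemidef.nonneg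
  rw [star_eq_conjTranspose] at hB
  have hMu : IsUnit M.det := (isUnit_iff_isUnit_det _).1 hM.isUnit
  have hBM : (B * M) * Bᴴ = 1 := by
    have h1 : Bᴴ * (B * M) = 1 := by rw [← Matrix.mul_assoc, ← hB, nonsing_inv_mul _ hMu]
    exact mul_eq_one_comm.1 h1
  set N' := B * N * Bᴴ with hN'
  have hN'p : N'.PosSemidef := hN.mul_mul_conjTranspose_same B
  have htr : (N * M⁻¹).trace = N'.trace := by
    rw [hB, hN', Matrix.trace_mul_comm, Matrix.mul_assoc, Matrix.trace_mul_comm]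
  have h1 : (1 - a • N').PosSemidef := by
    have := hMN.mul_mul_conjTranspose_same B
    rwa [Matrix.mul_sub, Matrix.sub_mul, hBM, Matrix.mul_smul, Matrix.smul_mul] at this
  have hev : ∀ i, hN'p.1.eigenvalues i ≤ 1 / a := by
    intro i
    have h2 := h1.dotProduct_mulVec_nonneg ((hN'p.1.eigenvectorBasis i).ofLp)
    have h3 : (hN'p.1.eigenvectorBasis i).ofLp ⬝ᵥ (hN'p.1.eigenvectorBasis i).ofLp = 1 := by
      have h4 := hN'p.1.eigenvectorBasis.orthonormal.1 i
      have h5 := real_inner_self_eq_norm_sq (hN'p.1.eigenvectorBasis i)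
      rwa [h4, one_pow, inner_eq_dotProduct] at h5
    rw [Matrix.sub_mulVec, one_mulVec, Matrix.smul_mulVec, hN'p.1.mulVec_eigenvectorBasis,
      dotProduct_sub, dotProduct_smul, dotProduct_smul] at h2
    simp only [star_trivial, h3, smul_eq_mul, mul_one] at h2
    rw [le_div_iff₀ ha]
    linarith
  have hrank : N'.rank ≤ N.rank :=
    (rank_mul_le_left _ _).trans (rank_mul_le_right _ _)
  rw [htr, hN'p.1.trace_eq_sum_eigenvalues]
  calc ∑ i, ((hN'p.1.eigenvalues i : ℝ) : ℝ)
      ≤ ∑ i, if hN'p.1.eigenvalues i ≠ 0 then 1 / a else 0 := by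
        refine Finset.sum_le_sum fun i _ => ?_
        split_ifs with h
        · exact hev i
        · push Not at h; exact h.le
    _ = N'.rank * (1 / a) := by
        rw [hN'p.1.rank_eq_card_non_zero_eigs, Fintype.card_subtype, ← Finset.sum_filter,
          Finset.sum_const, nsmul_eq_mul]
    _ ≤ N.rank / a := by
        rw [mul_one_div]
        gcongr

/-- The Cauchy-Schwarz inequality for the dual norms given by a positive definite matrix and its
inverse. -/
theorem dotProduct_sq_le_inv_mul {M : Matrix ι ι ℝ} (hM : M.PosDef) (x v : ι → ℝ) :
    (x ⬝ᵥ v) ^ 2 ≤ (x ⬝ᵥ M⁻¹ *ᵥ x) * (v ⬝ᵥ M *ᵥ v) := by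
  have hMu : IsUnit M.det := (isUnit_iff_isUnit_det _).1 hM.isUnit
  have hMt : Mᵀ = M := hM.1
  set y := M⁻¹ *ᵥ x with hy
  have hx : M *ᵥ y = x := by rw [hy, mulVec_mulVec, mul_nonsing_inv _ hMu, one_mulVec]
  have hsymm : ∀ a b : ι → ℝ, a ⬝ᵥ M *ᵥ b = b ⬝ᵥ M *ᵥ a := fun a b => by
    rw [dotProduct_mulVec, ← mulVec_transpose, hMt, dotProduct_comm]
  -- the quadratic form of `M` at `v + t • y` is a nonnegative polynomial in `t`
  have hq : ∀ t : ℝ, 0 ≤ (y ⬝ᵥ M *ᵥ y) * (t * t) + (2 * (v ⬝ᵥ M *ᵥ y)) * t + v ⬝ᵥ M *ᵥ v := by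
    intro t
    have h1 := hM.posSemidef.dotProduct_mulVec_nonneg (v + t • y)
    simp only [star_trivial, mulVec_add, mulVec_smul, dotProduct_add, add_dotProduct,
      smul_dotProduct, dotProduct_smul, smul_eq_mul, hsymm y v] at h1
    linarith
  have h2 := discrim_le_zero hq
  rw [discrim, hx] at h2
  rw [dotProduct_comm x v, dotProduct_comm x y]
  nlinarith

/-- The inverse of a matrix `M ⪰ 1` has entries in `[-1, 1]`. -/
theorem abs_inv_apply_le_one {M : Matrix ι ι ℝ} (hM : (M - 1).PosSemidef) (i j : ι) :
    |M⁻¹ i j| ≤ 1 := by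
  have hMp : M.PosDef := by
    have := (PosDef.one (n := ι) (R := ℝ)).add_posSemidef hM
    rwa [add_sub_cancel] at this
  have hMu : IsUnit M.det := (isUnit_iff_isUnit_det _).1 hMp.isUnit
  set x : ι → ℝ := Pi.single j 1
  set y := M⁻¹ *ᵥ x with hy
  have hyi : ∀ i, y i = M⁻¹ i j := fun i => by simp [hy, x]
  have hx : M *ᵥ y = x := by rw [hy, mulVec_mulVec, mul_nonsing_inv _ hMu, one_mulVec]
  have h1 := hM.dotProduct_mulVec_nonneg y
  rw [Matrix.sub_mulVec, one_mulVec, hx, dotProduct_sub, sub_nonneg, star_trivial] at h1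
  have h2 : y ⬝ᵥ x = y j := by simp [x]
  have h3 : ∀ i, y i ^ 2 ≤ y ⬝ᵥ y := fun i => by
    rw [dotProduct, pow_two]
    exact Finset.single_le_sum (f := fun i => y i * y i) (fun i _ => mul_self_nonneg _)
      (Finset.mem_univ i)
  rw [← hyi, abs_le]
  rw [h2] at h1
  have h4 := h3 j
  have h5 : y j ≤ 1 := by nlinarith
  have := h3 i
  constructor <;> nlinarith

omit [DecidableEq ι] in
/-- A matrix whose kernel contains that of another one has at most its rank. -/
theorem rank_le_rank_of_ker_le {M N : Matrix ι ι ℝ} (h : ∀ x, N *ᵥ x = 0 → M *ᵥ x = 0) :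
    M.rank ≤ N.rank := by
  have h1 := LinearMap.finrank_range_add_finrank_ker M.mulVecLin
  have h2 := LinearMap.finrank_range_add_finrank_ker N.mulVecLin
  have h3 : LinearMap.ker N.mulVecLin ≤ LinearMap.ker M.mulVecLin := fun x hx => by
    simpa using h x (by simpa using hx)
  have h4 := Submodule.finrank_mono h3
  rw [Matrix.rank, Matrix.rank]
  omega

end LinearAlgebra

section Gram

open Matrix

variable {S A : Type*} {H d n : ℕ}

theorem dotProduct_gramMatrix_mulVec
    (φ : S → A → EuclideanSpace ℝ (Fin d))
    (D : Fin n → Fin H → S × A) (h : Fin H) (v : EuclideanSpace ℝ (Fin d)) :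
    v.ofLp ⬝ᵥ gramMatrix φ D h *ᵥ v.ofLp = ∑ i, (linFun φ v (D i h).1 (D i h).2) ^ 2 := by
  simp only [gramMatrix, Matrix.sum_mulVec, dotProduct_sum]
  refine Finset.sum_congr rfl fun i _ => ?_
  rw [vecMulVec_mulVec, linFun, inner_eq_dotProduct, dotProduct_smul]
  simp [pow_two, dotProduct_comm]

theorem posSemidef_gramMatrix
    (φ : S → A → EuclideanSpace ℝ (Fin d))
    (D : Fin n → Fin H → S × A) (h : Fin H) : (gramMatrix φ D h).PosSemidef :=
  posSemidef_sum _ fun i _ => by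
    simpa using posSemidef_vecMulVec_self_star (R := ℝ) (φ (D i h).1 (D i h).2).ofLp

theorem posDef_gramMatrix_add
    (φ : S → A → EuclideanSpace ℝ (Fin d))
    (D : Fin n → Fin H → S × A) (h : Fin H) :
    (gramMatrix φ D h + (1 : ℝ) • (1 : Matrix (Fin d) (Fin d) ℝ)).PosDef := by
  rw [one_smul]
  exact PosDef.posSemidef_add (posSemidef_gramMatrix φ D h) PosDef.one

/-- A linear function `φ · v` is dominated by the penalty as soon as the norm of `v` given by
`Λ_h + 1` is at most `β`. -/
theorem abs_linFun_le_penalty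
    (φ : S → A → EuclideanSpace ℝ (Fin d))
    (D : Fin n → Fin H → S × A) (h : Fin H) {β : ℝ} (hβ : 0 ≤ β) (v : EuclideanSpace ℝ (Fin d))
    (hv : ∑ i, (linFun φ v (D i h).1 (D i h).2) ^ 2 + ‖v‖ ^ 2 ≤ β ^ 2) (s : S) (a : A) :
    |linFun φ v s a| ≤ penalty φ 1 β D h s a := by
  have hM := posDef_gramMatrix_add φ D h
  have h1 := dotProduct_sq_le_inv_mul hM (φ s a).ofLp v.ofLp
  have h2 : v.ofLp ⬝ᵥ (gramMatrix φ D h + (1 : ℝ) • (1 : Matrix (Fin d) (Fin d) ℝ)) *ᵥ v.ofLp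
      ≤ β ^ 2 := by
    rwa [one_smul, Matrix.add_mulVec, dotProduct_add, dotProduct_gramMatrix_mulVec, one_mulVec,
      ← inner_eq_dotProduct, real_inner_self_eq_norm_sq]
  have h3 := hM.inv.posSemidef.dotProduct_mulVec_nonneg (φ s a).ofLp
  rw [star_trivial] at h3
  refine abs_le_of_sq_le_sq' ?_ (mul_nonneg hβ (Real.sqrt_nonneg _)) |> abs_le.2
  rw [penalty, mul_pow, Real.sq_sqrt h3, linFun, inner_eq_dotProduct]
  nlinarith

end Gram

/-! ### Suboptimality of pessimistic policies -/

section Pessimism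

variable {S A : Type*} [MeasurableSpace S] [MeasurableSpace A] {H : ℕ}

namespace EpisodicMDP

variable (M : EpisodicMDP S A H)

theorem integrable_of_bound_kernel (h : ℕ) (s : S) (a : A) {f : S → ℝ} (hf : Measurable f) {B : ℝ}
    (hB : ∀ s, |f s| ≤ B) : Integrable f (M.P h (s, a)) := by
  have := M.markov h
  exact Integrable.of_bound hf.aestronglyMeasurable B (Filter.Eventually.of_forall hB)

theorem transition_mono (h : ℕ) (s : S) (a : A) {f g : S → ℝ} (hf : Measurable f)
    (hg : Measurable g) {B : ℝ} (hfB : ∀ s, |f s| ≤ B) (hgB : ∀ s, |g s| ≤ B)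
    (hfg : ∀ s, f s ≤ g s) : M.transition h f s a ≤ M.transition h g s a :=
  integral_mono (M.integrable_of_bound_kernel h s a hf hfB)
    (M.integrable_of_bound_kernel h s a hg hgB) hfg

theorem transition_add (h : ℕ) (s : S) (a : A) {f g : S → ℝ} (hf : Measurable f)
    (hg : Measurable g) {B : ℝ} (hfB : ∀ s, |f s| ≤ B) (hgB : ∀ s, |g s| ≤ B) :
    M.transition h (fun s => f s + g s) s a = M.transition h f s a + M.transition h g s a :=
  integral_add (M.integrable_of_bound_kernel h s a hf hfB)
    (M.integrable_of_bound_kernel h s a hg hgB)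

theorem transition_const_mul (h : ℕ) (s : S) (a : A) (c : ℝ) (f : S → ℝ) :
    M.transition h (fun s => c * f s) s a = c * M.transition h f s a :=
  integral_const_mul c f

theorem transition_sub (h : ℕ) (s : S) (a : A) {f g : S → ℝ} (hf : Measurable f)
    (hg : Measurable g) {B : ℝ} (hfB : ∀ s, |f s| ≤ B) (hgB : ∀ s, |g s| ≤ B) :
    M.transition h (fun s => f s - g s) s a = M.transition h f s a - M.transition h g s a :=
  integral_sub (M.integrable_of_bound_kernel h s a hf hfB)
    (M.integrable_of_bound_kernel h s a hg hgB)

theorem transition_mem_Icc (h : ℕ) (s : S) (a : A) {f : S → ℝ} (hf : Measurable f) {b c : ℝ}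
    (hfb : ∀ s, f s ∈ Set.Icc b c) : M.transition h f s a ∈ Set.Icc b c := by
  have := M.markov h
  have hi := M.integrable_of_bound_kernel h s a hf (B := max |b| |c|)
    fun s => abs_le_max_abs_abs (hfb s).1 (hfb s).2
  have h1 := integral_mono (integrable_const b) hi fun s => (hfb s).1
  have h2 := integral_mono hi (integrable_const c) fun s => (hfb s).2
  simp only [integral_const, probReal_univ, one_smul] at h1 h2
  exact ⟨h1, h2⟩

theorem abs_transition_le (h : ℕ) (s : S) (a : A) {f : S → ℝ} (hf : Measurable f) {B : ℝ}
    (hB : ∀ s, |f s| ≤ B) : |M.transition h f s a| ≤ B :=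
  abs_le.2 (M.transition_mem_Icc h s a hf fun s => abs_le.1 (hB s))

variable [Fintype A] [MeasurableSingletonClass A]

/-- Pessimism: if `Q h` underestimates `r_h + ℙ_h V_{h+1}` by at most `2 Γ_h` and `π` is greedy
with respect to `Q`, with value `V`, then the suboptimality of `π` relative to any policy `π'` is
at most the expectation of `∑_h 2 Γ_h` under `π'`. -/
theorem subOpt_le_expSum (π π' : Policy S A) {Q Γ : ℕ → S → A → ℝ} {V : ℕ → S → ℝ}
    (hV : ∀ h, Measurable (V h)) (hVB : ∀ h s, |V h s| ≤ H) (hVH : ∀ s, V H s = 0)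
    (hΓ : ∀ h a, Measurable fun s => Γ h s a) {B : ℝ} (hΓB : ∀ h s a, |Γ h s a| ≤ B)
    (hVQ : ∀ h < H, ∀ s, V h s = ∑ a, Q h s a * π.prob h s a)
    (hgreedy : ∀ h < H, ∀ s, ∀ p ∈ stdSimplex ℝ A, ∑ a, Q h s a * p a ≤ V h s)
    (hupper : ∀ h < H, ∀ s a, Q h s a ≤ M.r h s a + M.transition h (V (h + 1)) s a)
    (hlower : ∀ h < H, ∀ s a,
      M.r h s a + M.transition h (V (h + 1)) s a - 2 * Γ h s a ≤ Q h s a) :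
    M.subOpt π' π ≤ M.expSum π' (fun h s a => 2 * Γ h s a) H 0 M.s₀ := by
  have hrB : ∀ k h, k + h = H → ∀ j < k, ∀ s a, |M.r (h + j) s a| ≤ 1 := fun k h hk j hj s a => by
    obtain ⟨h0, h1⟩ := M.r_mem (h + j) (by omega) s a
    rwa [abs_of_nonneg h0]
  have hexpB : ∀ (π : Policy S A) k h, k + h = H → ∀ s, |M.expSum π M.r k h s| ≤ H := by
    intro π k h hk s
    refine (M.abs_expSum_le π k h (hrB k h hk) s).trans ?_
    rw [mul_one]
    exact_mod_cast (by omega : k ≤ H)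
  have hΓm : ∀ h a, Measurable fun s => 2 * Γ h s a := fun h a => (hΓ h a).const_mul 2
  have hΓB' : ∀ h s a, |2 * Γ h s a| ≤ 2 * B := fun h s a => by
    rw [abs_mul, abs_two]
    exact mul_le_mul_of_nonneg_left (hΓB h s a) zero_le_two
  -- pessimism: `V` is a lower bound of the value of `π`
  have h1 : ∀ k h, k + h = H → ∀ s, V h s ≤ M.expSum π M.r k h s := by
    intro k
    induction k with
    | zero =>
      intro h hk s
      obtain rfl : h = H := by omega
      simp [expSum, hVH]
    | succ k ih =>
      intro h hk s
      rw [M.expSum_succ π M.measurable_r k h (hrB (k + 1) h hk), hVQ h (by omega)]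
      refine Finset.sum_le_sum fun a _ => ?_
      rw [mul_comm]
      refine mul_le_mul_of_nonneg_left ?_ ((π.mem_stdSimplex h s).1 a)
      refine (hupper h (by omega) s a).trans (add_le_add_right ?_ _)
      exact M.transition_mono h s a (hV _) (M.measurable_expSum π M.measurable_r _ _) (hVB _)
        (hexpB π k (h + 1) (by omega)) (ih (h + 1) (by omega))
  -- greediness: `V` plus the expected penalties is an upper bound of the value of `π'`
  have h2 : ∀ k h, k + h = H → ∀ s, M.expSum π' M.r k h s ≤
      V h s + M.expSum π' (fun h s a => 2 * Γ h s a) k h s := by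
    intro k
    induction k with
    | zero =>
      intro h hk s
      obtain rfl : h = H := by omega
      simp [expSum, hVH]
    | succ k ih =>
      intro h hk s
      rw [M.expSum_succ π' M.measurable_r k h (hrB (k + 1) h hk),
        M.expSum_succ π' hΓm k h (B := 2 * B) fun j _ => hΓB' _]
      refine le_trans ?_ (add_le_add_left
        (hgreedy h (by omega) s _ (π'.mem_stdSimplex h s)) _)
      rw [← Finset.sum_add_distrib]
      refine Finset.sum_le_sum fun a _ => ?_
      rw [mul_comm (Q h s a), ← mul_add]
      refine mul_le_mul_of_nonneg_left ?_ ((π'.mem_stdSimplex h s).1 a)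
      have h3 := hlower h (by omega) s a
      have hgB : ∀ s, |M.expSum π' (fun h s a => 2 * Γ h s a) k (h + 1) s| ≤ k * (2 * B) :=
        M.abs_expSum_le π' k (h + 1) fun j _ => hΓB' _
      have hgm := M.measurable_expSum π' hΓm k (h + 1)
      have hmax1 : ∀ s, |V (h + 1) s| ≤ max (H : ℝ) (k * (2 * B)) := fun s =>
        (hVB _ s).trans (le_max_left _ _)
      have hmax2 := fun s => (hgB s).trans (le_max_right (H : ℝ) ((k : ℝ) * (2 * B)))
      have h4 := M.transition_mono h s a
        (B := H + max (H : ℝ) (k * (2 * B)) + max (H : ℝ) (k * (2 * B)))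
        (M.measurable_expSum π' M.measurable_r k (h + 1)) ((hV (h + 1)).add hgm) (fun s => by
          have := hexpB π' k (h + 1) (by omega) s
          have : (0 : ℝ) ≤ max (H : ℝ) (k * (2 * B)) := le_max_of_le_left (Nat.cast_nonneg _)
          linarith) (fun s => by
          have := (abs_add_le _ _).trans (add_le_add (hmax1 s) (hmax2 s))
          have : (0 : ℝ) ≤ H := Nat.cast_nonneg _
          simp only [Pi.add_apply]
          linarith) (ih (h + 1) (by omega))
      have h5 := M.transition_add h s a (hV (h + 1)) hgm hmax1 hmax2
      simp only [Pi.add_def] at h4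
      linarith
  have h3 := h1 H 0 (by omega) M.s₀
  have h4 := h2 H 0 (by omega) M.s₀
  rw [subOpt, value_eq_expSum, value_eq_expSum]
  simp only [Nat.sub_zero]
  linarith

end EpisodicMDP

/-! ### Feature covariances -/

namespace EpisodicMDP

open Matrix

variable (M : EpisodicMDP S A H) [Fintype A] [MeasurableSingletonClass A] {d : ℕ}
  {φ : S → A → EuclideanSpace ℝ (Fin d)}

theorem measurable_feature (hφ : ∀ a, Measurable fun s => φ s a) (i : Fin d) :
    Measurable fun p : S × A => φ p.1 p.2 i := by
  have h1 : Measurable fun p : S × A => φ p.1 p.2 := measurable_from_prod_countable_left hφ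
  exact (measurable_pi_apply i).comp ((by fun_prop : Measurable
    fun x : EuclideanSpace ℝ (Fin d) => (x.ofLp : Fin d → ℝ)).comp h1)

omit [MeasurableSpace S] [MeasurableSpace A] [Fintype A] [MeasurableSingletonClass A] in
theorem abs_feature_le (hφ1 : ∀ s a, ‖φ s a‖ ≤ 1) (s : S) (a : A) (i : Fin d) :
    |φ s a i| ≤ 1 :=
  (PiLp.norm_apply_le (φ s a) i).trans (hφ1 s a)

theorem integrable_feature_mul (hφ : ∀ a, Measurable fun s => φ s a)
    (hφ1 : ∀ s a, ‖φ s a‖ ≤ 1) (π : Policy S A) (h : Fin H) (i j : Fin d) :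
    Integrable (fun τ : Fin H → S × A => φ (τ h).1 (τ h).2 i * φ (τ h).1 (τ h).2 j)
      (M.trajLaw π H 0 M.s₀) := by
  refine Integrable.of_bound (C := 1) ?_ (Filter.Eventually.of_forall fun τ => ?_)
  · exact (((measurable_feature hφ i).comp (measurable_pi_apply h)).mul
      ((measurable_feature hφ j).comp (measurable_pi_apply h))).aestronglyMeasurable
  · rw [Real.norm_eq_abs, abs_mul]
    exact mul_le_one₀ (abs_feature_le hφ1 _ _ _) (abs_nonneg _) (abs_feature_le hφ1 _ _ _)

theorem quadForm_eq_sum (B : Matrix (Fin d) (Fin d) ℝ) (x : Fin d → ℝ) :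
    x ⬝ᵥ B *ᵥ x = ∑ i, ∑ j, B i j * (x i * x j) := by
  simp only [dotProduct, mulVec, Finset.mul_sum]
  exact Finset.sum_congr rfl fun i _ => Finset.sum_congr rfl fun j _ => by ring

theorem integrable_quadForm (hφ : ∀ a, Measurable fun s => φ s a)
    (hφ1 : ∀ s a, ‖φ s a‖ ≤ 1) (π : Policy S A) (h : Fin H) (B : Matrix (Fin d) (Fin d) ℝ) :
    Integrable (fun τ : Fin H → S × A =>
      (φ (τ h).1 (τ h).2).ofLp ⬝ᵥ B *ᵥ (φ (τ h).1 (τ h).2).ofLp) (M.trajLaw π H 0 M.s₀) := by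
  simp only [quadForm_eq_sum]
  exact integrable_finsetSum _ fun i _ => integrable_finsetSum _ fun j _ =>
    (M.integrable_feature_mul hφ hφ1 π h i j).const_mul _

theorem integral_quadForm (hφ : ∀ a, Measurable fun s => φ s a)
    (hφ1 : ∀ s a, ‖φ s a‖ ≤ 1) (π : Policy S A) (h : Fin H) (B : Matrix (Fin d) (Fin d) ℝ) :
    ∫ τ, (φ (τ h).1 (τ h).2).ofLp ⬝ᵥ B *ᵥ (φ (τ h).1 (τ h).2).ofLp ∂(M.trajLaw π H 0 M.s₀) =
      (M.featureCov φ π h * B).trace := by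
  have hi := fun i j => (M.integrable_feature_mul hφ hφ1 π h i j).const_mul (B i j)
  simp only [quadForm_eq_sum]
  rw [integral_finsetSum _ fun i _ => integrable_finsetSum _ fun j _ => hi i j]
  simp only [integral_finsetSum _ fun j _ => hi _ j, integral_const_mul]
  rw [Finset.sum_comm]
  simp only [Matrix.trace, Matrix.diag, Matrix.mul_apply, featureCov, Matrix.of_apply]
  refine Finset.sum_congr rfl fun i _ => Finset.sum_congr rfl fun j _ => ?_
  rw [mul_comm]
  congr 1
  simp only [mul_comm]

theorem dotProduct_featureCov_mulVec (hφ : ∀ a, Measurable fun s => φ s a)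
    (hφ1 : ∀ s a, ‖φ s a‖ ≤ 1) (π : Policy S A) (h : Fin H) (x : Fin d → ℝ) :
    x ⬝ᵥ M.featureCov φ π h *ᵥ x =
      ∫ τ, ((φ (τ h).1 (τ h).2).ofLp ⬝ᵥ x) ^ 2 ∂(M.trajLaw π H 0 M.s₀) := by
  have h1 : ∀ y : Fin d → ℝ, (y ⬝ᵥ x) ^ 2 = y ⬝ᵥ vecMulVec x x *ᵥ y := fun y => by
    rw [vecMulVec_mulVec, dotProduct_smul, dotProduct_comm x y]
    simp [pow_two]
  simp only [h1]
  rw [M.integral_quadForm hφ hφ1, mul_vecMulVec, trace_vecMulVec, dotProduct_comm]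

theorem posSemidef_featureCov (hφ : ∀ a, Measurable fun s => φ s a)
    (hφ1 : ∀ s a, ‖φ s a‖ ≤ 1) (π : Policy S A) (h : Fin H) :
    (M.featureCov φ π h).PosSemidef := by
  refine PosSemidef.of_dotProduct_mulVec_nonneg ?_ fun x => ?_
  · ext i j
    simp only [featureCov, conjTranspose_apply, Matrix.of_apply, star_trivial]
    congr 1
    simp only [mul_comm]
  · rw [star_trivial, M.dotProduct_featureCov_mulVec hφ hφ1]
    exact integral_nonneg fun τ => sq_nonneg _

/-- A direction that is never explored by a policy that tries all actions is never explored by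
any other policy. -/
theorem rank_featureCov_le (hφ : ∀ a, Measurable fun s => φ s a)
    (hφ1 : ∀ s a, ‖φ s a‖ ≤ 1) (π π' : Policy S A) (hpos : ∀ j < H, ∀ s a, 0 < π'.prob j s a)
    (h : Fin H) : (M.featureCov φ π h).rank ≤ (M.featureCov φ π' h).rank := by
  refine rank_le_rank_of_ker_le fun x hx => ?_
  have hi : ∀ π : Policy S A, Integrable (fun τ : Fin H → S × A =>
      ((φ (τ h).1 (τ h).2).ofLp ⬝ᵥ x) ^ 2) (M.trajLaw π H 0 M.s₀) := by
    intro π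
    have h1 : ∀ y : Fin d → ℝ, (y ⬝ᵥ x) ^ 2 = y ⬝ᵥ vecMulVec x x *ᵥ y := fun y => by
      rw [vecMulVec_mulVec, dotProduct_smul, dotProduct_comm x y]
      simp [pow_two]
    simp only [h1]
    exact M.integrable_quadForm hφ hφ1 π h _
  have h0 : x ⬝ᵥ M.featureCov φ π' h *ᵥ x = 0 := by rw [hx, dotProduct_zero]
  rw [M.dotProduct_featureCov_mulVec hφ hφ1,
    integral_eq_zero_iff_of_nonneg (fun τ => sq_nonneg _) (hi π')] at h0
  have hac := M.trajLaw_absolutelyContinuous π π' H 0 (by simpa using hpos) M.s₀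
  have h2 := (M.posSemidef_featureCov hφ hφ1 π h).dotProduct_mulVec_zero_iff x
  rw [star_trivial] at h2
  rw [← h2, M.dotProduct_featureCov_mulVec hφ hφ1,
    integral_eq_zero_iff_of_nonneg (fun τ => sq_nonneg _) (hi π)]
  exact hac.ae_le h0

/-- Jensen's inequality for the expected elliptical norm of the features. -/
theorem integral_sqrt_quadForm_le (hφ : ∀ a, Measurable fun s => φ s a)
    (hφ1 : ∀ s a, ‖φ s a‖ ≤ 1) (π : Policy S A) (h : Fin H) {B : Matrix (Fin d) (Fin d) ℝ}
    (hB : B.PosSemidef) :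
    Integrable (fun τ : Fin H → S × A =>
      √((φ (τ h).1 (τ h).2).ofLp ⬝ᵥ B *ᵥ (φ (τ h).1 (τ h).2).ofLp)) (M.trajLaw π H 0 M.s₀) ∧
    ∫ τ, √((φ (τ h).1 (τ h).2).ofLp ⬝ᵥ B *ᵥ (φ (τ h).1 (τ h).2).ofLp) ∂(M.trajLaw π H 0 M.s₀) ≤
      √((M.featureCov φ π h * B).trace) := by
  have hi := M.integrable_quadForm hφ hφ1 π h B
  have hnn : ∀ x : Fin d → ℝ, 0 ≤ x ⬝ᵥ B *ᵥ x := fun x => by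
    simpa using hB.dotProduct_mulVec_nonneg x
  have hs : Integrable (fun τ : Fin H → S × A =>
      √((φ (τ h).1 (τ h).2).ofLp ⬝ᵥ B *ᵥ (φ (τ h).1 (τ h).2).ofLp)) (M.trajLaw π H 0 M.s₀) := by
    refine Integrable.mono' (hi.add (integrable_const 1))
      (hi.aestronglyMeasurable.aemeasurable.sqrt.aestronglyMeasurable)
      (Filter.Eventually.of_forall fun τ => ?_)
    have h1 := hnn (φ (τ h).1 (τ h).2).ofLp
    rw [Real.norm_eq_abs, abs_of_nonneg (Real.sqrt_nonneg _)]
    simp only [Pi.add_apply]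
    rw [Real.sqrt_le_left (by linarith)]
    nlinarith
  refine ⟨hs, ?_⟩
  rw [← M.integral_quadForm hφ hφ1]
  refine Real.le_sqrt_of_sq_le ?_
  have hsq : ∀ x : Fin d → ℝ, √(x ⬝ᵥ B *ᵥ x) ^ 2 = x ⬝ᵥ B *ᵥ x := fun x => Real.sq_sqrt (hnn x)
  have h1 := (even_two.convexOn_pow (𝕜 := ℝ)).map_integral_le (continuous_pow 2).continuousOn
    isClosed_univ (Filter.Eventually.of_forall fun _ => Set.mem_univ _) hs
    (by simpa only [Function.comp_def, hsq] using hi)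
  simpa only [hsq] using h1

end EpisodicMDP

end Pessimism

/-! ### Pessimistic value iteration -/

section PessimisticValueIteration

open Matrix

variable {S A : Type*} [MeasurableSpace S] [MeasurableSpace A] {H d n : ℕ}
  {φ : S → A → EuclideanSpace ℝ (Fin d)} {D : Fin n → Fin H → S × A}
  {what utilde : Fin H → EuclideanSpace ℝ (Fin d)} {lam β : ℝ}

omit [MeasurableSpace A] in
theorem measurable_coord (hφ : ∀ a, Measurable fun s => φ s a) (a : A) (i : Fin d) :
    Measurable fun s => φ s a i :=
  (measurable_pi_apply i).comp ((by fun_prop : Measurable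
    fun x : EuclideanSpace ℝ (Fin d) => (x.ofLp : Fin d → ℝ)).comp (hφ a))

omit [MeasurableSpace A] in
theorem measurable_linFun (hφ : ∀ a, Measurable fun s => φ s a) (θ : EuclideanSpace ℝ (Fin d))
    (a : A) : Measurable fun s => linFun φ θ s a := by
  simp only [linFun, inner_eq_dotProduct, dotProduct]
  exact Finset.measurable_sum _ fun i _ => (measurable_coord hφ a i).mul_const _

omit [MeasurableSpace A] in
theorem measurable_quadForm (hφ : ∀ a, Measurable fun s => φ s a) (B : Matrix (Fin d) (Fin d) ℝ)
    (a : A) : Measurable fun s => (φ s a).ofLp ⬝ᵥ B *ᵥ (φ s a).ofLp := by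
  simp only [EpisodicMDP.quadForm_eq_sum]
  exact Finset.measurable_sum _ fun i _ => Finset.measurable_sum _ fun j _ =>
    ((measurable_coord hφ a i).mul (measurable_coord hφ a j)).const_mul _

omit [MeasurableSpace A] in
theorem measurable_penalty (hφ : ∀ a, Measurable fun s => φ s a) (h : Fin H) (a : A) :
    Measurable fun s => penalty φ lam β D h s a :=
  (measurable_quadForm hφ _ a).sqrt.const_mul β

omit [MeasurableSpace S] [MeasurableSpace A] in
theorem penalty_nonneg (hβ : 0 ≤ β) (h : Fin H) (s : S) (a : A) :
    0 ≤ penalty φ lam β D h s a :=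
  mul_nonneg hβ (Real.sqrt_nonneg _)

omit [MeasurableSpace A] in
theorem measurable_pessQ (hφ : ∀ a, Measurable fun s => φ s a) (h : Fin H) (a : A) :
    Measurable fun s => pessQ φ lam β D what utilde h s a :=
  ((((measurable_linFun hφ _ a).add (measurable_linFun hφ _ a)).sub
    (measurable_penalty hφ h a)).min measurable_const).max measurable_const

omit [MeasurableSpace S] [MeasurableSpace A] in
theorem pessQ_mem_Icc (h : Fin H) (s : S) (a : A) :
    pessQ φ lam β D what utilde h s a ∈ Set.Icc (0 : ℝ) ((H : ℝ) - (h : ℕ)) := by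
  refine ⟨le_max_right _ _, max_le (min_le_right _ _) ?_⟩
  have : ((h : ℕ) : ℝ) ≤ H := by exact_mod_cast h.2.le
  linarith

omit [MeasurableSpace S] [MeasurableSpace A] in
theorem abs_penalty_le (hφ1 : ∀ s a, ‖φ s a‖ ≤ 1) (hβ : 0 ≤ β) (h : Fin H) (s : S) (a : A) :
    |penalty φ 1 β D h s a| ≤ β * √((d : ℝ) * d) := by
  rw [abs_of_nonneg (penalty_nonneg hβ h s a)]
  refine mul_le_mul_of_nonneg_left (Real.sqrt_le_sqrt ?_) hβ
  rw [EpisodicMDP.quadForm_eq_sum]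
  have hM : ∀ i j, |(gramMatrix φ D h + (1 : ℝ) • (1 : Matrix (Fin d) (Fin d) ℝ))⁻¹ i j| ≤ 1 := by
    refine abs_inv_apply_le_one ?_
    simpa using posSemidef_gramMatrix φ D h
  calc _ ≤ ∑ _i : Fin d, ∑ _j : Fin d, (1 : ℝ) := by
        refine Finset.sum_le_sum fun i _ => Finset.sum_le_sum fun j _ => (le_abs_self _).trans ?_
        rw [abs_mul, abs_mul]
        exact mul_le_one₀ (hM i j) (by positivity)
          (mul_le_one₀ (EpisodicMDP.abs_feature_le hφ1 s a i) (abs_nonneg _)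
            (EpisodicMDP.abs_feature_le hφ1 s a j))
    _ = d * d := by simp

variable [Fintype A]

omit [MeasurableSpace A] in
theorem measurable_pessV (hφ : ∀ a, Measurable fun s => φ s a) (π : Policy S A) (h : Fin H) :
    Measurable (pessV φ lam β D what utilde π h) :=
  Finset.measurable_sum _ fun a _ => (measurable_pessQ hφ h a).mul (π.measurable_prob h a)

omit [MeasurableSpace A] in
theorem pessV_mem_Icc (π : Policy S A) (h : Fin H) (s : S) :
    pessV φ lam β D what utilde π h s ∈ Set.Icc (0 : ℝ) ((H : ℝ) - (h : ℕ)) := by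
  obtain ⟨hp0, hp1⟩ := π.mem_stdSimplex h s
  refine ⟨Finset.sum_nonneg fun a _ => mul_nonneg (pessQ_mem_Icc h s a).1 (hp0 a), ?_⟩
  calc _ ≤ ∑ a, ((H : ℝ) - (h : ℕ)) * π.prob h s a := Finset.sum_le_sum fun a _ =>
        mul_le_mul_of_nonneg_right (pessQ_mem_Icc h s a).2 (hp0 a)
    _ = (H : ℝ) - (h : ℕ) := by rw [← Finset.mul_sum, hp1, mul_one]

omit [MeasurableSpace A] [Fintype A] in
theorem measurable_nextV {V : Fin H → S → ℝ} (hV : ∀ h, Measurable (V h)) (h : Fin H) :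
    Measurable (nextV V h) := by
  unfold nextV
  split_ifs with hh
  · exact hV _
  · exact measurable_const

omit [MeasurableSpace A] in
theorem nextV_pessV_mem_Icc (π : Policy S A) (h : Fin H) (s : S) :
    nextV (pessV φ lam β D what utilde π) h s ∈ Set.Icc (0 : ℝ) ((H : ℝ) - (h : ℕ) - 1) := by
  unfold nextV
  split_ifs with hh
  · have := pessV_mem_Icc (φ := φ) (D := D) (what := what) (utilde := utilde) (lam := lam)
      (β := β) π ⟨h + 1, hh⟩ s
    push_cast at this
    rwa [sub_sub]
  · have : ((h : ℕ) : ℝ) + 1 ≤ H := by exact_mod_cast h.2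
    exact ⟨le_rfl, by linarith⟩

variable [MeasurableSingletonClass A]

/-- If the penalties are uncertainty quantifiers, the suboptimality of pessimistic value
iteration is at most the expected sum of `2 Γ_h` under the policy `π'` it is compared with; under
coverage of `π'` Jensen's inequality and the trace inequality bound this by the rank of the feature
covariances. -/
theorem subOpt_le_of_isUncertaintyQuantifier (M : EpisodicMDP S A H)
    {Θ : Set (EuclideanSpace ℝ (Fin d))} {γ : ℝ} {θhat : Fin H → EuclideanSpace ℝ (Fin d)}
    {π π' : Policy S A} (hφ : ∀ a, Measurable fun s => φ s a) (hφ1 : ∀ s a, ‖φ s a‖ ≤ 1)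
    (hβ : 0 ≤ β) (hn : 0 < n) (hout : IsDCPPOOutput φ Θ γ 1 β D θhat what utilde π)
    (hUQ : IsUncertaintyQuantifier M φ 1 β D what utilde π) {cdag : ℝ} (hc : 0 < cdag)
    (hcov : ∀ h : Fin H,
      (gramMatrix φ D h - (cdag * n) • M.featureCov φ π' h).PosSemidef)
    {r : ℕ} (hr : ∀ h : Fin H, (M.featureCov φ π' h).rank ≤ r) :
    M.subOpt π' π ≤ 2 * H * β * √(r / (cdag * n)) := by
  -- extension by zero to the steps `h ≥ H`
  set V : ℕ → S → ℝ := fun h s =>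
    if hh : h < H then pessV φ 1 β D what utilde π ⟨h, hh⟩ s else 0 with hV
  set Q : ℕ → S → A → ℝ := fun h s a =>
    if hh : h < H then pessQ φ 1 β D what utilde ⟨h, hh⟩ s a else 0 with hQ
  set Γ : ℕ → S → A → ℝ := fun h s a =>
    if hh : h < H then penalty φ 1 β D ⟨h, hh⟩ s a else 0 with hΓ
  have hVnext : ∀ (h : ℕ) (hh : h < H), V (h + 1) = nextV (pessV φ 1 β D what utilde π) ⟨h, hh⟩ :=
    fun h hh => rfl
  have hy : ∀ (h : ℕ) (hh : h < H) s a,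
      M.r h s a + M.transition h (V (h + 1)) s a ∈ Set.Icc (0 : ℝ) ((H : ℝ) - h) := by
    intro h hh s a
    obtain ⟨h1, h2⟩ := M.r_mem h hh s a
    obtain ⟨h3, h4⟩ := M.transition_mem_Icc h s a
      (measurable_nextV (fun h => measurable_pessV hφ π h) ⟨h, hh⟩)
      (nextV_pessV_mem_Icc (φ := φ) (D := D) (what := what) (utilde := utilde) (lam := 1)
        (β := β) π ⟨h, hh⟩)
    rw [hVnext h hh]
    constructor <;> linarith
  have hmain := M.subOpt_le_expSum π π' (Q := Q) (Γ := Γ) (V := V) (B := β * √((d : ℝ) * d))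
    (by
      intro h
      simp only [hV]
      split_ifs
      · exact measurable_pessV hφ π _
      · exact measurable_const)
    (by
      intro h s
      simp only [hV]
      split_ifs with hh
      · obtain ⟨h1, h2⟩ := pessV_mem_Icc (φ := φ) (D := D) (what := what) (utilde := utilde)
          (lam := 1) (β := β) π ⟨h, hh⟩ s
        rw [abs_of_nonneg h1]
        refine h2.trans ?_
        simp
      · simp)
    (by simp [hV])
    (by
      intro h a
      simp only [hΓ]
      split_ifs
      · exact measurable_penalty hφ _ a
      · exact measurable_const)
    (by
      intro h s a
      simp only [hΓ]
      split_ifs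
      · exact abs_penalty_le hφ1 hβ _ s a
      · rw [abs_zero]; positivity)
    (by
      intro h hh s
      simp only [hV, hQ, dif_pos hh]
      rfl)
    (by
      intro h hh s p hp
      simp only [hV, hQ, dif_pos hh]
      exact hout.greedy ⟨h, hh⟩ s hp)
    (by
      intro h hh s a
      simp only [hQ, dif_pos hh]
      have h1 := (abs_le.1 (hUQ ⟨h, hh⟩ s a)).2
      refine max_le ((min_le_left _ _).trans ?_) (hy h hh s a).1
      rw [hVnext h hh]
      linarith)
    (by
      intro h hh s a
      simp only [hQ, hΓ, dif_pos hh]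
      have h1 := (abs_le.1 (hUQ ⟨h, hh⟩ s a)).1
      have h2 := penalty_nonneg (φ := φ) (lam := 1) (D := D) hβ ⟨h, hh⟩ s a
      refine le_trans (le_min ?_ ?_) (le_max_left _ _)
      · rw [hVnext h hh]
        linarith
      · have := (hy h hh s a).2
        simp only
        linarith)
  refine hmain.trans ?_
  set B : Fin H → Matrix (Fin d) (Fin d) ℝ :=
    fun h => (gramMatrix φ D h + (1 : ℝ) • (1 : Matrix (Fin d) (Fin d) ℝ))⁻¹ with hB
  have hBpos : ∀ h, (B h).PosSemidef := fun h => (posDef_gramMatrix_add φ D h).inv.posSemidef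
  have hJ := fun h => M.integral_sqrt_quadForm_le hφ hφ1 π' h (hBpos h)
  have hcn : 0 < cdag * n := mul_pos hc (by exact_mod_cast hn)
  have htr : ∀ h, (M.featureCov φ π' h * B h).trace ≤ r / (cdag * n) := by
    intro h
    refine (trace_mul_inv_le_rank_div (posDef_gramMatrix_add φ D h)
      (M.posSemidef_featureCov hφ hφ1 π' h) hcn ?_).trans ?_
    · rw [add_sub_right_comm, one_smul]
      exact (hcov h).add PosSemidef.one
    · gcongr
      exact_mod_cast hr h
  have hexp : M.expSum π' (fun h s a => 2 * Γ h s a) H 0 M.s₀ = ∑ h : Fin H, 2 * (β *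
      ∫ τ, √((φ (τ h).1 (τ h).2).ofLp ⬝ᵥ B h *ᵥ (φ (τ h).1 (τ h).2).ofLp)
        ∂(M.trajLaw π' H 0 M.s₀)) := by
    have h1 : ∀ (τ : Fin H → S × A) (j : Fin H), 2 * Γ (0 + j) (τ j).1 (τ j).2 =
        2 * (β * √((φ (τ j).1 (τ j).2).ofLp ⬝ᵥ B j *ᵥ (φ (τ j).1 (τ j).2).ofLp)) := by
      intro τ j
      simp only [hΓ, zero_add, dif_pos j.2]
      rfl
    simp only [EpisodicMDP.expSum, h1]
    rw [integral_finsetSum _ fun h _ => ((hJ h).1.const_mul β).const_mul 2]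
    simp only [integral_const_mul]
  rw [hexp]
  calc _ ≤ ∑ _h : Fin H, 2 * (β * √(r / (cdag * n))) := by
        refine Finset.sum_le_sum fun h _ => ?_
        gcongr
        exact (hJ h).2.trans (Real.sqrt_le_sqrt (htr h))
    _ = _ := by
        rw [Finset.sum_const, Finset.card_univ, Fintype.card_fin, nsmul_eq_mul]
        ring

end PessimisticValueIteration

/-! ### Softmax distributions -/

section Softmax

variable {A : Type*} [Fintype A]

/-- The expectation of `q` under its softmax distribution. -/
noncomputable def softmaxValue (q : A → ℝ) : ℝ := ∑ a, q a * softmax q a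

/-- The squared Hellinger distance `1 - ∑ √(p p')` of two probability vectors. -/
noncomputable def hellingerSq (p p' : A → ℝ) : ℝ := 1 - ∑ a, √(p a * p' a)

theorem sum_sub_abs_sq_le_hellingerSq {p p' : A → ℝ} (hp : p ∈ stdSimplex ℝ A)
    (hp' : p' ∈ stdSimplex ℝ A) : (∑ a, |p a - p' a|) ^ 2 ≤ 8 * hellingerSq p p' := by
  have h1 : ∀ a, √(p a) * √(p a) = p a := fun a => Real.mul_self_sqrt (hp.1 a)
  have h2 : ∀ a, √(p' a) * √(p' a) = p' a := fun a => Real.mul_self_sqrt (hp'.1 a)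
  have h3 : ∀ a, √(p a * p' a) = √(p a) * √(p' a) := fun a => Real.sqrt_mul (hp.1 a) _
  have hfac : ∀ a, |p a - p' a| = |√(p a) - √(p' a)| * (√(p a) + √(p' a)) := fun a => by
    rw [← abs_of_nonneg (by positivity : 0 ≤ √(p a) + √(p' a)), ← abs_mul]
    congr 1
    linear_combination -h1 a + h2 a
  have hcs := Finset.sum_mul_sq_le_sq_mul_sq Finset.univ (fun a => |√(p a) - √(p' a)|)
    fun a => √(p a) + √(p' a)
  have hs1 : ∑ a, |√(p a) - √(p' a)| ^ 2 = 2 * hellingerSq p p' := by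
    have : ∀ a, |√(p a) - √(p' a)| ^ 2 = p a + p' a - 2 * √(p a * p' a) := fun a => by
      rw [sq_abs, h3]
      linear_combination h1 a + h2 a
    simp only [this, Finset.sum_sub_distrib, Finset.sum_add_distrib, hp.2, hp'.2,
      ← Finset.mul_sum, hellingerSq]
    ring
  have hs2 : ∑ a, (√(p a) + √(p' a)) ^ 2 ≤ 4 := by
    have : ∀ a, (√(p a) + √(p' a)) ^ 2 ≤ 2 * (p a + p' a) := fun a => by
      nlinarith [h1 a, h2 a, sq_nonneg (√(p a) - √(p' a))]
    refine (Finset.sum_le_sum fun a _ => this a).trans_eq ?_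
    rw [← Finset.mul_sum, Finset.sum_add_distrib, hp.2, hp'.2]
    norm_num
  simp only [← hfac, hs1] at hcs
  have hs3 : 0 ≤ 2 * hellingerSq p p' := hs1 ▸ Finset.sum_nonneg fun a _ => sq_nonneg _
  nlinarith

theorem hellingerSq_nonneg {p p' : A → ℝ} (hp : p ∈ stdSimplex ℝ A)
    (hp' : p' ∈ stdSimplex ℝ A) : 0 ≤ hellingerSq p p' := by
  have := sum_sub_abs_sq_le_hellingerSq hp hp'
  have := sq_nonneg (∑ a, |p a - p' a|)
  linarith

theorem hellingerSq_le_one (p p' : A → ℝ) : hellingerSq p p' ≤ 1 :=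
  sub_le_self _ (Finset.sum_nonneg fun _ _ => Real.sqrt_nonneg _)

theorem sum_mul_exp_half_log_eq {p p' : A → ℝ} (hp : ∀ a, 0 < p a) (hp' : ∀ a, 0 < p' a) :
    ∑ a, p a * Real.exp ((Real.log (p' a) - Real.log (p a)) / 2) = 1 - hellingerSq p p' := by
  rw [hellingerSq, sub_sub_cancel]
  refine Finset.sum_congr rfl fun a _ => ?_
  have h1 : Real.log (√(p a * p' a)) = Real.log (p a) + (Real.log (p' a) - Real.log (p a)) / 2 := by
    rw [Real.log_sqrt (mul_pos (hp a) (hp' a)).le, Real.log_mul (hp a).ne' (hp' a).ne']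
    ring
  rw [← Real.exp_log (Real.sqrt_pos.2 (mul_pos (hp a) (hp' a))), h1, Real.exp_add,
    Real.exp_log (hp a)]

variable [Nonempty A]

theorem sum_exp_pos (q : A → ℝ) : 0 < ∑ a, Real.exp (q a) :=
  Finset.sum_pos (fun _ _ => Real.exp_pos _) Finset.univ_nonempty

theorem softmax_pos (q : A → ℝ) (a : A) : 0 < softmax q a :=
  div_pos (Real.exp_pos _) (sum_exp_pos q)

theorem softmax_mem_stdSimplex (q : A → ℝ) : softmax q ∈ stdSimplex ℝ A := by
  refine ⟨fun a => (softmax_pos q a).le, ?_⟩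
  simp only [softmax]
  rw [← Finset.sum_div, div_self (sum_exp_pos q).ne']

theorem log_softmax (q : A → ℝ) (a : A) :
    Real.log (softmax q a) = q a - Real.log (∑ a', Real.exp (q a')) := by
  rw [softmax, Real.log_div (Real.exp_pos _).ne' (sum_exp_pos q).ne', Real.log_exp]

theorem log_sum_exp_le {q q' : A → ℝ} {x : ℝ} (h : ∀ a, |q a - q' a| ≤ x) :
    Real.log (∑ a, Real.exp (q a)) ≤ Real.log (∑ a, Real.exp (q' a)) + x := by
  rw [← Real.log_exp x, ← Real.log_mul (sum_exp_pos q').ne' (Real.exp_pos _).ne',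
    Finset.sum_mul]
  refine Real.log_le_log (sum_exp_pos q) (Finset.sum_le_sum fun a _ => ?_)
  rw [← Real.exp_add, Real.exp_le_exp]
  have := (abs_le.1 (h a)).2
  linarith

theorem abs_log_softmax_sub_le {q q' : A → ℝ} {x : ℝ} (h : ∀ a, |q a - q' a| ≤ x) (a : A) :
    |Real.log (softmax q a) - Real.log (softmax q' a)| ≤ 2 * x := by
  rw [log_softmax, log_softmax]
  have h1 := log_sum_exp_le h
  have h2 := log_sum_exp_le (q := q') (q' := q) fun a => by rw [abs_sub_comm]; exact h a
  have h3 := abs_le.1 (h a)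
  rw [abs_le]
  constructor <;> linarith

theorem sum_abs_softmax_sub_le {q q' : A → ℝ} {x : ℝ} (h : ∀ a, |q a - q' a| ≤ x) :
    ∑ a, |softmax q a - softmax q' a| ≤ 4 * x := by
  have hx : 0 ≤ x := (abs_nonneg _).trans (h (Classical.arbitrary A))
  have key : ∀ u v : ℝ, 0 < u → 0 < v → Real.log u - Real.log v ≤ 2 * x → u - v ≤ 2 * x * u := by
    intro u v hu hv huv
    have h1 := Real.log_le_sub_one_of_pos (div_pos hv hu)
    rw [Real.log_div hv.ne' hu.ne', le_sub_iff_add_le, le_div_iff₀ hu] at h1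
    nlinarith
  have h1 : ∀ a, |softmax q a - softmax q' a| ≤ 2 * x * (softmax q a + softmax q' a) := by
    intro a
    have hp := softmax_pos q a
    have hp' := softmax_pos q' a
    have h2 := abs_le.1 (abs_log_softmax_sub_le h a)
    have h3 := key _ _ hp hp' h2.2
    have h4 := key _ _ hp' hp (by linarith)
    rw [abs_le]
    constructor <;> nlinarith [mul_nonneg hx hp.le, mul_nonneg hx hp'.le]
  refine (Finset.sum_le_sum fun a _ => h1 a).trans_eq ?_
  rw [← Finset.mul_sum, Finset.sum_add_distrib, (softmax_mem_stdSimplex q).2,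
    (softmax_mem_stdSimplex q').2]
  ring

theorem one_le_mul_softmax {q : A → ℝ} {H : ℝ} (hq : ∀ a, q a ∈ Set.Icc 0 H) (a : A) :
    1 ≤ Fintype.card A * Real.exp H * softmax q a := by
  rw [softmax, mul_div_assoc', le_div_iff₀ (sum_exp_pos q), one_mul]
  calc ∑ a', Real.exp (q a') ≤ ∑ _a' : A, Real.exp H :=
        Finset.sum_le_sum fun a' _ => Real.exp_le_exp.2 (hq a').2
    _ = Fintype.card A * Real.exp H * 1 := by simp
    _ ≤ _ := by
        gcongr
        exact Real.one_le_exp (hq a).1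

/-- Logits that vanish at a common action can be recovered from the softmax distribution: as the
probabilities are at least `e^{-H} / |A|`, the logarithm is `|A| e^H`-Lipschitz. -/
theorem abs_sub_le_of_softmax {q q' : A → ℝ} {H : ℝ} (hq : ∀ a, q a ∈ Set.Icc 0 H)
    (hq' : ∀ a, q' a ∈ Set.Icc 0 H) {a₀ : A} (h0 : q a₀ = 0) (h0' : q' a₀ = 0) (a : A) :
    |q a - q' a| ≤ Fintype.card A * Real.exp H * ∑ a, |softmax q a - softmax q' a| := by
  classical
  set L := Fintype.card A * Real.exp H
  have hL : 0 ≤ L := by positivity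
  by_cases ha : a = a₀
  · rw [ha, h0, h0', sub_zero, abs_zero]
    exact mul_nonneg hL (Finset.sum_nonneg fun _ _ => abs_nonneg _)
  have key : ∀ u v : ℝ, 0 < u → 0 < v → 1 ≤ L * v → Real.log u - Real.log v ≤ L * |u - v| := by
    intro u v hu hv hLv
    have h1 := Real.log_le_sub_one_of_pos (div_pos hu hv)
    rw [Real.log_div hu.ne' hv.ne'] at h1
    refine h1.trans ?_
    rw [div_sub_one hv.ne', div_le_iff₀ hv]
    nlinarith [le_abs_self (u - v), abs_nonneg (u - v)]
  have hlog : ∀ a, |Real.log (softmax q a) - Real.log (softmax q' a)| ≤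
      L * |softmax q a - softmax q' a| := by
    intro a
    have h1 := key _ _ (softmax_pos q a) (softmax_pos q' a) (one_le_mul_softmax hq' a)
    have h2 := key _ _ (softmax_pos q' a) (softmax_pos q a) (one_le_mul_softmax hq a)
    rw [abs_sub_comm] at h2
    rw [abs_le]
    constructor <;> linarith
  have hrep : q a - q' a = (Real.log (softmax q a) - Real.log (softmax q' a)) -
      (Real.log (softmax q a₀) - Real.log (softmax q' a₀)) := by
    simp only [log_softmax, h0, h0']
    ring
  have hle : |softmax q a - softmax q' a| + |softmax q a₀ - softmax q' a₀| ≤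
      ∑ a, |softmax q a - softmax q' a| := by
    rw [← Finset.sum_pair (f := fun a => |softmax q a - softmax q' a|) ha]
    exact Finset.sum_le_sum_of_subset_of_nonneg (Finset.subset_univ _) fun _ _ _ => abs_nonneg _
  rw [hrep]
  refine (abs_sub _ _).trans ((add_le_add (hlog a) (hlog a₀)).trans ?_)
  rw [← mul_add]
  exact mul_le_mul_of_nonneg_left hle hL

theorem abs_softmaxValue_sub_le {q q' : A → ℝ} {H x : ℝ} (hq' : ∀ a, q' a ∈ Set.Icc 0 H)
    (h : ∀ a, |q a - q' a| ≤ x) : |softmaxValue q - softmaxValue q'| ≤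
      x + H * ∑ a, |softmax q a - softmax q' a| := by
  have h1 : softmaxValue q - softmaxValue q' = ∑ a, ((q a - q' a) * softmax q a +
      q' a * (softmax q a - softmax q' a)) := by
    rw [softmaxValue, softmaxValue, ← Finset.sum_sub_distrib]
    exact Finset.sum_congr rfl fun a _ => by ring
  rw [h1]
  refine (Finset.abs_sum_le_sum_abs _ _).trans ?_
  calc _ ≤ ∑ a, (x * softmax q a + H * |softmax q a - softmax q' a|) := by
        refine Finset.sum_le_sum fun a _ => (abs_add_le _ _).trans (add_le_add ?_ ?_)
        · rw [abs_mul, abs_of_pos (softmax_pos q a)]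
          exact mul_le_mul_of_nonneg_right (h a) (softmax_pos q a).le
        · rw [abs_mul, abs_of_nonneg (hq' a).1]
          exact mul_le_mul_of_nonneg_right (hq' a).2 (abs_nonneg _)
    _ = _ := by
        rw [Finset.sum_add_distrib, ← Finset.mul_sum, ← Finset.mul_sum,
          (softmax_mem_stdSimplex q).2, mul_one]

theorem softmaxValue_mem_Icc {q : A → ℝ} {H : ℝ} (hq : ∀ a, q a ∈ Set.Icc 0 H) :
    softmaxValue q ∈ Set.Icc 0 H := by
  refine ⟨Finset.sum_nonneg fun a _ => mul_nonneg (hq a).1 (softmax_pos q a).le, ?_⟩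
  calc _ ≤ ∑ a, H * softmax q a :=
        Finset.sum_le_sum fun a _ => mul_le_mul_of_nonneg_right (hq a).2 (softmax_pos q a).le
    _ = H := by rw [← Finset.mul_sum, (softmax_mem_stdSimplex q).2, mul_one]

end Softmax

/-! ### Exponential inequalities -/

section Concentration

variable {S A : Type*} [MeasurableSpace S] [MeasurableSpace A] [Fintype A] {H : ℕ}

namespace EpisodicMDP

variable (M : EpisodicMDP S A H) (π : Policy S A)

theorem lintegral_coord_le_one {N j : ℕ} (hj : j < N) {F : S × A → ℝ≥0∞} (hF : Measurable F)
    (hle : ∀ s, ∑ a, ENNReal.ofReal (π.prob j s a) * F (s, a) ≤ 1) (s : S) :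
    ∫⁻ τ, F (τ ⟨j, hj⟩) ∂(M.trajLaw π N 0 s) ≤ 1 := by
  obtain ⟨k, rfl⟩ : ∃ k, N = k + 1 + j := ⟨N - 1 - j, by omega⟩
  have hF' : Measurable fun τ : Fin (k + 1) → S × A => F (τ 0) := hF.comp (measurable_pi_apply 0)
  refine M.lintegral_trajLaw_le_one_of_tail π hF' j 0 _ (fun τ => ?_) (fun s => ?_) s
  · congr 2
    ext
    simp
  · rw [lintegral_trajLaw_succ _ _ _ _ _ hF']
    have hP := M.markov j
    simpa using hle s

theorem lintegral_coord_pair_le_one [MeasurableSingletonClass A] {N j : ℕ} (hj : j + 1 < N)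
    {F : (S × A) × (S × A) → ℝ≥0∞} (hF : Measurable F)
    (hle : ∀ s a, ∫⁻ s', ∑ a', ENNReal.ofReal (π.prob (j + 1) s' a') * F ((s, a), (s', a'))
      ∂(M.P j (s, a)) ≤ 1) (s : S) :
    ∫⁻ τ, F (τ ⟨j, by omega⟩, τ ⟨j + 1, hj⟩) ∂(M.trajLaw π N 0 s) ≤ 1 := by
  obtain ⟨k, rfl⟩ : ∃ k, N = k + 2 + j := ⟨N - 2 - j, by omega⟩
  have hF' : Measurable fun τ : Fin (k + 2) → S × A => F (τ 0, τ 1) :=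
    hF.comp ((measurable_pi_apply 0).prodMk (measurable_pi_apply 1))
  refine M.lintegral_trajLaw_le_one_of_tail π hF' j 0 _ (fun τ => ?_) (fun s => ?_) s
  · congr 3 <;> ext <;> simp [add_comm]
  · rw [lintegral_trajLaw_succ _ _ _ _ _ hF']
    calc _ ≤ ∑ a, ENNReal.ofReal (π.prob (0 + j) s a) * 1 := by
          refine Finset.sum_le_sum fun a _ => mul_le_mul_right ?_ _
          refine le_trans (le_of_eq ?_) (hle s a)
          rw [zero_add]
          refine lintegral_congr fun s' => ?_
          have hF'' : Measurable fun τ : Fin (k + 1) → S × A => F ((s, a), τ 0) :=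
            hF.comp (measurable_const.prodMk (measurable_pi_apply 0))
          have h1 := M.lintegral_trajLaw_succ π k (j + 1) s' hF''
          have hP := M.markov (j + 1)
          simpa using h1
      _ = 1 := by simp [π.sum_ofReal_prob]

variable {Ω : Type*} [MeasurableSpace Ω] {μ : Measure Ω} [IsProbabilityMeasure μ] {n : ℕ}
  {D : Ω → Fin n → Fin H → S × A}

/-- Chernoff's bound for a function of a trajectory whose exponential has integral at most `1`. -/
theorem measure_lt_sum_le (hD : M.IsIIDSample π μ D) {ψ : (Fin H → S × A) → ℝ}
    (hψ : Measurable ψ) (hle : ∫⁻ τ, ENNReal.ofReal (Real.exp (ψ τ)) ∂(M.trajLaw π H 0 M.s₀) ≤ 1)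
    (l : ℝ) : μ {ω | l < ∑ i, ψ (D ω i)} ≤ ENNReal.ofReal (Real.exp (-l)) := by
  obtain ⟨hDm, hind, hlaw⟩ := hD
  have hm : ∀ i, Measurable fun ω => ψ (D ω i) := fun i => hψ.comp (hDm i)
  have hle' : ∀ i, ∫⁻ ω, ENNReal.ofReal (Real.exp (ψ (D ω i))) ∂μ ≤ 1 := fun i => by
    rw [← hlaw i, lintegral_map (by fun_prop) (hDm i)] at hle
    exact hle
  have hint : ∀ i, Integrable (fun ω => Real.exp (1 * ψ (D ω i))) μ := fun i => by
    simp only [one_mul]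
    refine ⟨(hm i).exp.aestronglyMeasurable, ?_⟩
    rw [hasFiniteIntegral_iff_ofReal (Filter.Eventually.of_forall fun _ => (Real.exp_pos _).le)]
    exact (hle' i).trans_lt ENNReal.one_lt_top
  have hind' : iIndepFun (fun i ω => ψ (D ω i)) μ := hind.comp (fun _ => ψ) fun _ => hψ
  have hmgf : mgf (∑ i, fun ω => ψ (D ω i)) μ 1 ≤ 1 := by
    rw [hind'.mgf_sum hm]
    refine Finset.prod_le_one (fun i _ => mgf_nonneg) fun i _ => ?_
    rw [mgf]
    simp only [one_mul]
    rw [integral_eq_lintegral_of_nonneg_ae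
      (Filter.Eventually.of_forall fun _ => (Real.exp_pos _).le) (hm i).exp.aestronglyMeasurable]
    exact ENNReal.toReal_le_of_le_ofReal zero_le_one (by simpa using hle' i)
  have hint' := hind'.integrable_exp_mul_sum (t := 1) hm (s := Finset.univ) fun i _ => hint i
  have h1 := measure_ge_le_exp_mul_mgf l zero_le_one hint'
  have h2 : μ.real {ω | l ≤ (∑ i, fun ω => ψ (D ω i)) ω} ≤ Real.exp (-l) := by
    refine h1.trans ?_
    rw [neg_mul, one_mul]
    exact mul_le_of_le_one_right (Real.exp_pos _).le hmgf
  refine (measure_mono fun ω hω => ?_).trans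
    ((ENNReal.le_ofReal_iff_toReal_le (measure_ne_top μ _) (Real.exp_pos _).le).2 h2)
  simp only [Set.mem_ofPred_eq, Finset.sum_apply]
  exact (show l < ∑ i, ψ (D ω i) from hω).le

/-- The union bound for finitely many such functions. -/
theorem measure_exists_lt_sum_le (hD : M.IsIIDSample π μ D) {X : Type*} (I : Finset X)
    {ψ : X → (Fin H → S × A) → ℝ} (hψ : ∀ x ∈ I, Measurable (ψ x))
    (hle : ∀ x ∈ I, ∫⁻ τ, ENNReal.ofReal (Real.exp (ψ x τ)) ∂(M.trajLaw π H 0 M.s₀) ≤ 1)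
    {N δ : ℝ} (hN : (I.card : ℝ) ≤ N) (hN0 : 0 < N) (hδ : 0 < δ) :
    μ {ω | ∃ x ∈ I, Real.log (N / δ) < ∑ i, ψ x (D ω i)} ≤ ENNReal.ofReal δ := by
  have h1 : {ω | ∃ x ∈ I, Real.log (N / δ) < ∑ i, ψ x (D ω i)} =
      ⋃ x ∈ I, {ω | Real.log (N / δ) < ∑ i, ψ x (D ω i)} := by
    ext ω
    simp
  rw [h1]
  refine (measure_biUnion_finset_le I _).trans ?_
  refine (Finset.sum_le_sum fun x hx => M.measure_lt_sum_le π hD (hψ x hx) (hle x hx) _).trans ?_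
  rw [Finset.sum_const, nsmul_eq_mul, ← Real.log_inv, Real.exp_log (by positivity), inv_div,
    ← ENNReal.ofReal_natCast, ← ENNReal.ofReal_mul (Nat.cast_nonneg _)]
  refine ENNReal.ofReal_le_ofReal ?_
  rw [mul_div_assoc', div_le_iff₀ hN0, mul_comm]
  gcongr

/-! ### The exponential moments of the log-likelihood ratio and of the regression noise -/

variable [MeasurableSingletonClass A]

omit [MeasurableSpace A] [MeasurableSingletonClass A] in
theorem measurable_hellingerSq {p p' : S → A → ℝ} (hp : ∀ a, Measurable fun s => p s a)
    (hp' : ∀ a, Measurable fun s => p' s a) : Measurable fun s => hellingerSq (p s) (p' s) :=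
  measurable_const.sub (Finset.measurable_sum _ fun a _ => ((hp a).mul (hp' a)).sqrt)

omit [MeasurableSpace A] [MeasurableSingletonClass A] in
theorem sum_ofReal_mul_exp_half_log {p p' : A → ℝ} (hp : ∀ a, 0 < p a) (hp' : ∀ a, 0 < p' a)
    (x : ℝ) : ∑ a, ENNReal.ofReal (p a) *
      ENNReal.ofReal (Real.exp ((Real.log (p' a) - Real.log (p a)) / 2 + x)) =
      ENNReal.ofReal ((1 - hellingerSq p p') * Real.exp x) := by
  rw [← sum_mul_exp_half_log_eq hp hp', Finset.sum_mul, ENNReal.ofReal_sum_of_nonneg fun a _ =>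
    mul_nonneg (mul_nonneg (hp a).le (Real.exp_pos _).le) (Real.exp_pos _).le]
  refine Finset.sum_congr rfl fun a _ => ?_
  rw [← ENNReal.ofReal_mul (hp a).le, Real.exp_add, mul_assoc]

theorem one_sub_mul_exp_le_one {x : ℝ} : (1 - x) * Real.exp x ≤ 1 := by
  have h1 := Real.add_one_le_exp (-x)
  calc (1 - x) * Real.exp x ≤ Real.exp (-x) * Real.exp x :=
        mul_le_mul_of_nonneg_right (by linarith) (Real.exp_pos _).le
    _ = 1 := by rw [← Real.exp_add]; simp

theorem measurable_uncurry {f : S → A → ℝ} (hf : ∀ a, Measurable fun s => f s a) :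
    Measurable fun x : S × A => f x.1 x.2 :=
  measurable_from_prod_countable_left hf

/-- Half the log-likelihood ratio of an alternative `p'`, compensated by the squared Hellinger
distance in the state where the action is chosen. -/
theorem lintegral_exp_logRatio_le_one {p' : S → A → ℝ} (h : Fin H)
    (hpos : ∀ s a, 0 < π.prob h s a) (hp' : ∀ s a, 0 < p' s a)
    (hp'm : ∀ a, Measurable fun s => p' s a) :
    ∫⁻ τ, ENNReal.ofReal (Real.exp
      ((Real.log (p' (τ h).1 (τ h).2) - Real.log (π.prob h (τ h).1 (τ h).2)) / 2 +
        hellingerSq (π.prob h (τ h).1) (p' (τ h).1))) ∂(M.trajLaw π H 0 M.s₀) ≤ 1 := by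
  have h1 := measurable_uncurry hp'm
  have h2 := measurable_uncurry (π.measurable_prob h)
  have h3 := (measurable_hellingerSq (π.measurable_prob h) hp'm).comp
    (measurable_fst : Measurable (Prod.fst : S × A → S))
  refine M.lintegral_coord_le_one π h.2 (F := fun x => ENNReal.ofReal (Real.exp
      ((Real.log (p' x.1 x.2) - Real.log (π.prob h x.1 x.2)) / 2 +
        hellingerSq (π.prob h x.1) (p' x.1)))) ?_ (fun s => ?_) M.s₀
  · exact ((((h1.log.sub h2.log).div_const 2).add h3).exp).ennreal_ofReal
  · have h4 := sum_ofReal_mul_exp_half_log (hpos s) (hp' s) (hellingerSq (π.prob h s) (p' s))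
    simp only
    rw [h4]
    exact ENNReal.ofReal_le_one.2 one_sub_mul_exp_le_one

/-- The same with the conditional expectation of the squared Hellinger distance, given the
preceding state-action pair. -/
theorem lintegral_exp_logRatio_next_le_one {p' : S → A → ℝ} {h : ℕ} (hh : h + 1 < H)
    (hpos : ∀ s a, 0 < π.prob (h + 1) s a) (hp' : ∀ s, p' s ∈ stdSimplex ℝ A)
    (hp'pos : ∀ s a, 0 < p' s a) (hp'm : ∀ a, Measurable fun s => p' s a) :
    ∫⁻ τ, ENNReal.ofReal (Real.exp
      ((Real.log (p' (τ ⟨h + 1, hh⟩).1 (τ ⟨h + 1, hh⟩).2) -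
        Real.log (π.prob (h + 1) (τ ⟨h + 1, hh⟩).1 (τ ⟨h + 1, hh⟩).2)) / 2 +
        M.transition h (fun s => hellingerSq (π.prob (h + 1) s) (p' s)) (τ ⟨h, by omega⟩).1
          (τ ⟨h, by omega⟩).2)) ∂(M.trajLaw π H 0 M.s₀) ≤ 1 := by
  have h1 := measurable_uncurry hp'm
  have h2 := measurable_uncurry (π.measurable_prob (h + 1))
  have h3 := measurable_hellingerSq (π.measurable_prob (h + 1)) hp'm
  have h4 := measurable_uncurry fun a => M.measurable_transition h h3 a
  have hP := M.markov h
  refine M.lintegral_coord_pair_le_one π hh (F := fun x => ENNReal.ofReal (Real.exp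
      ((Real.log (p' x.2.1 x.2.2) - Real.log (π.prob (h + 1) x.2.1 x.2.2)) / 2 +
        M.transition h (fun s => hellingerSq (π.prob (h + 1) s) (p' s)) x.1.1 x.1.2)))
      ?_ (fun s a => ?_) M.s₀
  · exact (((((h1.log.sub h2.log).div_const 2).comp measurable_snd).add
      (h4.comp measurable_fst)).exp).ennreal_ofReal
  · simp only [sum_ofReal_mul_exp_half_log (hpos _) (hp'pos _)]
    set x := M.transition h (fun s => hellingerSq (π.prob (h + 1) s) (p' s)) s a with hx
    have hb : ∀ s, hellingerSq (π.prob (h + 1) s) (p' s) ∈ Set.Icc (0 : ℝ) 1 := fun s =>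
      ⟨hellingerSq_nonneg (π.mem_stdSimplex _ s) (hp' s), hellingerSq_le_one _ _⟩
    have hi := M.integrable_of_bound_kernel h s a h3 (B := 1)
      fun s => by rw [abs_of_nonneg (hb s).1]; exact (hb s).2
    have hi1 : Integrable (fun s' => (1 - hellingerSq (π.prob (h + 1) s') (p' s')) * Real.exp x)
        (M.P h (s, a)) := ((integrable_const 1).sub hi).mul_const _
    rw [← ofReal_integral_eq_lintegral_ofReal hi1
      (Filter.Eventually.of_forall fun s =>
        mul_nonneg (sub_nonneg.2 (hb s).2) (Real.exp_pos _).le), integral_mul_const]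
    refine ENNReal.ofReal_le_one.2 ?_
    have : ∫ s', (1 - hellingerSq (π.prob (h + 1) s') (p' s')) ∂(M.P h (s, a)) = 1 - x := by
      rw [integral_sub (integrable_const 1) hi]
      simp [hx, transition]
    rw [this]
    exact one_sub_mul_exp_le_one

/-- The exponential moment of the regression noise `G(s_{h+1}) - ℙ_h G(s_h, a_h)`, with a weight
`y(s_h, a_h)`, by Hoeffding's lemma. -/
theorem lintegral_exp_noise_le_one {G : S → ℝ} (hG : Measurable G) {b : ℝ} (hb : 0 < b)
    (hGb : ∀ s, G s ∈ Set.Icc (-b) b) {y : S → A → ℝ} (hy : ∀ a, Measurable fun s => y s a)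
    {h : ℕ} (hh : h + 1 < H) :
    ∫⁻ τ, ENNReal.ofReal (Real.exp
      (y (τ ⟨h, by omega⟩).1 (τ ⟨h, by omega⟩).2 *
        (G (τ ⟨h + 1, hh⟩).1 - M.transition h G (τ ⟨h, by omega⟩).1 (τ ⟨h, by omega⟩).2) /
          (2 * b ^ 2) -
        y (τ ⟨h, by omega⟩).1 (τ ⟨h, by omega⟩).2 ^ 2 / (8 * b ^ 2)))
      ∂(M.trajLaw π H 0 M.s₀) ≤ 1 := by
  have hP := M.markov h
  have h1 := measurable_uncurry hy
  have h2 := measurable_uncurry fun a => M.measurable_transition h hG a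
  refine M.lintegral_coord_pair_le_one π hh (F := fun x => ENNReal.ofReal (Real.exp
      (y x.1.1 x.1.2 * (G x.2.1 - M.transition h G x.1.1 x.1.2) / (2 * b ^ 2) -
        y x.1.1 x.1.2 ^ 2 / (8 * b ^ 2)))) ?_ (fun s a => ?_) M.s₀
  · refine Measurable.ennreal_ofReal (Measurable.exp ?_)
    have hG' : Measurable fun x : (S × A) × (S × A) => G x.2.1 := by fun_prop
    have h1' := h1.comp (measurable_fst : Measurable (Prod.fst : (S × A) × (S × A) → S × A))
    have h2' := h2.comp (measurable_fst : Measurable (Prod.fst : (S × A) × (S × A) → S × A))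
    exact ((h1'.mul (hG'.sub h2')).div_const _).sub ((h1'.pow_const 2).div_const _)
  · simp only [← Finset.sum_mul, π.sum_ofReal_prob, one_mul]
    set t := y s a / (2 * b ^ 2) with ht
    set ν := M.P h (s, a)
    have hsub := hasSubgaussianMGF_of_mem_Icc (μ := ν) (X := G) hG.aemeasurable
      (Filter.Eventually.of_forall hGb)
    have h3 := hsub.mgf_le t
    have h4 := hsub.integrable_exp_mul t
    have h5 : ∀ s', Real.exp (y s a * (G s' - M.transition h G s a) / (2 * b ^ 2) -
        y s a ^ 2 / (8 * b ^ 2)) = Real.exp (t * (G s' - ν[G])) *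
          Real.exp (-(y s a ^ 2 / (8 * b ^ 2))) := fun s' => by
      rw [← Real.exp_add]
      congr 1
      rw [ht, transition]
      ring
    simp only [h5]
    rw [← ofReal_integral_eq_lintegral_ofReal (h4.mul_const _)
      (Filter.Eventually.of_forall fun s => by positivity), integral_mul_const]
    refine ENNReal.ofReal_le_one.2 ?_
    rw [mgf] at h3
    refine (mul_le_mul_of_nonneg_right h3 (Real.exp_pos _).le).trans ?_
    rw [← Real.exp_add, Real.exp_le_one_iff]
    have h6 : (((‖b - -b‖₊ / 2) ^ 2 : ℝ≥0) : ℝ) = b ^ 2 := by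
      push_cast
      rw [Real.norm_eq_abs, abs_of_pos (by linarith)]
      ring
    rw [h6, ht]
    refine le_of_eq ?_
    field_simp
    ring

end EpisodicMDP

end Concentration

/-! ### Finite nets -/

section Nets

/-- The integer points of the cube `[-k, k]^ι`. -/
noncomputable def intCube (ι : Type*) [Fintype ι] [DecidableEq ι] (k : ℕ) : Finset (ι → ℤ) :=
  Fintype.piFinset fun _ => Finset.Icc (-(k : ℤ)) k

theorem card_intCube (ι : Type*) [Fintype ι] [DecidableEq ι] (k : ℕ) :
    ((intCube ι k).card : ℝ) = (2 * k + 1 : ℝ) ^ Fintype.card ι := by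
  rw [intCube, Fintype.card_piFinset]
  simp only [Int.card_Icc, Finset.prod_const, Finset.card_univ]
  rw [show ((k : ℤ) + 1 - -(k : ℤ)).toNat = 2 * k + 1 by omega]
  push_cast
  rfl

theorem exists_mem_intCube {ι : Type*} [Fintype ι] [DecidableEq ι] {η B : ℝ} (hη : 0 < η) {k : ℕ}
    (hk : B ≤ η * k) {x : ι → ℝ} (hx : ∀ i, |x i| ≤ B) :
    ∃ z ∈ intCube ι k, ∀ i, |x i - η * z i| ≤ η := by
  refine ⟨fun i => ⌊x i / η⌋, ?_, fun i => ?_⟩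
  · rw [intCube, Fintype.mem_piFinset]
    intro i
    obtain ⟨h1, h2⟩ := abs_le.1 ((hx i).trans hk)
    rw [Finset.mem_Icc]
    constructor
    · rw [Int.le_floor, le_div_iff₀ hη]
      push_cast
      linarith
    · have : x i / η ≤ k := by rw [div_le_iff₀ hη]; linarith
      exact_mod_cast (Int.floor_le _).trans this
  · have h1 := Int.floor_le (x i / η)
    have h2 := Int.lt_floor_add_one (x i / η)
    rw [le_div_iff₀ hη] at h1
    rw [div_lt_iff₀ hη] at h2
    rw [abs_le]
    constructor <;> linarith

theorem norm_le_sqrt_mul {d : ℕ} {x : EuclideanSpace ℝ (Fin d)} {c : ℝ} (hc : 0 ≤ c)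
    (hx : ∀ i, |x i| ≤ c) : ‖x‖ ≤ √(d : ℝ) * c := by
  rw [EuclideanSpace.norm_eq]
  refine Real.sqrt_le_iff.2 ⟨by positivity, ?_⟩
  rw [mul_pow, Real.sq_sqrt (Nat.cast_nonneg _)]
  calc ∑ i, ‖x i‖ ^ 2 ≤ ∑ _i : Fin d, c ^ 2 :=
        Finset.sum_le_sum fun i _ => pow_le_pow_left₀ (norm_nonneg _) (hx i) 2
    _ = d * c ^ 2 := by simp

/-- A covering number bound in the supremum norm yields a finite Euclidean net inside the set. -/
theorem exists_net_of_log_externalCoveringNumber_le {d : ℕ} {Θ : Set (EuclideanSpace ℝ (Fin d))}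
    {ε : ℝ≥0} {b : ℝ} (hcov : ENNReal.log (Metric.externalCoveringNumber ε
      ((fun θ : EuclideanSpace ℝ (Fin d) => (θ.ofLp : Fin d → ℝ)) '' Θ) : ℝ≥0∞) ≤ (b : EReal)) :
    ∃ I : Finset (EuclideanSpace ℝ (Fin d)), ↑I ⊆ Θ ∧ (I.card : ℝ) ≤ Real.exp b ∧
      ∀ θ ∈ Θ, ∃ θ₀ ∈ I, ‖θ - θ₀‖ ≤ √(d : ℝ) * (2 * ε) := by
  classical
  set T := (fun θ : EuclideanSpace ℝ (Fin d) => (θ.ofLp : Fin d → ℝ)) '' Θ with hT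
  have h1 : (Metric.externalCoveringNumber ε T : ℝ≥0∞) ≤ ENNReal.ofReal (Real.exp b) := by
    have := EReal.exp_monotone hcov
    rwa [ENNReal.exp_log, EReal.exp_coe] at this
  have h2 : ((Metric.coveringNumber (2 * ε) T : ℕ∞) : ℝ≥0∞) ≤ ENNReal.ofReal (Real.exp b) :=
    le_trans (by exact_mod_cast Metric.coveringNumber_two_mul_le_externalCoveringNumber ε T) h1
  have h3 : Metric.coveringNumber (2 * ε) T ≠ ⊤ := fun h => by
    rw [h] at h2
    simp at h2
  obtain ⟨C, hCT, hCfin, hCcov, hCcard⟩ := Metric.exists_set_encard_eq_coveringNumber h3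
  set F := hCfin.toFinset with hF
  have hsub : ∀ x ∈ F, WithLp.toLp 2 x ∈ Θ := by
    intro x hx
    obtain ⟨θ, hθ, rfl⟩ := hCT (hCfin.mem_toFinset.1 hx)
    exact hθ
  refine ⟨F.image (WithLp.toLp 2), ?_, ?_, fun θ hθ => ?_⟩
  · intro θ hθ
    obtain ⟨x, hx, rfl⟩ := Finset.mem_image.1 (Finset.mem_coe.1 hθ)
    exact hsub x hx
  · have h4 : ((F.card : ℕ∞) : ℝ≥0∞) ≤ ENNReal.ofReal (Real.exp b) := by
      rw [← hCcard, hCfin.encard_eq_coe_toFinset_card] at h2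
      exact h2
    have h5 : (F.card : ℝ) ≤ Real.exp b := by
      rw [ENat.toENNReal_coe, ← ENNReal.ofReal_natCast] at h4
      exact (ENNReal.ofReal_le_ofReal_iff (Real.exp_pos _).le).1 h4
    exact le_trans (by exact_mod_cast Finset.card_image_le) h5
  · obtain ⟨x, hx, hdist⟩ := hCcov ⟨θ, hθ, rfl⟩
    refine ⟨WithLp.toLp 2 x, Finset.mem_image_of_mem _ (hCfin.mem_toFinset.2 hx), ?_⟩
    refine norm_le_sqrt_mul (by positivity) fun i => ?_
    have h4 : dist θ.ofLp x ≤ 2 * ε := by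
      have : edist θ.ofLp x ≤ ((2 * ε : ℝ≥0) : ℝ≥0∞) := hdist
      rw [edist_le_coe, ← NNReal.coe_le_coe, coe_nndist] at this
      exact_mod_cast this
    exact (dist_le_pi_dist θ.ofLp x i).trans h4

end Nets

/-! ### Ridge regression -/

section Ridge

variable {E : Type*} [NormedAddCommGroup E] [InnerProductSpace ℝ E] {n : ℕ}

/-- The normal equations. -/
theorem ridge_normal_eq {x : Fin n → E} {y : Fin n → ℝ} {f : E → ℝ}
    (hf : ∀ u, f u = (∑ i, (inner ℝ (x i) u - y i) ^ 2) + ‖u‖ ^ 2) {w : E}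
    (hw : IsMinOn f Set.univ w) (v : E) :
    (∑ i, (inner ℝ (x i) w - y i) * inner ℝ (x i) v) + inner ℝ w v = 0 := by
  set g := (∑ i, (inner ℝ (x i) w - y i) * inner ℝ (x i) v) + inner ℝ w v with hg
  set q := (∑ i, inner ℝ (x i) v ^ 2) + ‖v‖ ^ 2
  -- along a line through the minimizer, `f` is a quadratic polynomial minimal at `t = 0`
  have hexp : ∀ t : ℝ, f (w + t • v) = f w + (2 * g * t + q * t ^ 2) := by
    intro t
    have h1 : ∀ i, (inner ℝ (x i) (w + t • v) - y i) ^ 2 = (inner ℝ (x i) w - y i) ^ 2 +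
        2 * t * ((inner ℝ (x i) w - y i) * inner ℝ (x i) v) + t ^ 2 * inner ℝ (x i) v ^ 2 := by
      intro i
      rw [inner_add_right, real_inner_smul_right]
      ring
    have h2 : ‖w + t • v‖ ^ 2 = ‖w‖ ^ 2 + 2 * t * inner ℝ w v + t ^ 2 * ‖v‖ ^ 2 := by
      rw [norm_add_sq_real, real_inner_smul_right, norm_smul, mul_pow, Real.norm_eq_abs, sq_abs]
      ring
    rw [hf, hf, h2]
    simp only [h1, Finset.sum_add_distrib, ← Finset.mul_sum]
    ring
  have hnn : ∀ t : ℝ, 0 ≤ q * (t * t) + 2 * g * t + 0 := fun t => by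
    have h1 : f w ≤ f (w + t • v) := hw (Set.mem_univ _)
    rw [hexp] at h1
    nlinarith
  have hd := discrim_le_zero hnn
  rw [discrim] at hd
  nlinarith

theorem ridge_norm_sq_le {x : Fin n → E} {y : Fin n → ℝ} {f : E → ℝ}
    (hf : ∀ u, f u = (∑ i, (inner ℝ (x i) u - y i) ^ 2) + ‖u‖ ^ 2) {w : E}
    (hw : IsMinOn f Set.univ w) : ‖w‖ ^ 2 ≤ ∑ i, y i ^ 2 := by
  have h1 : f w ≤ f 0 := hw (Set.mem_univ _)
  rw [hf, hf] at h1
  have h2 : 0 ≤ ∑ i, (inner ℝ (x i) w - y i) ^ 2 := Finset.sum_nonneg fun i _ => sq_nonneg _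
  simp only [inner_zero_right, zero_sub, neg_sq, norm_zero] at h1
  linarith

/-- The error `v = w₁ + w₂ - w` of the sum of two ridge estimates, in the norm of the regularized
Gram matrix, in terms of the correlation of `v` with the residuals `y₁ + y₂ - x · w`. -/
theorem ridge_error_le {x : Fin n → E} {y₁ y₂ : Fin n → ℝ} {f₁ f₂ : E → ℝ}
    (hf₁ : ∀ u, f₁ u = (∑ i, (inner ℝ (x i) u - y₁ i) ^ 2) + ‖u‖ ^ 2)
    (hf₂ : ∀ u, f₂ u = (∑ i, (inner ℝ (x i) u - y₂ i) ^ 2) + ‖u‖ ^ 2) {w₁ w₂ w : E}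
    (hw₁ : IsMinOn f₁ Set.univ w₁) (hw₂ : IsMinOn f₂ Set.univ w₂) {R : ℝ}
    (hR : ∑ i, inner ℝ (x i) (w₁ + w₂ - w) * (y₁ i + y₂ i - inner ℝ (x i) w) ≤
      (∑ i, inner ℝ (x i) (w₁ + w₂ - w) ^ 2) / 2 + R) :
    (∑ i, inner ℝ (x i) (w₁ + w₂ - w) ^ 2) + ‖w₁ + w₂ - w‖ ^ 2 ≤ 2 * R + ‖w‖ ^ 2 := by
  set v := w₁ + w₂ - w with hv
  have h1 := ridge_normal_eq hf₁ hw₁ v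
  have h2 := ridge_normal_eq hf₂ hw₂ v
  have h3 : ∀ i, inner ℝ (x i) v * (y₁ i + y₂ i - inner ℝ (x i) w) = inner ℝ (x i) v ^ 2 -
      (inner ℝ (x i) w₁ - y₁ i) * inner ℝ (x i) v -
      (inner ℝ (x i) w₂ - y₂ i) * inner ℝ (x i) v := fun i => by
    have : inner ℝ (x i) v = inner ℝ (x i) w₁ + inner ℝ (x i) w₂ - inner ℝ (x i) w := by
      rw [hv, inner_sub_right, inner_add_right]
    rw [this]
    ring
  simp only [h3, Finset.sum_sub_distrib] at hR
  have h4 : inner ℝ w₁ v + inner ℝ w₂ v = ‖v‖ ^ 2 + inner ℝ w v := by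
    rw [← real_inner_self_eq_norm_sq, ← inner_add_left, ← inner_add_left, hv, sub_add_cancel]
  have h5 : -inner ℝ w v ≤ ‖w‖ * ‖v‖ := by
    have := abs_real_inner_le_norm w v
    linarith [neg_abs_le (inner ℝ w v)]
  nlinarith [sq_nonneg (‖w‖ - ‖v‖)]

end Ridge

/-! ### The class of pessimistic value functions -/

section ValueClass

open Matrix

variable {S A : Type*} [Fintype A] [Nonempty A] {d : ℕ} {φ : S → A → EuclideanSpace ℝ (Fin d)}

/-- The greedy value of the action value function `min {φ · ω - β √(φᵀ B φ), b}_+`, where the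
vector `ω` and the matrix `B` are arbitrary. -/
noncomputable def clipV (φ : S → A → EuclideanSpace ℝ (Fin d)) (β b : ℝ)
    (ω : EuclideanSpace ℝ (Fin d)) (B : Matrix (Fin d) (Fin d) ℝ) (s : S) : ℝ :=
  Finset.univ.sup' Finset.univ_nonempty fun a =>
    max (min (linFun φ ω s a - β * √((φ s a).ofLp ⬝ᵥ B *ᵥ (φ s a).ofLp)) b) 0

theorem measurable_clipV [MeasurableSpace S] (hφ : ∀ a, Measurable fun s => φ s a) (β b : ℝ)
    (ω : EuclideanSpace ℝ (Fin d)) (B : Matrix (Fin d) (Fin d) ℝ) :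
    Measurable (clipV φ β b ω B) := by
  have h1 : Measurable (Finset.univ.sup' Finset.univ_nonempty fun (a : A) (s : S) =>
      max (min (linFun φ ω s a - β * √((φ s a).ofLp ⬝ᵥ B *ᵥ (φ s a).ofLp)) b) 0) :=
    Finset.measurable_sup' _ fun a _ => (((measurable_linFun hφ ω a).sub
      ((measurable_quadForm hφ B a).sqrt.const_mul β)).min measurable_const).max measurable_const
  convert h1 using 1
  funext s
  rw [Finset.sup'_apply]
  rfl

theorem clipV_mem_Icc {β b : ℝ} (hb : 0 ≤ b)
    (ω : EuclideanSpace ℝ (Fin d)) (B : Matrix (Fin d) (Fin d) ℝ) (s : S) :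
    clipV φ β b ω B s ∈ Set.Icc 0 b := by
  constructor
  · exact (le_max_right _ _).trans (Finset.le_sup' (fun a =>
      max (min (linFun φ ω s a - β * √((φ s a).ofLp ⬝ᵥ B *ᵥ (φ s a).ofLp)) b) 0)
      (Finset.mem_univ (Classical.arbitrary A)))
  · exact Finset.sup'_le _ _ fun a _ => max_le (min_le_right _ _) hb

omit [Fintype A] [Nonempty A] in
theorem abs_linFun_le (hφ1 : ∀ s a, ‖φ s a‖ ≤ 1) (θ : EuclideanSpace ℝ (Fin d)) (s : S) (a : A) :
    |linFun φ θ s a| ≤ ‖θ‖ :=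
  (abs_real_inner_le_norm _ _).trans (mul_le_of_le_one_left (norm_nonneg _) (hφ1 s a))

omit [Fintype A] [Nonempty A] in
theorem linFun_sub (θ θ' : EuclideanSpace ℝ (Fin d)) (s : S) (a : A) :
    linFun φ (θ - θ') s a = linFun φ θ s a - linFun φ θ' s a :=
  inner_sub_right _ _ _

theorem abs_sqrt_sub_sqrt_le (x y : ℝ) : |√x - √y| ≤ √|x - y| := by
  have key : ∀ x y : ℝ, √x - √y ≤ √|x - y| := fun x y => by
    rw [sub_le_iff_le_add]
    refine Real.sqrt_le_iff.2 ⟨by positivity, ?_⟩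
    have h1 := Real.sq_sqrt (abs_nonneg (x - y))
    have h2 : y ≤ √y ^ 2 := by
      rcases le_total 0 y with hy | hy
      · rw [Real.sq_sqrt hy]
      · exact hy.trans (sq_nonneg _)
    nlinarith [le_abs_self (x - y), mul_nonneg (Real.sqrt_nonneg |x - y|) (Real.sqrt_nonneg y)]
  rw [abs_le]
  constructor
  · have := key y x
    rw [abs_sub_comm] at this
    linarith
  · exact key x y

theorem clipV_sub_le (hφ1 : ∀ s a, ‖φ s a‖ ≤ 1) {β b : ℝ} (hβ : 0 ≤ β)
    (ω ω' : EuclideanSpace ℝ (Fin d)) {B B' : Matrix (Fin d) (Fin d) ℝ} {η : ℝ}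
    (hB : ∀ i j, |B i j - B' i j| ≤ η) (s : S) :
    clipV φ β b ω B s - clipV φ β b ω' B' s ≤ ‖ω - ω'‖ + β * √((d : ℝ) * d * η) := by
  rw [sub_le_iff_le_add]
  refine Finset.sup'_le _ _ fun a _ => ?_
  have h1 := Finset.le_sup' (fun a =>
      max (min (linFun φ ω' s a - β * √((φ s a).ofLp ⬝ᵥ B' *ᵥ (φ s a).ofLp)) b) 0)
      (Finset.mem_univ a)
  refine le_trans ?_ (add_le_add_right h1 _)
  have h2 := (abs_le.1 (abs_linFun_le hφ1 (ω - ω') s a)).2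
  rw [linFun_sub] at h2
  have h3 : |(φ s a).ofLp ⬝ᵥ B *ᵥ (φ s a).ofLp - (φ s a).ofLp ⬝ᵥ B' *ᵥ (φ s a).ofLp| ≤
      (d : ℝ) * d * η := by
    rw [EpisodicMDP.quadForm_eq_sum, EpisodicMDP.quadForm_eq_sum, ← Finset.sum_sub_distrib]
    simp only [← Finset.sum_sub_distrib, ← sub_mul]
    calc _ ≤ ∑ _i : Fin d, ∑ _j : Fin d, η := by
          refine (Finset.abs_sum_le_sum_abs _ _).trans (Finset.sum_le_sum fun i _ =>
            (Finset.abs_sum_le_sum_abs _ _).trans (Finset.sum_le_sum fun j _ => ?_))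
          rw [abs_mul, abs_mul]
          have hη : 0 ≤ η := (abs_nonneg _).trans (hB i j)
          refine (mul_le_mul_of_nonneg_right (hB i j) (by positivity)).trans
            (mul_le_of_le_one_right hη ?_)
          exact mul_le_one₀ (EpisodicMDP.abs_feature_le hφ1 s a i) (abs_nonneg _)
            (EpisodicMDP.abs_feature_le hφ1 s a j)
      _ = d * d * η := by simp; ring
  have h4 := (abs_le.1 ((abs_sqrt_sub_sqrt_le _ _).trans (Real.sqrt_le_sqrt h3))).1
  have h5 := mul_le_mul_of_nonneg_left h4 hβ
  have h6 : 0 ≤ ‖ω - ω'‖ + β * √((d : ℝ) * d * η) := by positivity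
  set c := ‖ω - ω'‖ + β * √((d : ℝ) * d * η) with hc
  have h7 : linFun φ ω s a - β * √((φ s a).ofLp ⬝ᵥ B *ᵥ (φ s a).ofLp) ≤
      c + (linFun φ ω' s a - β * √((φ s a).ofLp ⬝ᵥ B' *ᵥ (φ s a).ofLp)) := by
    rw [hc]
    linarith
  refine max_le ?_ (add_nonneg h6 (le_max_right _ _))
  refine le_trans ?_ (add_le_add_right (le_max_left _ _) c)
  rw [← min_add_add_left]
  exact min_le_min h7 (by linarith)

theorem abs_clipV_sub_le (hφ1 : ∀ s a, ‖φ s a‖ ≤ 1) {β b : ℝ} (hβ : 0 ≤ β)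
    (ω ω' : EuclideanSpace ℝ (Fin d)) {B B' : Matrix (Fin d) (Fin d) ℝ} {η : ℝ}
    (hB : ∀ i j, |B i j - B' i j| ≤ η) (s : S) :
    |clipV φ β b ω B s - clipV φ β b ω' B' s| ≤ ‖ω - ω'‖ + β * √((d : ℝ) * d * η) := by
  have h1 := clipV_sub_le hφ1 (b := b) hβ ω ω' hB s
  have h2 := clipV_sub_le hφ1 (b := b) hβ ω' ω (B := B') (B' := B) (η := η)
    (fun i j => by rw [abs_sub_comm]; exact hB i j) s
  rw [norm_sub_rev] at h2
  rw [abs_le]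
  constructor <;> linarith

/-- The greedy value function of the algorithm belongs to this class. -/
theorem pessV_eq_clipV [MeasurableSpace S] [MeasurableSpace A] {H n : ℕ} {β γ : ℝ}
    {Θ : Set (EuclideanSpace ℝ (Fin d))} {D : Fin n → Fin H → S × A}
    {θhat what utilde : Fin H → EuclideanSpace ℝ (Fin d)} {π : Policy S A}
    (hout : IsDCPPOOutput φ Θ γ 1 β D θhat what utilde π) (h : Fin H) (s : S) :
    pessV φ 1 β D what utilde π h s = clipV φ β ((H : ℝ) - (h : ℕ)) (what h + utilde h)
      (gramMatrix φ D h + (1 : ℝ) • (1 : Matrix (Fin d) (Fin d) ℝ))⁻¹ s := by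
  classical
  have hQ : ∀ a, pessQ φ 1 β D what utilde h s a = max (min (linFun φ (what h + utilde h) s a -
      β * √((φ s a).ofLp ⬝ᵥ (gramMatrix φ D h + (1 : ℝ) • (1 : Matrix (Fin d) (Fin d) ℝ))⁻¹ *ᵥ
        (φ s a).ofLp)) ((H : ℝ) - (h : ℕ))) 0 := fun a => by
    rw [pessQ, penalty]
    simp only [linFun, inner_add_right]
  simp only [clipV, ← hQ]
  obtain ⟨hp0, hp1⟩ := π.mem_stdSimplex h s
  refine le_antisymm ?_ (Finset.sup'_le _ _ fun a _ => ?_)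
  · rw [pessV]
    calc _ ≤ ∑ a, (Finset.univ.sup' Finset.univ_nonempty fun a =>
          pessQ φ 1 β D what utilde h s a) * π.prob h s a :=
        Finset.sum_le_sum fun a _ => mul_le_mul_of_nonneg_right
          (Finset.le_sup' (fun a => pessQ φ 1 β D what utilde h s a) (Finset.mem_univ a)) (hp0 a)
      _ = _ := by rw [← Finset.mul_sum, hp1, mul_one]
  · have h1 := hout.greedy h s (single_mem_stdSimplex ℝ a)
    simpa [Pi.single_apply, pessV] using h1

end ValueClass

/-! ### The error of the maximum likelihood estimates -/

section Likelihood

variable {S A : Type*} [MeasurableSpace S] [MeasurableSpace A] [Fintype A] [Nonempty A]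
  {H d n : ℕ} {φ : S → A → EuclideanSpace ℝ (Fin d)}

omit [MeasurableSpace A] [Nonempty A] in
theorem measurable_softmax_linFun (hφ : ∀ a, Measurable fun s => φ s a)
    (θ : EuclideanSpace ℝ (Fin d)) (a : A) : Measurable fun s => softmax (linFun φ θ s) a := by
  have := measurable_linFun hφ θ
  unfold softmax
  fun_prop

omit [MeasurableSpace A] [Nonempty A] in
theorem measurable_softmaxValue_linFun (hφ : ∀ a, Measurable fun s => φ s a)
    (θ : EuclideanSpace ℝ (Fin d)) : Measurable fun s => softmaxValue (linFun φ θ s) :=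
  Finset.measurable_sum _ fun a _ => (measurable_linFun hφ θ a).mul
    (measurable_softmax_linFun hφ θ a)

omit [MeasurableSpace S] [MeasurableSpace A] in
/-- Since the likelihood of the maximizer `θ` is at least that of `θ'`, an upper bound of the
compensated log-likelihood ratio of a neighbour `θ₀` of `θ` bounds the compensator. -/
theorem sum_compensator_le {Θ : Set (EuclideanSpace ℝ (Fin d))} {D : Fin n → Fin H → S × A}
    {h : Fin H} {θ θ' θ₀ : EuclideanSpace ℝ (Fin d)} (hn : 0 < n)
    (hmle : IsMaxOn (logLik φ D h) Θ θ) (hθ' : θ' ∈ Θ) {ρ : ℝ}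
    (hρ : ∀ s a, |linFun φ θ s a - linFun φ θ₀ s a| ≤ ρ) {W : Fin n → ℝ} {l : ℝ}
    (hl : ∑ i, ((Real.log (softmax (linFun φ θ₀ (D i h).1) (D i h).2) -
      Real.log (softmax (linFun φ θ' (D i h).1) (D i h).2)) / 2 + W i) ≤ l) :
    ∑ i, W i ≤ l + n * ρ := by
  have hlik : ∀ θ, logLik φ D h θ =
      (1 / (n : ℝ)) * ∑ i, Real.log (softmax (linFun φ θ (D i h).1) (D i h).2) := fun θ => by
    simp only [logLik, log_softmax]
  have h1 : logLik φ D h θ' ≤ logLik φ D h θ := hmle hθ'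
  rw [hlik, hlik] at h1
  have h2 := le_of_mul_le_mul_left h1 (by positivity)
  have h3 : ∑ i, Real.log (softmax (linFun φ θ (D i h).1) (D i h).2) ≤
      ∑ i, (Real.log (softmax (linFun φ θ₀ (D i h).1) (D i h).2) + 2 * ρ) :=
    Finset.sum_le_sum fun i _ => by
      have := (abs_le.1 (abs_log_softmax_sub_le (hρ (D i h).1) (D i h).2)).2
      linarith
  rw [Finset.sum_add_distrib, Finset.sum_const, Finset.card_univ, Fintype.card_fin,
    nsmul_eq_mul] at h3
  rw [Finset.sum_add_distrib, ← Finset.sum_div, Finset.sum_sub_distrib] at hl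
  linarith

omit [MeasurableSpace A] in
theorem sq_sum_abs_softmax_sub_le {q q' q₀ : A → ℝ} {ρ : ℝ} (h : ∀ a, |q a - q₀ a| ≤ ρ) :
    (∑ a, |softmax q a - softmax q' a|) ^ 2 ≤
      32 * ρ ^ 2 + 16 * hellingerSq (softmax q') (softmax q₀) := by
  have h1 := sum_abs_softmax_sub_le h
  have h2 := sum_sub_abs_sq_le_hellingerSq (softmax_mem_stdSimplex q') (softmax_mem_stdSimplex q₀)
  have h3 : ∑ a, |softmax q a - softmax q' a| ≤ ∑ a, |softmax q a - softmax q₀ a| +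
      ∑ a, |softmax q' a - softmax q₀ a| := by
    rw [← Finset.sum_add_distrib]
    refine Finset.sum_le_sum fun a _ => ?_
    rw [abs_sub_comm (softmax q' a)]
    exact abs_sub_le _ _ _
  have h4 : 0 ≤ ∑ a, |softmax q a - softmax q' a| := Finset.sum_nonneg fun _ _ => abs_nonneg _
  have h5 : 0 ≤ ∑ a, |softmax q a - softmax q₀ a| := Finset.sum_nonneg fun _ _ => abs_nonneg _
  set x := ∑ a, |softmax q a - softmax q₀ a|
  set y := ∑ a, |softmax q' a - softmax q₀ a|
  have h6 : (∑ a, |softmax q a - softmax q' a|) ^ 2 ≤ (x + y) ^ 2 := pow_le_pow_left₀ h4 h3 2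
  have h7 : x ^ 2 ≤ (4 * ρ) ^ 2 := pow_le_pow_left₀ h5 h1 2
  nlinarith [sq_nonneg (x - y)]

omit [MeasurableSpace A] in
/-- As `H ≤ e^H`, the contribution of the size of the logits is absorbed by their Lipschitz
constant. -/
theorem abs_softmaxValue_sub_le_of_identified {q q' : A → ℝ}
    (hq : ∀ a, q a ∈ Set.Icc (0 : ℝ) H) (hq' : ∀ a, q' a ∈ Set.Icc (0 : ℝ) H) {a₀ : A}
    (h0 : q a₀ = 0) (h0' : q' a₀ = 0) : |softmaxValue q - softmaxValue q'| ≤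
      2 * (Fintype.card A * Real.exp H) * ∑ a, |softmax q a - softmax q' a| := by
  have h1 := abs_softmaxValue_sub_le hq' (abs_sub_le_of_softmax hq hq' h0 h0')
  have h2 : (H : ℝ) ≤ Fintype.card A * Real.exp H := by
    have h3 := Real.add_one_le_exp (H : ℝ)
    have h4 : (1 : ℝ) ≤ Fintype.card A := by exact_mod_cast Fintype.card_pos
    nlinarith [Real.exp_pos (H : ℝ)]
  have h3 : 0 ≤ ∑ a, |softmax q a - softmax q' a| := Finset.sum_nonneg fun _ _ => abs_nonneg _
  nlinarith [mul_le_mul_of_nonneg_right h2 h3]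

omit [Fintype A] [Nonempty A] in
theorem EpisodicMDP.transition_sq_le (M : EpisodicMDP S A H) (h : ℕ) (s : S) (a : A) {f : S → ℝ}
    (hf : Measurable f) {B : ℝ} (hB : ∀ s, |f s| ≤ B) :
    M.transition h f s a ^ 2 ≤ M.transition h (fun s => f s ^ 2) s a := by
  have := M.markov h
  refine (even_two.convexOn_pow (𝕜 := ℝ)).map_integral_le (continuous_pow 2).continuousOn
    isClosed_univ (Filter.Eventually.of_forall fun _ => Set.mem_univ _)
    (M.integrable_of_bound_kernel h s a hf hB)
    (M.integrable_of_bound_kernel h s a (hf.pow_const 2) (B := B ^ 2) fun s => ?_)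
  change |f s ^ 2| ≤ B ^ 2
  rw [abs_pow]
  exact pow_le_pow_left₀ (abs_nonneg _) (hB s) 2

variable {Θ : Set (EuclideanSpace ℝ (Fin d))} {θ θ' θ₀ : EuclideanSpace ℝ (Fin d)} {ρ : ℝ}

omit [MeasurableSpace S] [MeasurableSpace A] in
/-- In-sample error of the estimated action values. -/
theorem sum_sq_linFun_sub_le (hrange : ∀ θ ∈ Θ, ∀ s a, linFun φ θ s a ∈ Set.Icc (0 : ℝ) H)
    (hid : Identified φ Θ) (hθ : θ ∈ Θ) (hθ' : θ' ∈ Θ)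
    (hρ : ∀ s a, |linFun φ θ s a - linFun φ θ₀ s a| ≤ ρ) (x : Fin n → S) (a : Fin n → A) :
    ∑ i, (linFun φ θ (x i) (a i) - linFun φ θ' (x i) (a i)) ^ 2 ≤
      (Fintype.card A * Real.exp H) ^ 2 * (32 * n * ρ ^ 2 +
        16 * ∑ i, hellingerSq (softmax (linFun φ θ' (x i))) (softmax (linFun φ θ₀ (x i)))) := by
  obtain ⟨a₀, ha₀⟩ := hid
  calc _ ≤ ∑ i, (Fintype.card A * Real.exp H) ^ 2 * (32 * ρ ^ 2 +
        16 * hellingerSq (softmax (linFun φ θ' (x i))) (softmax (linFun φ θ₀ (x i)))) := by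
        refine Finset.sum_le_sum fun i _ => ?_
        have h1 := abs_sub_le_of_softmax (hrange θ hθ (x i)) (hrange θ' hθ' (x i))
          (ha₀ θ hθ _) (ha₀ θ' hθ' _) (a i)
        rw [← sq_abs]
        refine (pow_le_pow_left₀ (abs_nonneg _) h1 2).trans ?_
        rw [mul_pow]
        exact mul_le_mul_of_nonneg_left (sq_sum_abs_softmax_sub_le (hρ (x i))) (sq_nonneg _)
    _ = _ := by
        rw [← Finset.mul_sum, Finset.sum_add_distrib, Finset.sum_const,
          Finset.card_univ, Fintype.card_fin, nsmul_eq_mul, ← Finset.mul_sum]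
        ring

/-- In-sample error of the predicted values of the next states. -/
theorem sum_sq_transition_softmaxValue_sub_le (M : EpisodicMDP S A H)
    (hφ : ∀ a, Measurable fun s => φ s a)
    (hrange : ∀ θ ∈ Θ, ∀ s a, linFun φ θ s a ∈ Set.Icc (0 : ℝ) H)
    (hid : Identified φ Θ) (hθ : θ ∈ Θ) (hθ' : θ' ∈ Θ)
    (hρ : ∀ s a, |linFun φ θ s a - linFun φ θ₀ s a| ≤ ρ) (h : ℕ) (x : Fin n → S) (a : Fin n → A) :
    ∑ i, (M.transition h (fun s => softmaxValue (linFun φ θ s)) (x i) (a i) -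
        M.transition h (fun s => softmaxValue (linFun φ θ' s)) (x i) (a i)) ^ 2 ≤
      4 * (Fintype.card A * Real.exp H) ^ 2 * (32 * n * ρ ^ 2 +
        16 * ∑ i, M.transition h (fun s => hellingerSq (softmax (linFun φ θ' s))
          (softmax (linFun φ θ₀ s))) (x i) (a i)) := by
  obtain ⟨a₀, ha₀⟩ := hid
  have hm := measurable_softmaxValue_linFun hφ
  have hv : ∀ θ ∈ Θ, ∀ s, |softmaxValue (linFun φ θ s)| ≤ (H : ℝ) := fun θ hθ s => by
    obtain ⟨h1, h2⟩ := softmaxValue_mem_Icc (hrange θ hθ s)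
    rwa [abs_of_nonneg h1]
  have hhm : Measurable fun s => hellingerSq (softmax (linFun φ θ' s)) (softmax (linFun φ θ₀ s)) :=
    EpisodicMDP.measurable_hellingerSq (measurable_softmax_linFun hφ θ')
      (measurable_softmax_linFun hφ θ₀)
  have hhb : ∀ s, |hellingerSq (softmax (linFun φ θ' s)) (softmax (linFun φ θ₀ s))| ≤ 1 :=
    fun s => by
      rw [abs_of_nonneg (hellingerSq_nonneg (softmax_mem_stdSimplex _) (softmax_mem_stdSimplex _))]
      exact hellingerSq_le_one _ _
  obtain ⟨c, hc⟩ : ∃ c, c = 4 * (Fintype.card A * Real.exp H) ^ 2 := ⟨_, rfl⟩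
  have hc0 : 0 ≤ c := by rw [hc]; positivity
  rw [← hc]
  calc _ ≤ ∑ i, c * (32 * ρ ^ 2 + 16 * M.transition h (fun s =>
        hellingerSq (softmax (linFun φ θ' s)) (softmax (linFun φ θ₀ s))) (x i) (a i)) := by
        refine Finset.sum_le_sum fun i _ => ?_
        rw [← M.transition_sub h (x i) (a i) (hm θ) (hm θ') (hv θ hθ) (hv θ' hθ')]
        have hsm := (hm θ).sub (hm θ')
        have hsb : ∀ s, |softmaxValue (linFun φ θ s) - softmaxValue (linFun φ θ' s)| ≤
            (H : ℝ) + H := fun s => (abs_sub _ _).trans (add_le_add (hv θ hθ s) (hv θ' hθ' s))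
        refine (M.transition_sq_le h (x i) (a i) hsm hsb).trans ?_
        rw [← M.transition_const_mul, mul_add, ← M.transition_const_mul]
        have hP := M.markov h
        have hconst : M.transition h (fun _ => c * (32 * ρ ^ 2)) (x i) (a i) =
            c * (32 * ρ ^ 2) := by simp [EpisodicMDP.transition]
        rw [← hconst, ← M.transition_add h (x i) (a i) (B := max |c * (32 * ρ ^ 2)| (c * 16))
          measurable_const ((hhm.const_mul 16).const_mul c) (fun _ => le_max_left _ _)
          (fun s => le_max_of_le_right ?_)]
        · refine M.transition_mono h (x i) (a i) (hsm.pow_const 2)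
            (measurable_const.add ((hhm.const_mul 16).const_mul c))
            (B := max ((H + H : ℝ) ^ 2) (|c * (32 * ρ ^ 2)| + c * 16)) (fun s => ?_)
            (fun s => ?_) (fun s => ?_)
          · rw [abs_pow]
            exact le_max_of_le_left (pow_le_pow_left₀ (abs_nonneg _) (hsb s) 2)
          · refine le_max_of_le_right ((abs_add_le _ _).trans (add_le_add_right ?_ _))
            rw [abs_mul, abs_mul, abs_of_nonneg hc0, abs_of_pos (by norm_num : (0 : ℝ) < 16)]
            have := hhb s
            nlinarith
          · have h1 := abs_softmaxValue_sub_le_of_identified (hrange θ hθ s) (hrange θ' hθ' s)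
              (ha₀ θ hθ s) (ha₀ θ' hθ' s)
            rw [← mul_add, ← sq_abs]
            refine (pow_le_pow_left₀ (abs_nonneg _) h1 2).trans ?_
            have h2 := mul_le_mul_of_nonneg_left
              (sq_sum_abs_softmax_sub_le (q' := linFun φ θ' s) (hρ s)) hc0
            rw [mul_pow, mul_pow]
            rw [hc] at h2 ⊢
            linarith
        · rw [abs_mul, abs_mul, abs_of_nonneg hc0, abs_of_pos (by norm_num : (0 : ℝ) < 16)]
          have := hhb s
          nlinarith
    _ = _ := by
        rw [← Finset.mul_sum, Finset.sum_add_distrib, Finset.sum_const,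
          Finset.card_univ, Fintype.card_fin, nsmul_eq_mul, ← Finset.mul_sum]
        ring

end Likelihood

/-! ### The regression error -/

section RegressionError

open Matrix

variable {S A : Type*} [MeasurableSpace S] [MeasurableSpace A] [Fintype A]
  {H d n : ℕ} {φ : S → A → EuclideanSpace ℝ (Fin d)} {Θ : Set (EuclideanSpace ℝ (Fin d))}
  {γ β : ℝ} {D : Fin n → Fin H → S × A}
  {θhat what utilde : Fin H → EuclideanSpace ℝ (Fin d)} {π : Policy S A}

/-- The residual of the two regressions with respect to their population targets. -/
noncomputable def regResidual (M : EpisodicMDP S A H) (φ : S → A → EuclideanSpace ℝ (Fin d))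
    (γ β : ℝ) (D : Fin n → Fin H → S × A) (θhat what utilde : Fin H → EuclideanSpace ℝ (Fin d))
    (π : Policy S A) (h : Fin H) (i : Fin n) : ℝ :=
  linFun φ (θhat h) (D i h).1 (D i h).2 - γ * nextVAlong (estV φ θhat) (D i) h +
    nextVAlong (pessV φ 1 β D what utilde π) (D i) h -
    (M.r h (D i h).1 (D i h).2 +
      M.transition h (nextV (pessV φ 1 β D what utilde π) h) (D i h).1 (D i h).2)

theorem sum_sq_add_norm_sq_le_of_residual (M : EpisodicMDP S A H)
    (hout : IsDCPPOOutput φ Θ γ 1 β D θhat what utilde π) (h : Fin H)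
    {w u : EuclideanSpace ℝ (Fin d)} (hw : ‖w‖ ≤ √(d : ℝ)) (hrw : M.r h = linFun φ w)
    (hu : ‖u‖ ≤ ((H : ℝ) - (h : ℕ)) * √(d : ℝ))
    (hPu : M.transition h (nextV (pessV φ 1 β D what utilde π) h) = linFun φ u) {R : ℝ}
    (hR : ∑ i, linFun φ (what h + utilde h - (w + u)) (D i h).1 (D i h).2 *
        regResidual M φ γ β D θhat what utilde π h i ≤
      (∑ i, linFun φ (what h + utilde h - (w + u)) (D i h).1 (D i h).2 ^ 2) / 2 + R) :
    (∑ i, linFun φ (what h + utilde h - (w + u)) (D i h).1 (D i h).2 ^ 2) +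
      ‖what h + utilde h - (w + u)‖ ^ 2 ≤ 2 * R + 4 * H ^ 2 * d := by
  have h1 := ridge_error_le (x := fun i => φ (D i h).1 (D i h).2)
    (y₁ := fun i => linFun φ (θhat h) (D i h).1 (D i h).2 -
      γ * nextVAlong (estV φ θhat) (D i) h)
    (y₂ := fun i => nextVAlong (pessV φ 1 β D what utilde π) (D i) h)
    (f₁ := rewardLoss φ γ 1 D θhat h)
    (f₂ := transitionLoss φ 1 D (pessV φ 1 β D what utilde π) h)
    (fun u => by
      rw [rewardLoss, one_mul]
      congr 1
      exact Finset.sum_congr rfl fun i _ => by rw [linFun]; ring)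
    (fun u => by rw [transitionLoss, one_mul]; rfl)
    (w := w + u) (hout.reward h) (hout.transition h) (R := R) (by
      refine le_trans (le_of_eq ?_) hR
      refine Finset.sum_congr rfl fun i _ => ?_
      rw [regResidual, hrw, hPu, inner_add_right]
      rfl)
  refine h1.trans (add_le_add_right ?_ _)
  have hH : (1 : ℝ) ≤ H := by exact_mod_cast (Nat.succ_le_of_lt (h.pos))
  have h2 : ‖w + u‖ ≤ 2 * H * √(d : ℝ) := by
    refine (norm_add_le _ _).trans ((add_le_add hw hu).trans ?_)
    have h3 : (0 : ℝ) ≤ (h : ℕ) := Nat.cast_nonneg _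
    nlinarith [Real.sqrt_nonneg (d : ℝ)]
  calc ‖w + u‖ ^ 2 ≤ (2 * H * √(d : ℝ)) ^ 2 := pow_le_pow_left₀ (norm_nonneg _) h2 2
    _ = 4 * H ^ 2 * d := by
        rw [mul_pow, Real.sq_sqrt (Nat.cast_nonneg _)]
        ring

/-- The penalties are uncertainty quantifiers as soon as the norm of the regression errors, in the
norms given by the regularized Gram matrices, is at most `β`. -/
theorem isUncertaintyQuantifier_of_residual (M : EpisodicMDP S A H)
    (hφ : ∀ a, Measurable fun s => φ s a)
    (hrew : ∀ h < H, ∃ w : EuclideanSpace ℝ (Fin d), ‖w‖ ≤ √(d : ℝ) ∧ M.r h = linFun φ w)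
    (htrans : LinearTransition M φ) (hβ : 0 ≤ β)
    (hout : IsDCPPOOutput φ Θ γ 1 β D θhat what utilde π) {R : ℝ}
    (hRβ : 2 * R + 4 * H ^ 2 * d ≤ β ^ 2)
    (hR : ∀ (h : Fin H) (w u : EuclideanSpace ℝ (Fin d)), ‖w‖ ≤ √(d : ℝ) →
      ‖u‖ ≤ ((H : ℝ) - (h : ℕ)) * √(d : ℝ) →
      ∑ i, linFun φ (what h + utilde h - (w + u)) (D i h).1 (D i h).2 *
        regResidual M φ γ β D θhat what utilde π h i ≤
      (∑ i, linFun φ (what h + utilde h - (w + u)) (D i h).1 (D i h).2 ^ 2) / 2 + R) :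
    IsUncertaintyQuantifier M φ 1 β D what utilde π := by
  intro h s a
  obtain ⟨w, hw, hrw⟩ := hrew h h.2
  obtain ⟨u, hu, hPu⟩ := htrans h h.2 _
    (measurable_nextV (fun h => measurable_pessV hφ π h) h)
    (nextV_pessV_mem_Icc (φ := φ) (D := D) (what := what) (utilde := utilde) (lam := 1)
      (β := β) π h)
  have h1 := sum_sq_add_norm_sq_le_of_residual M hout h hw hrw hu hPu (hR h w u hw hu)
  have h2 := abs_linFun_le_penalty φ D h hβ _ (h1.trans hRβ) s a
  have h3 : linFun φ (what h + utilde h - (w + u)) s a =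
      (linFun φ (what h) s a + linFun φ (utilde h) s a) -
      (M.r h s a + M.transition h (nextV (pessV φ 1 β D what utilde π) h) s a) := by
    rw [hrw, hPu]
    simp only [linFun, inner_sub_right, inner_add_right]
  rwa [h3] at h2

variable [Nonempty A]

omit [MeasurableSpace A] [Nonempty A] in
theorem nextVAlong_pessV_mem_Icc (τ : Fin H → S × A) (h : Fin H) :
    nextVAlong (pessV φ 1 β D what utilde π) τ h ∈ Set.Icc (0 : ℝ) ((H : ℝ) - (h : ℕ) - 1) := by
  unfold nextVAlong
  split_ifs with hh
  · have := pessV_mem_Icc (φ := φ) (D := D) (what := what) (utilde := utilde) (lam := 1)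
      (β := β) π ⟨h + 1, hh⟩ (τ ⟨h + 1, hh⟩).1
    push_cast at this
    rwa [sub_sub]
  · have : ((h : ℕ) : ℝ) + 1 ≤ H := by exact_mod_cast h.2
    exact ⟨le_rfl, by linarith⟩

omit [MeasurableSpace S] [MeasurableSpace A] in
theorem nextVAlong_estV_mem_Icc
    (hrange : ∀ θ ∈ Θ, ∀ s a, linFun φ θ s a ∈ Set.Icc (0 : ℝ) H) (hθ : ∀ h, θhat h ∈ Θ)
    (τ : Fin H → S × A) (h : Fin H) :
    nextVAlong (estV φ θhat) τ h ∈ Set.Icc (0 : ℝ) H := by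
  unfold nextVAlong
  split_ifs with hh
  · exact softmaxValue_mem_Icc (hrange _ (hθ _) _)
  · exact ⟨le_rfl, Nat.cast_nonneg _⟩

/-- The residuals are at most `2 H`, which settles the case of few trajectories. -/
theorem abs_residual_le (M : EpisodicMDP S A H) (hφ : ∀ a, Measurable fun s => φ s a)
    (hrange : ∀ θ ∈ Θ, ∀ s a, linFun φ θ s a ∈ Set.Icc (0 : ℝ) H) (hγ : γ ∈ Set.Icc (0 : ℝ) 1)
    (hθ : ∀ h, θhat h ∈ Θ) (h : Fin H) (i : Fin n) :
    |regResidual M φ γ β D θhat what utilde π h i| ≤ 2 * H := by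
  obtain ⟨h1, h2⟩ := hrange _ (hθ h) (D i h).1 (D i h).2
  obtain ⟨h3, h4⟩ := nextVAlong_estV_mem_Icc hrange hθ (D i) h
  obtain ⟨h5, h6⟩ := nextVAlong_pessV_mem_Icc (φ := φ) (D := D) (what := what)
    (utilde := utilde) (β := β) (π := π) (D i) h
  obtain ⟨h7, h8⟩ := M.r_mem h h.2 (D i h).1 (D i h).2
  obtain ⟨h9, h10⟩ := M.transition_mem_Icc h (D i h).1 (D i h).2
    (measurable_nextV (fun h => measurable_pessV hφ π h) h)
    (nextV_pessV_mem_Icc (φ := φ) (D := D) (what := what) (utilde := utilde) (lam := 1)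
      (β := β) π h)
  have h11 : γ * nextVAlong (estV φ θhat) (D i) h ≤ H := by
    nlinarith [hγ.1, hγ.2]
  have h12 := mul_nonneg hγ.1 h3
  have h13 : (0 : ℝ) ≤ (h : ℕ) := Nat.cast_nonneg _
  rw [regResidual, abs_le]
  constructor <;> linarith

end RegressionError

/-! ### Regular datasets -/

section GoodData

open Matrix

variable {S A : Type*} [MeasurableSpace S] [MeasurableSpace A] [Fintype A] [Nonempty A]
  {H d n : ℕ} {φ : S → A → EuclideanSpace ℝ (Fin d)} {Θ : Set (EuclideanSpace ℝ (Fin d))}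
  {γ β : ℝ} {D : Fin n → Fin H → S × A}
  {θhat what utilde : Fin H → EuclideanSpace ℝ (Fin d)} {π : Policy S A}

/-- The coordinates of two vectors and a matrix. -/
abbrev NetIndex (d : ℕ) : Type := Fin d ⊕ Fin d ⊕ (Fin d × Fin d)

/-- The direction coded by a point of the grid of mesh `η`. -/
noncomputable def netDir (η : ℝ) (z : NetIndex d → ℤ) : EuclideanSpace ℝ (Fin d) :=
  WithLp.toLp 2 fun i => η * z (Sum.inl i)

/-- The parameter vector coded by a point of the grid of mesh `η`. -/
noncomputable def netVec (η : ℝ) (z : NetIndex d → ℤ) : EuclideanSpace ℝ (Fin d) :=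
  WithLp.toLp 2 fun i => η * z (Sum.inr (Sum.inl i))

/-- The matrix coded by a point of the grid of mesh `η`. -/
noncomputable def netMat (η : ℝ) (z : NetIndex d → ℤ) : Matrix (Fin d) (Fin d) ℝ :=
  Matrix.of fun i j => η * z (Sum.inr (Sum.inr (i, j)))

/-- The difference of a pessimistic value function and a discounted agent value function: the
regression noise is `G(s_{h+1}) - ℙ_h G` for such functions `G`. -/
noncomputable def valueDiff (φ : S → A → EuclideanSpace ℝ (Fin d)) (γ β b : ℝ)
    (ω : EuclideanSpace ℝ (Fin d)) (B : Matrix (Fin d) (Fin d) ℝ) (θ : EuclideanSpace ℝ (Fin d))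
    (s : S) : ℝ :=
  clipV φ β b ω B s - γ * softmaxValue (linFun φ θ s)

/-- The noise term of a trajectory `τ` at step `h`, in the direction `v`. -/
noncomputable def noiseTerm (M : EpisodicMDP S A H) (φ : S → A → EuclideanSpace ℝ (Fin d))
    (v : EuclideanSpace ℝ (Fin d)) (G : S → ℝ) {h : ℕ} (hh : h + 1 < H) (τ : Fin H → S × A) : ℝ :=
  linFun φ v (τ ⟨h, by omega⟩).1 (τ ⟨h, by omega⟩).2 *
    (G (τ ⟨h + 1, hh⟩).1 - M.transition h G (τ ⟨h, by omega⟩).1 (τ ⟨h, by omega⟩).2) /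
      (2 * (H : ℝ) ^ 2) -
    linFun φ v (τ ⟨h, by omega⟩).1 (τ ⟨h, by omega⟩).2 ^ 2 / (8 * (H : ℝ) ^ 2)

/-- The datasets on which the compensated log-likelihood ratios of a finite set `I` of parameters
are at most `l₁`, and the noise terms of the grid points are at most `l₂`. -/
structure GoodData (M : EpisodicMDP S A H) (φ : S → A → EuclideanSpace ℝ (Fin d)) (γ β η l₁ l₂ : ℝ)
    (I : Finset (EuclideanSpace ℝ (Fin d))) (k : ℕ) (D : Fin n → Fin H → S × A) : Prop where
  lik : ∀ h : Fin H, ∀ θ ∈ I, ∑ i, ((Real.log (softmax (linFun φ θ (D i h).1) (D i h).2) -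
    Real.log ((M.behavior γ).prob h (D i h).1 (D i h).2)) / 2 +
      hellingerSq ((M.behavior γ).prob h (D i h).1) (softmax (linFun φ θ (D i h).1))) ≤ l₁
  likNext : ∀ h : ℕ, ∀ hh : h + 1 < H, ∀ θ ∈ I,
    ∑ i, ((Real.log (softmax (linFun φ θ (D i ⟨h + 1, hh⟩).1) (D i ⟨h + 1, hh⟩).2) -
      Real.log ((M.behavior γ).prob (h + 1) (D i ⟨h + 1, hh⟩).1 (D i ⟨h + 1, hh⟩).2)) / 2 +
      M.transition h (fun s => hellingerSq ((M.behavior γ).prob (h + 1) s)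
        (softmax (linFun φ θ s))) (D i ⟨h, by omega⟩).1 (D i ⟨h, by omega⟩).2) ≤ l₁
  noise : ∀ h : ℕ, ∀ hh : h + 1 < H, ∀ x ∈ intCube (NetIndex d) k ×ˢ I,
    ∑ i, noiseTerm M φ (netDir η x.1) (valueDiff φ γ β ((H : ℝ) - ((h + 1 : ℕ) : ℝ))
      (netVec η x.1) (netMat η x.1) x.2) hh (D i) ≤ l₂

omit [MeasurableSpace S] [MeasurableSpace A] in
theorem valueDiff_mem_Icc (hrange : ∀ θ ∈ Θ, ∀ s a, linFun φ θ s a ∈ Set.Icc (0 : ℝ) H)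
    (hγ : γ ∈ Set.Icc (0 : ℝ) 1) {b : ℝ} (hb : b ∈ Set.Icc (0 : ℝ) H)
    (ω : EuclideanSpace ℝ (Fin d)) (B : Matrix (Fin d) (Fin d) ℝ) {θ : EuclideanSpace ℝ (Fin d)}
    (hθ : θ ∈ Θ) (s : S) : valueDiff φ γ β b ω B θ s ∈ Set.Icc (-(H : ℝ)) H := by
  obtain ⟨h1, h2⟩ := clipV_mem_Icc (φ := φ) (β := β) hb.1 ω B s
  obtain ⟨h3, h4⟩ := softmaxValue_mem_Icc (hrange θ hθ s)
  have h5 := mul_nonneg hγ.1 h3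
  have h6 : γ * softmaxValue (linFun φ θ s) ≤ H := by nlinarith [hγ.1, hγ.2]
  have := hb.2
  rw [valueDiff]
  constructor <;> linarith

omit [MeasurableSpace A] in
theorem measurable_valueDiff (hφ : ∀ a, Measurable fun s => φ s a) (b : ℝ)
    (ω : EuclideanSpace ℝ (Fin d)) (B : Matrix (Fin d) (Fin d) ℝ)
    (θ : EuclideanSpace ℝ (Fin d)) : Measurable (valueDiff φ γ β b ω B θ) :=
  (measurable_clipV hφ β b ω B).sub ((measurable_softmaxValue_linFun hφ θ).const_mul γ)

/-- Transfer of the noise bound from the grid to its neighbourhood. -/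
theorem sum_mul_le_of_near {y y₀ ε ε₀ : Fin n → ℝ} {b a e R l : ℝ} (hb : 0 < b)
    (hy : ∀ i, |y i| ≤ R) (hyy : ∀ i, |y i - y₀ i| ≤ a) (hε : ∀ i, |ε i - ε₀ i| ≤ e)
    (hε₀ : ∀ i, |ε₀ i| ≤ 2 * b)
    (hl : ∑ i, (y₀ i * ε₀ i / (2 * b ^ 2) - y₀ i ^ 2 / (8 * b ^ 2)) ≤ l) :
    ∑ i, y i * ε i ≤ (∑ i, y i ^ 2) / 4 + 2 * b ^ 2 * l +
      n * (R * e + 2 * b * a + a * (2 * R + a) / 4) := by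
  have h1 : ∀ i, y i * ε i ≤ y i ^ 2 / 4 + 2 * b ^ 2 *
      (y₀ i * ε₀ i / (2 * b ^ 2) - y₀ i ^ 2 / (8 * b ^ 2)) +
      (R * e + 2 * b * a + a * (2 * R + a) / 4) := by
    intro i
    have h2 : 2 * b ^ 2 * (y₀ i * ε₀ i / (2 * b ^ 2) - y₀ i ^ 2 / (8 * b ^ 2)) =
        y₀ i * ε₀ i - y₀ i ^ 2 / 4 := by
      field_simp
      ring
    have h3 : y i * (ε i - ε₀ i) ≤ R * e := by
      refine (le_abs_self _).trans ?_
      rw [abs_mul]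
      exact mul_le_mul (hy i) (hε i) (abs_nonneg _) ((abs_nonneg _).trans (hy i))
    have h4 : (y i - y₀ i) * ε₀ i ≤ a * (2 * b) := by
      refine (le_abs_self _).trans ?_
      rw [abs_mul]
      exact mul_le_mul (hyy i) (hε₀ i) (abs_nonneg _) ((abs_nonneg _).trans (hyy i))
    have h5 : y₀ i ^ 2 - y i ^ 2 ≤ a * (2 * R + a) := by
      have h6 : y₀ i ^ 2 - y i ^ 2 = -(y i - y₀ i) * (2 * y i - (y i - y₀ i)) := by ring
      rw [h6]
      refine (le_abs_self _).trans ?_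
      rw [abs_mul, abs_neg]
      refine mul_le_mul (hyy i) ((abs_sub _ _).trans (add_le_add ?_ (hyy i))) (abs_nonneg _)
        ((abs_nonneg _).trans (hyy i))
      rw [abs_mul, abs_two]
      exact mul_le_mul_of_nonneg_left (hy i) zero_le_two
    rw [h2]
    linarith
  refine (Finset.sum_le_sum fun i _ => h1 i).trans ?_
  rw [Finset.sum_add_distrib, Finset.sum_add_distrib, Finset.sum_const, Finset.card_univ,
    Fintype.card_fin, nsmul_eq_mul, ← Finset.mul_sum, ← Finset.sum_div]
  gcongr

omit [MeasurableSpace S] [MeasurableSpace A] in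
theorem abs_valueDiff_sub_le (hφ1 : ∀ s a, ‖φ s a‖ ≤ 1)
    (hrange : ∀ θ ∈ Θ, ∀ s a, linFun φ θ s a ∈ Set.Icc (0 : ℝ) H)
    (hγ : γ ∈ Set.Icc (0 : ℝ) 1) (hH : 1 ≤ H) (hβ : 0 ≤ β) {b : ℝ}
    (ω ω' : EuclideanSpace ℝ (Fin d)) {B B' : Matrix (Fin d) (Fin d) ℝ} {η : ℝ}
    (hB : ∀ i j, |B i j - B' i j| ≤ η) {θ θ' : EuclideanSpace ℝ (Fin d)} (hθ' : θ' ∈ Θ) (s : S) :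
    |valueDiff φ γ β b ω B θ s - valueDiff φ γ β b ω' B' θ' s| ≤
      ‖ω - ω'‖ + β * √((d : ℝ) * d * η) + 5 * H * ‖θ - θ'‖ := by
  have h1 := abs_clipV_sub_le hφ1 (b := b) hβ ω ω' hB s
  have h2 : ∀ a, |linFun φ θ s a - linFun φ θ' s a| ≤ ‖θ - θ'‖ := fun a => by
    rw [← linFun_sub]
    exact abs_linFun_le hφ1 _ s a
  have h3 := abs_softmaxValue_sub_le (hrange θ' hθ' s) h2
  have h4 := sum_abs_softmax_sub_le h2
  have hH' : (1 : ℝ) ≤ H := by exact_mod_cast hH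
  have h5 : |softmaxValue (linFun φ θ s) - softmaxValue (linFun φ θ' s)| ≤ 5 * H * ‖θ - θ'‖ := by
    have h6 : H * ∑ a, |softmax (linFun φ θ s) a - softmax (linFun φ θ' s) a| ≤
        H * (4 * ‖θ - θ'‖) := mul_le_mul_of_nonneg_left h4 (by linarith)
    have h7 : ‖θ - θ'‖ ≤ H * ‖θ - θ'‖ := le_mul_of_one_le_left (norm_nonneg _) hH'
    linarith
  have h8 : valueDiff φ γ β b ω B θ s - valueDiff φ γ β b ω' B' θ' s =
      (clipV φ β b ω B s - clipV φ β b ω' B' s) +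
        -(γ * (softmaxValue (linFun φ θ s) - softmaxValue (linFun φ θ' s))) := by
    simp only [valueDiff]
    ring
  rw [h8]
  refine (abs_add_le _ _).trans (add_le_add h1 ?_)
  rw [abs_neg, abs_mul, abs_of_nonneg hγ.1]
  exact (mul_le_of_le_one_left (abs_nonneg _) hγ.2).trans h5

/-- On a regular dataset, the correlation of the noise with any bounded direction is at most a
quarter of its empirical squared norm, up to the logarithmic size of the net. The mesh
`(1 / (β n³))²` makes the discretization error of order `H²`. -/
theorem sum_mul_noise_le (M : EpisodicMDP S A H) (hφ : ∀ a, Measurable fun s => φ s a)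
    (hφ1 : ∀ s a, ‖φ s a‖ ≤ 1)
    (hrange : ∀ θ ∈ Θ, ∀ s a, linFun φ θ s a ∈ Set.Icc (0 : ℝ) H) (hγ : γ ∈ Set.Icc (0 : ℝ) 1)
    (hβ : 1 ≤ β) (hn : 0 < n) (hdn : d ≤ n) {l₁ l₂ : ℝ} {I : Finset (EuclideanSpace ℝ (Fin d))}
    {k : ℕ} (hI : ↑I ⊆ Θ)
    (hIΘ : ∀ θ ∈ Θ, ∃ θ₀ ∈ I, ‖θ - θ₀‖ ≤ 1 / (n : ℝ) ^ 2)
    (hk : 4 * H * n ≤ (1 / (β * (n : ℝ) ^ 3)) ^ 2 * k)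
    (hD : GoodData M φ γ β ((1 / (β * (n : ℝ) ^ 3)) ^ 2) l₁ l₂ I k D) {h : ℕ} (hh : h + 1 < H)
    {v ω θ : EuclideanSpace ℝ (Fin d)} {B : Matrix (Fin d) (Fin d) ℝ}
    (hv : ‖v‖ ≤ 4 * H * n) (hω : ‖ω‖ ≤ 4 * H * n) (hB : ∀ i j, |B i j| ≤ 1) (hθ : θ ∈ Θ) :
    ∑ i, linFun φ v (D i ⟨h, by omega⟩).1 (D i ⟨h, by omega⟩).2 *
      (valueDiff φ γ β ((H : ℝ) - ((h + 1 : ℕ) : ℝ)) ω B θ (D i ⟨h + 1, hh⟩).1 -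
        M.transition h (valueDiff φ γ β ((H : ℝ) - ((h + 1 : ℕ) : ℝ)) ω B θ)
          (D i ⟨h, by omega⟩).1 (D i ⟨h, by omega⟩).2) ≤
      (∑ i, linFun φ v (D i ⟨h, by omega⟩).1 (D i ⟨h, by omega⟩).2 ^ 2) / 4 +
        2 * (H : ℝ) ^ 2 * l₂ + 64 * (H : ℝ) ^ 2 := by
  classical
  set η : ℝ := (1 / (β * (n : ℝ) ^ 3)) ^ 2 with hη
  have hn1 : (1 : ℝ) ≤ n := by exact_mod_cast hn
  have hH1 : (1 : ℝ) ≤ H := by exact_mod_cast (by omega : 1 ≤ H)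
  have hHn : (1 : ℝ) ≤ H * n := by nlinarith
  have hdn' : (d : ℝ) ≤ n := by exact_mod_cast hdn
  have hβ0 : 0 < β := by linarith
  have hη0 : 0 < η := by positivity
  set b : ℝ := (H : ℝ) - ((h + 1 : ℕ) : ℝ) with hb
  have hbmem : b ∈ Set.Icc (0 : ℝ) H := by
    have h1 : ((h + 1 : ℕ) : ℝ) ≤ H := by exact_mod_cast hh.le
    have h2 : (0 : ℝ) ≤ ((h + 1 : ℕ) : ℝ) := Nat.cast_nonneg _
    constructor <;> linarith
  obtain ⟨θ₀, hθ₀I, hθ₀⟩ := hIΘ θ hθ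
  obtain ⟨z, hz, hzx⟩ := exists_mem_intCube (ι := NetIndex d) hη0 hk
    (x := Sum.elim (fun i => v i) (Sum.elim (fun i => ω i) fun p => B p.1 p.2)) (by
      rintro (i | i | ⟨i, j⟩)
      · exact (PiLp.norm_apply_le v i).trans hv
      · exact (PiLp.norm_apply_le ω i).trans hω
      · exact (hB i j).trans (by linarith))
  have hsd : √(d : ℝ) * η ≤ n * η := by
    refine mul_le_mul_of_nonneg_right (Real.sqrt_le_iff.2 ⟨by linarith, ?_⟩) hη0.le
    nlinarith
  have hv₀ : ‖v - netDir η z‖ ≤ n * η := by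
    refine (norm_le_sqrt_mul hη0.le fun i => ?_).trans hsd
    simpa [netDir] using hzx (Sum.inl i)
  have hω₀ : ‖ω - netVec η z‖ ≤ n * η := by
    refine (norm_le_sqrt_mul hη0.le fun i => ?_).trans hsd
    simpa [netVec] using hzx (Sum.inr (Sum.inl i))
  have hB₀ : ∀ i j, |B i j - netMat η z i j| ≤ η := fun i j => by
    simpa [netMat] using hzx (Sum.inr (Sum.inr (i, j)))
  -- the mesh is fine enough for the vectors and for the square root of the quadratic form
  have hnη : n * η ≤ 1 / (n : ℝ) ^ 2 := by
    have h1 : η ≤ (1 / (n : ℝ) ^ 3) ^ 2 := by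
      refine pow_le_pow_left₀ (by positivity) ?_ 2
      refine one_div_le_one_div_of_le (by positivity) ?_
      exact le_mul_of_one_le_left (by positivity) hβ
    calc n * η ≤ n * (1 / (n : ℝ) ^ 3) ^ 2 := by gcongr
      _ = 1 / (n : ℝ) ^ 2 * (1 / (n : ℝ)) ^ 3 := by field_simp
      _ ≤ 1 / (n : ℝ) ^ 2 * 1 := by
        gcongr
        exact pow_le_one₀ (by positivity) ((div_le_one (by linarith)).2 hn1)
      _ = _ := mul_one _
  have hβη : β * √((d : ℝ) * d * η) ≤ 1 / (n : ℝ) ^ 2 := by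
    have h1 : √((d : ℝ) * d * η) = d * (1 / (β * (n : ℝ) ^ 3)) := by
      rw [hη, ← pow_two, ← mul_pow, Real.sqrt_sq (by positivity)]
    rw [h1]
    calc β * (d * (1 / (β * (n : ℝ) ^ 3))) ≤ β * (n * (1 / (β * (n : ℝ) ^ 3))) := by gcongr
      _ = 1 / (n : ℝ) ^ 2 := by field_simp
  set G := valueDiff φ γ β b ω B θ with hG
  set G₀ := valueDiff φ γ β b (netVec η z) (netMat η z) θ₀ with hG₀
  have hGm : Measurable G := measurable_valueDiff hφ b ω B θ
  have hG₀m : Measurable G₀ := measurable_valueDiff hφ b _ _ θ₀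
  have hGb : ∀ s, |G s| ≤ H := fun s => abs_le.2 (valueDiff_mem_Icc hrange hγ hbmem ω B hθ s)
  have hG₀b : ∀ s, |G₀ s| ≤ H := fun s =>
    abs_le.2 (valueDiff_mem_Icc hrange hγ hbmem _ _ (hI hθ₀I) s)
  have hGG : ∀ s, |G s - G₀ s| ≤ 7 * H / (n : ℝ) ^ 2 := fun s => by
    refine (abs_valueDiff_sub_le hφ1 hrange hγ (by omega) hβ0.le ω _ hB₀ (hI hθ₀I) s).trans ?_
    have h1 : 5 * (H : ℝ) * ‖θ - θ₀‖ ≤ 5 * H * (1 / (n : ℝ) ^ 2) := by gcongr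
    have h2 : 1 / (n : ℝ) ^ 2 ≤ H * (1 / (n : ℝ) ^ 2) :=
      le_mul_of_one_le_left (by positivity) hH1
    have h3 : 7 * H / (n : ℝ) ^ 2 = 7 * (H * (1 / (n : ℝ) ^ 2)) := by ring
    rw [h3]
    linarith [hω₀.trans hnη]
  have hmain := sum_mul_le_of_near (b := (H : ℝ)) (R := 4 * H * n) (a := n * η)
    (e := 14 * H / (n : ℝ) ^ 2) (l := l₂)
    (y := fun i => linFun φ v (D i ⟨h, by omega⟩).1 (D i ⟨h, by omega⟩).2)
    (y₀ := fun i => linFun φ (netDir η z) (D i ⟨h, by omega⟩).1 (D i ⟨h, by omega⟩).2)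
    (ε := fun i => G (D i ⟨h + 1, hh⟩).1 -
      M.transition h G (D i ⟨h, by omega⟩).1 (D i ⟨h, by omega⟩).2)
    (ε₀ := fun i => G₀ (D i ⟨h + 1, hh⟩).1 -
      M.transition h G₀ (D i ⟨h, by omega⟩).1 (D i ⟨h, by omega⟩).2) (by linarith)
    (fun i => (abs_linFun_le hφ1 v _ _).trans hv)
    (fun i => by
      rw [← linFun_sub]
      exact (abs_linFun_le hφ1 _ _ _).trans hv₀)
    (fun i => by
      rw [sub_sub_sub_comm, ← M.transition_sub h _ _ hGm hG₀m hGb hG₀b]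
      refine (abs_sub _ _).trans ((add_le_add (hGG _)
        (M.abs_transition_le h _ _ (hGm.sub hG₀m) hGG)).trans_eq ?_)
      ring)
    (fun i => by
      refine (abs_sub _ _).trans ((add_le_add (hG₀b _)
        (M.abs_transition_le h _ _ hG₀m hG₀b)).trans_eq ?_)
      ring)
    (hD.noise h hh (z, θ₀) (Finset.mem_product.2 ⟨hz, hθ₀I⟩))
  refine hmain.trans (add_le_add_right ?_ _)
  -- the discretization error is at most `56 H² + 2 H + 2 H + 1 / 4`
  have e1 : (n : ℝ) * (4 * H * n * (14 * H / (n : ℝ) ^ 2)) = 56 * (H : ℝ) ^ 2 := by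
    field_simp
    ring
  have e2 : (n : ℝ) * (n * η) ≤ 1 := by
    calc (n : ℝ) * (n * η) ≤ n * (1 / (n : ℝ) ^ 2) := by gcongr
      _ = 1 / n := by field_simp
      _ ≤ 1 := (div_le_one (by linarith)).2 hn1
  have e3 : (n : ℝ) * (n * η * (4 * H * n)) ≤ 4 * H := by
    calc (n : ℝ) * (n * η * (4 * H * n)) ≤ n * (1 / (n : ℝ) ^ 2 * (4 * H * n)) := by gcongr
      _ = 4 * H := by field_simp
  have e4 : (n : ℝ) * η ≤ 1 := by
    have : (n : ℝ) * η ≤ n * (n * η) := le_mul_of_one_le_left (by positivity) hn1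
    linarith
  have e5 : (n : ℝ) * (n * η * (n * η)) ≤ 1 := by
    calc (n : ℝ) * (n * η * (n * η)) = (n * (n * η)) * (n * η) := by ring
      _ ≤ 1 * 1 := mul_le_mul e2 e4 (by positivity) zero_le_one
      _ = 1 := mul_one _
  have e6 : (H : ℝ) ≤ H ^ 2 := by nlinarith
  have e7 : 2 * (H : ℝ) * (n * (n * η)) ≤ 2 * H * 1 := by gcongr
  have e8 : (n : ℝ) * (4 * H * n * (14 * H / (n : ℝ) ^ 2) + 2 * H * (n * η) +
      n * η * (2 * (4 * H * n) + n * η) / 4) =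
      n * (4 * H * n * (14 * H / (n : ℝ) ^ 2)) + 2 * H * (n * (n * η)) +
        n * (n * η * (4 * H * n)) / 2 + n * (n * η * (n * η)) / 4 := by ring
  rw [e8]
  linarith

end GoodData

/-! ### Uncertainty quantification on regular datasets -/

section Quantifier

open Matrix

variable {S A : Type*} [MeasurableSpace S] [MeasurableSpace A] [Fintype A] [Nonempty A]
  {H d n : ℕ} {φ : S → A → EuclideanSpace ℝ (Fin d)} {Θ : Set (EuclideanSpace ℝ (Fin d))}
  {γ β : ℝ} {D : Fin n → Fin H → S × A}
  {θhat what utilde : Fin H → EuclideanSpace ℝ (Fin d)} {π : Policy S A}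

omit [Nonempty A] in
theorem EpisodicMDP.agentV_eq_softmaxValue (M : EpisodicMDP S A H) {h : ℕ} (hh : h < H) :
    M.agentV γ h = fun s => softmaxValue (M.agentQ γ h s) := by
  obtain ⟨k, hk⟩ : ∃ k, H - h = k + 1 := ⟨H - h - 1, by omega⟩
  have hk' : H - (h + 1) = k := by omega
  funext s
  rw [EpisodicMDP.agentV, hk, EpisodicMDP.agentVAux, softmaxValue]
  unfold EpisodicMDP.agentQ EpisodicMDP.agentV
  rw [hk']
  exact Finset.sum_congr rfl fun a _ => mul_comm _ _

omit [MeasurableSpace S] [MeasurableSpace A] in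
/-- The ridge estimate of the reward has norm at most `H n`. -/
theorem norm_what_le (hrange : ∀ θ ∈ Θ, ∀ s a, linFun φ θ s a ∈ Set.Icc (0 : ℝ) H)
    (hγ : γ ∈ Set.Icc (0 : ℝ) 1) (hn : 0 < n) (hθ : ∀ h, θhat h ∈ Θ) {h : Fin H}
    (hw : IsMinOn (rewardLoss φ γ 1 D θhat h) Set.univ (what h)) : ‖what h‖ ≤ H * n := by
  have h1 := ridge_norm_sq_le (x := fun i => φ (D i h).1 (D i h).2)
    (y := fun i => linFun φ (θhat h) (D i h).1 (D i h).2 -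
      γ * nextVAlong (estV φ θhat) (D i) h)
    (fun u => by
      rw [rewardLoss, one_mul]
      congr 1
      exact Finset.sum_congr rfl fun i _ => by rw [linFun]; ring) hw
  have h2 : ∀ i, (linFun φ (θhat h) (D i h).1 (D i h).2 -
      γ * nextVAlong (estV φ θhat) (D i) h) ^ 2 ≤ (H : ℝ) ^ 2 := fun i => by
    obtain ⟨h3, h4⟩ := hrange _ (hθ h) (D i h).1 (D i h).2
    obtain ⟨h5, h6⟩ := nextVAlong_estV_mem_Icc hrange hθ (D i) h
    have h7 := mul_nonneg hγ.1 h5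
    have h8 := mul_le_mul hγ.2 h6 h5 zero_le_one
    exact sq_le_sq' (by linarith) (by linarith)
  have hn1 : (1 : ℝ) ≤ n := by exact_mod_cast hn
  refine abs_le_of_sq_le_sq' (a := ‖what h‖) (h1.trans ((Finset.sum_le_sum fun i _ => h2 i).trans
    ?_)) (by positivity) |>.2
  rw [Finset.sum_const, Finset.card_univ, Fintype.card_fin, nsmul_eq_mul, mul_pow, mul_comm]
  gcongr
  exact le_self_pow₀ hn1 two_ne_zero

omit [MeasurableSpace A] [Nonempty A] in
/-- The ridge estimate of the transition has norm at most `H n`. -/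
theorem norm_utilde_le (hn : 0 < n) {h : Fin H} (hu : IsMinOn
    (transitionLoss φ 1 D (pessV φ 1 β D what utilde π) h) Set.univ (utilde h)) :
    ‖utilde h‖ ≤ H * n := by
  have h1 := ridge_norm_sq_le (x := fun i => φ (D i h).1 (D i h).2)
    (y := fun i => nextVAlong (pessV φ 1 β D what utilde π) (D i) h)
    (fun u => by rw [transitionLoss, one_mul]; rfl) hu
  have h2 : ∀ i, nextVAlong (pessV φ 1 β D what utilde π) (D i) h ^ 2 ≤ (H : ℝ) ^ 2 := fun i => by
    obtain ⟨h3, h4⟩ := nextVAlong_pessV_mem_Icc (φ := φ) (D := D) (what := what)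
      (utilde := utilde) (β := β) (π := π) (D i) h
    have h5 : (0 : ℝ) ≤ (h : ℕ) := Nat.cast_nonneg _
    exact pow_le_pow_left₀ h3 (by linarith) 2
  have hn1 : (1 : ℝ) ≤ n := by exact_mod_cast hn
  refine abs_le_of_sq_le_sq' (a := ‖utilde h‖) (h1.trans ((Finset.sum_le_sum fun i _ =>
    h2 i).trans ?_)) (by positivity) |>.2
  rw [Finset.sum_const, Finset.card_univ, Fintype.card_fin, nsmul_eq_mul, mul_pow, mul_comm]
  gcongr
  exact le_self_pow₀ hn1 two_ne_zero

omit [MeasurableSpace S] [MeasurableSpace A] [Fintype A] [Nonempty A] in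
theorem abs_linFun_sub_le_of_norm_le (hφ1 : ∀ s a, ‖φ s a‖ ≤ 1)
    {θ θ₀ : EuclideanSpace ℝ (Fin d)} {ρ : ℝ} (h : ‖θ - θ₀‖ ≤ ρ) (s : S) (a : A) :
    |linFun φ θ s a - linFun φ θ₀ s a| ≤ ρ := by
  rw [← linFun_sub]
  exact (abs_linFun_le hφ1 _ s a).trans h

section Bias

variable {η l₁ l₂ : ℝ} {I : Finset (EuclideanSpace ℝ (Fin d))} {k : ℕ}

/-- The contribution of the radius `1 / n²` of the net of parameters to the bias is bounded. -/
theorem discretization_le (hn : 0 < n) (l : ℝ) :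
    32 * n * (1 / (n : ℝ) ^ 2) ^ 2 + 16 * (l + n * (1 / (n : ℝ) ^ 2)) ≤ 48 + 16 * l := by
  have hn1 : (1 : ℝ) ≤ n := by exact_mod_cast hn
  have h1 : (n : ℝ) * (1 / (n : ℝ) ^ 2) ≤ 1 := by
    rw [pow_two, ← mul_div_assoc, mul_one, div_le_one (by positivity)]
    nlinarith
  have h2 : (1 : ℝ) / (n : ℝ) ^ 2 ≤ 1 := (div_le_one (by positivity)).2 (one_le_pow₀ hn1)
  have h3 : 0 ≤ (1 : ℝ) / (n : ℝ) ^ 2 := by positivity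
  have h4 : 0 ≤ (n : ℝ) * (1 / (n : ℝ) ^ 2) := by positivity
  nlinarith

/-- In-sample error of the estimated action values on a regular dataset. -/
theorem sum_sq_linFun_sub_agentQ_le (M : EpisodicMDP S A H) (hlin : LinearClass M φ Θ γ)
    (hid : Identified φ Θ) (hφ1 : ∀ s a, ‖φ s a‖ ≤ 1) (hn : 0 < n)
    (hIΘ : ∀ θ ∈ Θ, ∃ θ₀ ∈ I, ‖θ - θ₀‖ ≤ 1 / (n : ℝ) ^ 2)
    (hD : GoodData M φ γ β η l₁ l₂ I k D) (h : Fin H) {θ : EuclideanSpace ℝ (Fin d)}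
    (hθ : θ ∈ Θ) (hmle : IsMaxOn (logLik φ D h) Θ θ) :
    ∑ i, (linFun φ θ (D i h).1 (D i h).2 - M.agentQ γ h (D i h).1 (D i h).2) ^ 2 ≤
      (Fintype.card A * Real.exp H) ^ 2 * (48 + 16 * l₁) := by
  obtain ⟨θ', hθ', hQ⟩ := hlin.realizable h h.2
  obtain ⟨θ₀, hθ₀, hnear⟩ := hIΘ θ hθ
  have hρ := abs_linFun_sub_le_of_norm_le hφ1 hnear
  have hb : ∀ s, (M.behavior γ).prob h s = softmax (linFun φ θ' s) := fun s => by
    rw [← hQ]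
    rfl
  have h1 := hD.lik h θ₀ hθ₀
  simp only [hb] at h1
  have h2 := sum_compensator_le hn hmle hθ' hρ h1
  rw [hQ]
  refine (sum_sq_linFun_sub_le hlin.range hid hθ hθ' hρ _ _).trans ?_
  refine mul_le_mul_of_nonneg_left (le_trans ?_ (discretization_le hn l₁)) (sq_nonneg _)
  linarith

/-- In-sample error of the predicted agent values on a regular dataset. -/
theorem sum_sq_transition_sub_agentV_le (M : EpisodicMDP S A H)
    (hφ : ∀ a, Measurable fun s => φ s a) (hlin : LinearClass M φ Θ γ)
    (hid : Identified φ Θ) (hφ1 : ∀ s a, ‖φ s a‖ ≤ 1) (hn : 0 < n)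
    (hIΘ : ∀ θ ∈ Θ, ∃ θ₀ ∈ I, ‖θ - θ₀‖ ≤ 1 / (n : ℝ) ^ 2)
    (hD : GoodData M φ γ β η l₁ l₂ I k D) {h : ℕ} (hh : h + 1 < H)
    {θ : EuclideanSpace ℝ (Fin d)} (hθ : θ ∈ Θ)
    (hmle : IsMaxOn (logLik φ D ⟨h + 1, hh⟩) Θ θ) :
    ∑ i, (M.transition h (fun s => softmaxValue (linFun φ θ s)) (D i ⟨h, by omega⟩).1
        (D i ⟨h, by omega⟩).2 -
      M.transition h (M.agentV γ (h + 1)) (D i ⟨h, by omega⟩).1 (D i ⟨h, by omega⟩).2) ^ 2 ≤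
      4 * (Fintype.card A * Real.exp H) ^ 2 * (48 + 16 * l₁) := by
  obtain ⟨θ', hθ', hQ⟩ := hlin.realizable (h + 1) hh
  obtain ⟨θ₀, hθ₀, hnear⟩ := hIΘ θ hθ
  have hρ := abs_linFun_sub_le_of_norm_le hφ1 hnear
  have hb : ∀ s, (M.behavior γ).prob (h + 1) s = softmax (linFun φ θ' s) := fun s => by
    rw [← hQ]
    rfl
  have h1 := hD.likNext h hh θ₀ hθ₀
  simp only [hb] at h1
  have h2 := sum_compensator_le hn hmle hθ' hρ h1
  rw [M.agentV_eq_softmaxValue hh, hQ]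
  refine (sum_sq_transition_softmaxValue_sub_le M hφ hlin.range hid hθ hθ' hρ h _ _).trans ?_
  refine mul_le_mul_of_nonneg_left (le_trans ?_ (discretization_le hn l₁)) (by positivity)
  linarith

end Bias

/-- The correlation of any direction with the residuals, from bounds of the bias and of the
noise. -/
theorem sum_mul_le_of_bias_noise {y e b ε : Fin n → ℝ} (he : ∀ i, e i = b i + ε i) {B N : ℝ}
    (hb : ∑ i, b i ^ 2 ≤ B) (hε : ∑ i, y i * ε i ≤ (∑ i, y i ^ 2) / 4 + N) :
    ∑ i, y i * e i ≤ (∑ i, y i ^ 2) / 2 + (B + N) := by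
  have h1 : ∑ i, y i * b i ≤ ∑ i, (y i ^ 2 / 4 + b i ^ 2) := Finset.sum_le_sum fun i _ => by
    nlinarith [sq_nonneg (y i / 2 - b i)]
  rw [Finset.sum_add_distrib, ← Finset.sum_div] at h1
  simp only [he, mul_add, Finset.sum_add_distrib]
  linarith

/-- On a regular dataset, the correlation of the residuals with the regression error is at most
half the empirical squared norm of the error, up to the bias and the logarithmic size of the
net. -/
theorem sum_mul_regResidual_le (M : EpisodicMDP S A H) (hφ : ∀ a, Measurable fun s => φ s a)
    (hlin : LinearClass M φ Θ γ) (hid : Identified φ Θ) (hφ1 : ∀ s a, ‖φ s a‖ ≤ 1)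
    (hγ : γ ∈ Set.Icc (0 : ℝ) 1) (hβ : 1 ≤ β) (hn : 0 < n) (hdn : d ≤ n) {l₁ l₂ : ℝ}
    (hl₁ : 0 ≤ l₁) (hl₂ : 0 ≤ l₂) {I : Finset (EuclideanSpace ℝ (Fin d))}
    {k : ℕ} (hI : ↑I ⊆ Θ) (hIΘ : ∀ θ ∈ Θ, ∃ θ₀ ∈ I, ‖θ - θ₀‖ ≤ 1 / (n : ℝ) ^ 2)
    (hk : 4 * H * n ≤ (1 / (β * (n : ℝ) ^ 3)) ^ 2 * k)
    (hD : GoodData M φ γ β ((1 / (β * (n : ℝ) ^ 3)) ^ 2) l₁ l₂ I k D)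
    (hout : IsDCPPOOutput φ Θ γ 1 β D θhat what utilde π) (h : Fin H)
    {v : EuclideanSpace ℝ (Fin d)} (hv : ‖v‖ ≤ 4 * H * n) :
    ∑ i, linFun φ v (D i h).1 (D i h).2 * regResidual M φ γ β D θhat what utilde π h i ≤
      (∑ i, linFun φ v (D i h).1 (D i h).2 ^ 2) / 2 +
        (10 * ((Fintype.card A * Real.exp H) ^ 2 * (48 + 16 * l₁)) +
          (2 * (H : ℝ) ^ 2 * l₂ + 64 * (H : ℝ) ^ 2)) := by
  obtain ⟨⟨h, hh0⟩, rfl⟩ : ∃ h' : Fin H, h' = h := ⟨h, rfl⟩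
  have hQ := sum_sq_linFun_sub_agentQ_le M hlin hid hφ1 hn hIΘ hD ⟨h, hh0⟩
    (hout.mle_mem _) (hout.mle _)
  set X := (Fintype.card A * Real.exp H) ^ 2 * (48 + 16 * l₁) with hX
  have hX0 : 0 ≤ X := by positivity
  -- at the last step the residual has no noise and the bias is that of `Q̂`
  by_cases hh : h + 1 < H
  · set θ₁ := θhat ⟨h + 1, hh⟩ with hθ₁
    have hθ₁Θ : θ₁ ∈ Θ := hout.mle_mem _
    have hV := sum_sq_transition_sub_agentV_le M hφ hlin hid hφ1 hn hIΘ hD hh hθ₁Θ (hout.mle _)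
    set ω := what ⟨h + 1, hh⟩ + utilde ⟨h + 1, hh⟩ with hω
    set Λ := gramMatrix φ D ⟨h + 1, hh⟩ + (1 : ℝ) • (1 : Matrix (Fin d) (Fin d) ℝ) with hΛ
    have hωn : ‖ω‖ ≤ 4 * H * n := by
      have h1 := norm_what_le hlin.range hγ hn hout.mle_mem (hout.reward ⟨h + 1, hh⟩)
      have h2 := norm_utilde_le hn (hout.transition ⟨h + 1, hh⟩)
      have h3 : (0 : ℝ) ≤ H * n := by positivity
      refine (norm_add_le _ _).trans ?_
      linarith
    have hB : ∀ i j, |Λ⁻¹ i j| ≤ 1 := abs_inv_apply_le_one (by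
      rw [hΛ, one_smul, add_sub_cancel_right]
      exact posSemidef_gramMatrix φ D _)
    have hnoise := sum_mul_noise_le M hφ hφ1 hlin.range hγ hβ hn hdn hI hIΘ hk hD hh hv hωn hB hθ₁Θ
    set b : ℝ := (H : ℝ) - ((h + 1 : ℕ) : ℝ) with hb
    have hbmem : b ∈ Set.Icc (0 : ℝ) H := by
      have h1 : ((h + 1 : ℕ) : ℝ) ≤ H := by exact_mod_cast hh.le
      have h2 : (0 : ℝ) ≤ ((h + 1 : ℕ) : ℝ) := Nat.cast_nonneg _
      constructor <;> linarith
    set G := valueDiff φ γ β b ω Λ⁻¹ θ₁ with hG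
    have hpess : ∀ s, pessV φ 1 β D what utilde π ⟨h + 1, hh⟩ s = clipV φ β b ω Λ⁻¹ s :=
      fun s => pessV_eq_clipV hout ⟨h + 1, hh⟩ s
    have hPG : ∀ s a, M.transition h G s a =
        M.transition h (nextV (pessV φ 1 β D what utilde π) ⟨h, hh0⟩) s a -
          γ * M.transition h (fun s => softmaxValue (linFun φ θ₁ s)) s a := by
      intro s a
      have h1 : nextV (pessV φ 1 β D what utilde π) ⟨h, hh0⟩ = clipV φ β b ω Λ⁻¹ := by
        funext s
        rw [nextV, dif_pos hh, hpess]
      rw [h1, ← M.transition_const_mul]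
      refine M.transition_sub h s a (B := (H : ℝ)) (measurable_clipV hφ β b ω _)
        ((measurable_softmaxValue_linFun hφ θ₁).const_mul γ) (fun s => ?_) fun s => ?_
      · obtain ⟨h2, h3⟩ := clipV_mem_Icc (φ := φ) (β := β) hbmem.1 ω Λ⁻¹ s
        rw [abs_of_nonneg h2]
        exact h3.trans hbmem.2
      · obtain ⟨h2, h3⟩ := softmaxValue_mem_Icc (hlin.range θ₁ hθ₁Θ s)
        rw [abs_of_nonneg (mul_nonneg hγ.1 h2)]
        exact (mul_le_of_le_one_left h2 hγ.2).trans h3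
    refine sum_mul_le_of_bias_noise
      (b := fun i => (linFun φ (θhat ⟨h, hh0⟩) (D i ⟨h, hh0⟩).1 (D i ⟨h, hh0⟩).2 -
        M.agentQ γ h (D i ⟨h, hh0⟩).1 (D i ⟨h, hh0⟩).2) -
        γ * (M.transition h (fun s => softmaxValue (linFun φ θ₁ s)) (D i ⟨h, hh0⟩).1
          (D i ⟨h, hh0⟩).2 - M.transition h (M.agentV γ (h + 1)) (D i ⟨h, hh0⟩).1
            (D i ⟨h, hh0⟩).2))
      (ε := fun i => G (D i ⟨h + 1, hh⟩).1 -
        M.transition h G (D i ⟨h, hh0⟩).1 (D i ⟨h, hh0⟩).2) (fun i => ?_) ?_ ?_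
    · have h1 : G (D i ⟨h + 1, hh⟩).1 = nextVAlong (pessV φ 1 β D what utilde π) (D i) ⟨h, hh0⟩ -
          γ * nextVAlong (estV φ θhat) (D i) ⟨h, hh0⟩ := by
        rw [nextVAlong, nextVAlong, dif_pos hh, dif_pos hh, hpess]
        rfl
      rw [regResidual, hPG, h1, EpisodicMDP.agentQ]
      ring
    · have h1 : ∀ x y : ℝ, (x - γ * y) ^ 2 ≤ 2 * x ^ 2 + 2 * y ^ 2 := fun x y => by
        have h2 : γ ^ 2 ≤ 1 := pow_le_one₀ hγ.1 hγ.2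
        nlinarith [sq_nonneg (x + γ * y), mul_le_mul_of_nonneg_right h2 (sq_nonneg y)]
      refine (Finset.sum_le_sum fun i _ => h1 _ _).trans ?_
      rw [Finset.sum_add_distrib, ← Finset.mul_sum, ← Finset.mul_sum]
      linarith
    · rw [add_assoc] at hnoise
      exact hnoise
  · refine sum_mul_le_of_bias_noise
      (b := fun i => linFun φ (θhat ⟨h, hh0⟩) (D i ⟨h, hh0⟩).1 (D i ⟨h, hh0⟩).2 -
        M.agentQ γ h (D i ⟨h, hh0⟩).1 (D i ⟨h, hh0⟩).2)
      (ε := fun _ => 0) (fun i => ?_) ?_ ?_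
    · have h1 : nextV (pessV φ 1 β D what utilde π) ⟨h, hh0⟩ = fun _ => 0 := by
        funext s
        rw [nextV, dif_neg hh]
      have h2 : M.agentV γ (h + 1) = fun _ => 0 := by
        funext s
        rw [EpisodicMDP.agentV, show H - (h + 1) = 0 by omega]
        rfl
      have h3 : ∀ s a, M.transition h (fun _ => 0) s a = 0 := fun s a => by
        simp [EpisodicMDP.transition]
      rw [regResidual, nextVAlong, nextVAlong, dif_neg hh, dif_neg hh, h1, EpisodicMDP.agentQ,
        h2, h3]
      ring
    · linarith
    · have h1 : 0 ≤ ∑ i, linFun φ v (D i ⟨h, hh0⟩).1 (D i ⟨h, hh0⟩).2 ^ 2 :=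
        Finset.sum_nonneg fun i _ => sq_nonneg _
      simp only [mul_zero, Finset.sum_const_zero]
      positivity

/-- On a regular dataset the penalties are uncertainty quantifiers. -/
theorem isUncertaintyQuantifier_of_goodData (M : EpisodicMDP S A H)
    (hφ : ∀ a, Measurable fun s => φ s a)
    (hlin : LinearClass M φ Θ γ) (hid : Identified φ Θ) (hφ1 : ∀ s a, ‖φ s a‖ ≤ 1)
    (hrew : ∀ h < H, ∃ w : EuclideanSpace ℝ (Fin d), ‖w‖ ≤ √(d : ℝ) ∧ M.r h = linFun φ w)
    (htrans : LinearTransition M φ)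
    (hγ : γ ∈ Set.Icc (0 : ℝ) 1) (hβ : 1 ≤ β) (hn : 0 < n) (hdn : d ≤ n) {l₁ l₂ : ℝ}
    (hl₁ : 0 ≤ l₁) (hl₂ : 0 ≤ l₂) {I : Finset (EuclideanSpace ℝ (Fin d))}
    {k : ℕ} (hI : ↑I ⊆ Θ) (hIΘ : ∀ θ ∈ Θ, ∃ θ₀ ∈ I, ‖θ - θ₀‖ ≤ 1 / (n : ℝ) ^ 2)
    (hk : 4 * H * n ≤ (1 / (β * (n : ℝ) ^ 3)) ^ 2 * k)
    (hD : GoodData M φ γ β ((1 / (β * (n : ℝ) ^ 3)) ^ 2) l₁ l₂ I k D)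
    (hout : IsDCPPOOutput φ Θ γ 1 β D θhat what utilde π)
    (hRβ : 20 * ((Fintype.card A * Real.exp H) ^ 2 * (48 + 16 * l₁)) + 4 * (H : ℝ) ^ 2 * l₂ +
      128 * (H : ℝ) ^ 2 + 4 * (H : ℝ) ^ 2 * d ≤ β ^ 2) :
    IsUncertaintyQuantifier M φ 1 β D what utilde π := by
  refine isUncertaintyQuantifier_of_residual M hφ hrew htrans (by linarith) hout
    (R := 10 * ((Fintype.card A * Real.exp H) ^ 2 * (48 + 16 * l₁)) +
          (2 * (H : ℝ) ^ 2 * l₂ + 64 * (H : ℝ) ^ 2)) (by linarith) fun h w u hw hu => ?_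
  refine sum_mul_regResidual_le M hφ hlin hid hφ1 hγ hβ hn hdn hl₁ hl₂ hI hIΘ hk hD hout h ?_
  have hn1 : (1 : ℝ) ≤ n := by exact_mod_cast hn
  have hH1 : (1 : ℝ) ≤ H := by exact_mod_cast Nat.succ_le_of_lt h.pos
  have h1 := norm_what_le hlin.range hγ hn hout.mle_mem (hout.reward h)
  have h2 := norm_utilde_le hn (hout.transition h)
  have hdn' : (d : ℝ) ≤ n := by exact_mod_cast hdn
  have h3 : √(d : ℝ) ≤ n := Real.sqrt_le_iff.2 ⟨by linarith, by nlinarith⟩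
  have h4 : ‖w‖ ≤ H * n := by nlinarith
  have h5 : ‖u‖ ≤ H * n := by
    have h6 : (0 : ℝ) ≤ (h : ℕ) := Nat.cast_nonneg _
    have h7 := mul_le_mul (sub_le_self (H : ℝ) h6) h3 (Real.sqrt_nonneg _) (by linarith)
    linarith
  have h6 := norm_sub_le (what h + utilde h) (w + u)
  have h7 := norm_add_le (what h) (utilde h)
  have h8 := norm_add_le w u
  linarith

/-- With few trajectories, the crude bound of the residuals suffices. -/
theorem isUncertaintyQuantifier_of_few (M : EpisodicMDP S A H)
    (hφ : ∀ a, Measurable fun s => φ s a) (hlin : LinearClass M φ Θ γ)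
    (hrew : ∀ h < H, ∃ w : EuclideanSpace ℝ (Fin d), ‖w‖ ≤ √(d : ℝ) ∧ M.r h = linFun φ w)
    (htrans : LinearTransition M φ) (hγ : γ ∈ Set.Icc (0 : ℝ) 1) (hβ : 0 ≤ β)
    (hout : IsDCPPOOutput φ Θ γ 1 β D θhat what utilde π)
    (hRβ : 4 * (H : ℝ) ^ 2 * n + 4 * (H : ℝ) ^ 2 * d ≤ β ^ 2) :
    IsUncertaintyQuantifier M φ 1 β D what utilde π := by
  refine isUncertaintyQuantifier_of_residual M hφ hrew htrans hβ hout
    (R := 2 * (H : ℝ) ^ 2 * n) (by linarith) fun h w u hw hu => ?_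
  set e := regResidual M φ γ β D θhat what utilde π h with he
  have h1 : ∀ i, e i ^ 2 ≤ (2 * H : ℝ) ^ 2 := fun i =>
    sq_le_sq' (abs_le.1 (abs_residual_le M hφ hlin.range hγ hout.mle_mem h i)).1
      (abs_le.1 (abs_residual_le M hφ hlin.range hγ hout.mle_mem h i)).2
  rw [Finset.sum_div]
  calc _ ≤ ∑ i : Fin n, (linFun φ (what h + utilde h - (w + u)) (D i h).1 (D i h).2 ^ 2 / 2 +
        2 * (H : ℝ) ^ 2) := by
        refine Finset.sum_le_sum fun i _ => ?_
        have h2 := h1 i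
        nlinarith [sq_nonneg (linFun φ (what h + utilde h - (w + u)) (D i h).1 (D i h).2 - e i)]
    _ = _ := by
        rw [Finset.sum_add_distrib, Finset.sum_const, Finset.card_univ, Fintype.card_fin,
          nsmul_eq_mul]
        ring

end Quantifier

/-! ### The probability of the regular datasets -/

section Probability

variable {S A : Type*} [MeasurableSpace S] [MeasurableSpace A] [MeasurableSingletonClass A]
  [Fintype A] [Nonempty A] {H d n : ℕ} {φ : S → A → EuclideanSpace ℝ (Fin d)}
  {Θ : Set (EuclideanSpace ℝ (Fin d))} {γ β : ℝ} {Ω : Type*} [MeasurableSpace Ω] {μ : Measure Ω}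

theorem measure_iUnion_fin_le {H : ℕ} (hH : 0 < H) {E : Fin H → Set Ω} {δ : ℝ}
    (hE : ∀ h, μ (E h) ≤ ENNReal.ofReal (δ / H)) : μ (⋃ h, E h) ≤ ENNReal.ofReal δ := by
  refine (measure_iUnion_fintype_le μ E).trans ((Finset.sum_le_sum fun h _ => hE h).trans ?_)
  have hH' : (0 : ℝ) < H := by exact_mod_cast hH
  rw [Finset.sum_const, Finset.card_univ, Fintype.card_fin, nsmul_eq_mul,
    ← ENNReal.ofReal_natCast, ← ENNReal.ofReal_mul (Nat.cast_nonneg _),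
    mul_div_cancel₀ _ hH'.ne']

variable [IsProbabilityMeasure μ] {D : Ω → Fin n → Fin H → S × A}

/-- The three families of exponential inequalities, each of them for `H` steps at confidence level
`δ / (6 H)`; `N₁` and `N₂` bound the sizes of the two nets. -/
theorem measure_not_goodData_le (M : EpisodicMDP S A H) (hφ : ∀ a, Measurable fun s => φ s a)
    (hrange : ∀ θ ∈ Θ, ∀ s a, linFun φ θ s a ∈ Set.Icc (0 : ℝ) H) (hγ : γ ∈ Set.Icc (0 : ℝ) 1)
    (hD : M.IsIIDSample (M.behavior γ) μ D) (hH : 0 < H) (η : ℝ)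
    {I : Finset (EuclideanSpace ℝ (Fin d))} (hI : ↑I ⊆ Θ) (k : ℕ) {N₁ N₂ δ : ℝ}
    (hN₁ : (I.card : ℝ) ≤ N₁) (hN₁0 : 0 < N₁)
    (hN₂ : ((intCube (NetIndex d) k ×ˢ I).card : ℝ) ≤ N₂) (hN₂0 : 0 < N₂) (hδ : 0 < δ) :
    μ {ω | ¬ GoodData M φ γ β η (Real.log (N₁ / (δ / 6 / H))) (Real.log (N₂ / (δ / 6 / H))) I k
      (D ω)} ≤ ENNReal.ofReal (δ / 2) := by
  have hH' : (0 : ℝ) < H := by exact_mod_cast hH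
  have hδ6 : 0 < δ / 6 / H := by positivity
  set l₁ := Real.log (N₁ / (δ / 6 / H)) with hl₁
  set l₂ := Real.log (N₂ / (δ / 6 / H)) with hl₂
  have hbpos : ∀ h s a, 0 < (M.behavior γ).prob h s a := fun h s a => softmax_pos _ _
  set E₁ : Fin H → Set Ω := fun h => {ω | ∃ θ ∈ I, l₁ < ∑ i,
    ((Real.log (softmax (linFun φ θ (D ω i h).1) (D ω i h).2) -
      Real.log ((M.behavior γ).prob h (D ω i h).1 (D ω i h).2)) / 2 +
      hellingerSq ((M.behavior γ).prob h (D ω i h).1) (softmax (linFun φ θ (D ω i h).1)))} with hE₁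
  set E₂ : Fin H → Set Ω := fun h => {ω | ∃ hh : (h : ℕ) + 1 < H, ∃ θ ∈ I, l₁ < ∑ i,
    ((Real.log (softmax (linFun φ θ (D ω i ⟨h + 1, hh⟩).1) (D ω i ⟨h + 1, hh⟩).2) -
      Real.log ((M.behavior γ).prob (h + 1) (D ω i ⟨h + 1, hh⟩).1 (D ω i ⟨h + 1, hh⟩).2)) / 2 +
      M.transition h (fun s => hellingerSq ((M.behavior γ).prob (h + 1) s)
        (softmax (linFun φ θ s))) (D ω i ⟨h, by omega⟩).1 (D ω i ⟨h, by omega⟩).2)} with hE₂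
  set E₃ : Fin H → Set Ω := fun h => {ω | ∃ hh : (h : ℕ) + 1 < H,
    ∃ x ∈ intCube (NetIndex d) k ×ˢ I, l₂ < ∑ i,
      noiseTerm M φ (netDir η x.1) (valueDiff φ γ β ((H : ℝ) - (((h : ℕ) + 1 : ℕ) : ℝ))
        (netVec η x.1) (netMat η x.1) x.2) hh (D ω i)} with hE₃
  have hsub : {ω | ¬ GoodData M φ γ β η l₁ l₂ I k (D ω)} ⊆
      (⋃ h, E₁ h) ∪ (⋃ h, E₂ h) ∪ ⋃ h, E₃ h := by
    intro ω hω
    by_contra hcon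
    simp only [Set.mem_union, Set.mem_iUnion, not_or, not_exists] at hcon
    obtain ⟨⟨h1, h2⟩, h3⟩ := hcon
    refine hω ⟨fun h θ hθ => not_lt.1 fun hlt => h1 h ⟨θ, hθ, hlt⟩,
      fun h hh θ hθ => not_lt.1 fun hlt => h2 ⟨h, by omega⟩ ⟨hh, θ, hθ, hlt⟩,
      fun h hh x hx => not_lt.1 fun hlt => h3 ⟨h, by omega⟩ ⟨hh, x, hx, hlt⟩⟩
  have hc : ∀ h : Fin H, Measurable fun τ : Fin H → S × A => τ h := measurable_pi_apply
  have hsoft := fun θ => measurable_softmax_linFun hφ θ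
  have hm₁ : ∀ h : Fin H, μ (E₁ h) ≤ ENNReal.ofReal (δ / 6 / H) := fun h => by
    refine M.measure_exists_lt_sum_le (M.behavior γ) hD I (ψ := fun θ τ =>
      (Real.log (softmax (linFun φ θ (τ h).1) (τ h).2) -
        Real.log ((M.behavior γ).prob h (τ h).1 (τ h).2)) / 2 +
        hellingerSq ((M.behavior γ).prob h (τ h).1) (softmax (linFun φ θ (τ h).1)))
      (fun θ _ => ?_) (fun θ _ => ?_) hN₁ hN₁0 hδ6
    · have h1 := (EpisodicMDP.measurable_uncurry (hsoft θ)).comp (hc h)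
      have h2 := (EpisodicMDP.measurable_uncurry ((M.behavior γ).measurable_prob h)).comp
        (hc h)
      have h3 := (EpisodicMDP.measurable_hellingerSq ((M.behavior γ).measurable_prob h)
        (hsoft θ)).comp (measurable_fst.comp (hc h))
      exact ((h1.log.sub h2.log).div_const 2).add h3
    · exact M.lintegral_exp_logRatio_le_one (M.behavior γ)
        (p' := fun s => softmax (linFun φ θ s)) h (hbpos h)
        (fun s a => softmax_pos (linFun φ θ s) a) (hsoft θ)
  have hm₂ : ∀ h : Fin H, μ (E₂ h) ≤ ENNReal.ofReal (δ / 6 / H) := fun h => by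
    by_cases hh : (h : ℕ) + 1 < H
    swap
    · rw [show E₂ h = ∅ from Set.eq_empty_of_forall_notMem fun ω hω => hh hω.1, measure_empty]
      exact zero_le
    have hmem : E₂ h = _ := Set.ext fun ω => exists_prop_of_true hh
    rw [hmem]
    refine M.measure_exists_lt_sum_le (M.behavior γ) hD I (ψ := fun θ τ =>
      (Real.log (softmax (linFun φ θ (τ ⟨h + 1, hh⟩).1) (τ ⟨h + 1, hh⟩).2) -
        Real.log ((M.behavior γ).prob (h + 1) (τ ⟨h + 1, hh⟩).1 (τ ⟨h + 1, hh⟩).2)) / 2 +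
        M.transition h (fun s => hellingerSq ((M.behavior γ).prob (h + 1) s)
          (softmax (linFun φ θ s))) (τ ⟨h, by omega⟩).1 (τ ⟨h, by omega⟩).2)
      (fun θ _ => ?_) (fun θ _ => ?_) hN₁ hN₁0 hδ6
    · have h1 := (EpisodicMDP.measurable_uncurry (hsoft θ)).comp
        (hc (⟨h + 1, hh⟩ : Fin H))
      have h2 := (EpisodicMDP.measurable_uncurry ((M.behavior γ).measurable_prob (h + 1))).comp
        (hc (⟨h + 1, hh⟩ : Fin H))
      have h3 := (EpisodicMDP.measurable_uncurry fun a => M.measurable_transition h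
        (EpisodicMDP.measurable_hellingerSq ((M.behavior γ).measurable_prob (h + 1))
          (hsoft θ)) a).comp (hc (⟨h, by omega⟩ : Fin H))
      exact ((h1.log.sub h2.log).div_const 2).add h3
    · exact M.lintegral_exp_logRatio_next_le_one (M.behavior γ)
        (p' := fun s => softmax (linFun φ θ s)) hh (hbpos _)
        (fun s => softmax_mem_stdSimplex (linFun φ θ s))
        (fun s a => softmax_pos (linFun φ θ s) a) (hsoft θ)
  have hm₃ : ∀ h : Fin H, μ (E₃ h) ≤ ENNReal.ofReal (δ / 6 / H) := fun h => by
    by_cases hh : (h : ℕ) + 1 < H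
    swap
    · rw [show E₃ h = ∅ from Set.eq_empty_of_forall_notMem fun ω hω => hh hω.1, measure_empty]
      exact zero_le
    have hmem : E₃ h = _ := Set.ext fun ω => exists_prop_of_true hh
    rw [hmem]
    have hb : (H : ℝ) - (((h : ℕ) + 1 : ℕ) : ℝ) ∈ Set.Icc (0 : ℝ) H := by
      have h1 : (((h : ℕ) + 1 : ℕ) : ℝ) ≤ H := by exact_mod_cast hh.le
      have h2 : (0 : ℝ) ≤ (((h : ℕ) + 1 : ℕ) : ℝ) := Nat.cast_nonneg _
      constructor <;> linarith
    refine M.measure_exists_lt_sum_le (M.behavior γ) hD (intCube (NetIndex d) k ×ˢ I)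
      (ψ := fun x τ => noiseTerm M φ (netDir η x.1)
        (valueDiff φ γ β ((H : ℝ) - (((h : ℕ) + 1 : ℕ) : ℝ)) (netVec η x.1) (netMat η x.1) x.2)
          hh τ) (fun x _ => ?_) (fun x hx => ?_) hN₂ hN₂0 hδ6
    · have hG := measurable_valueDiff (γ := γ) (β := β) hφ
        ((H : ℝ) - (((h : ℕ) + 1 : ℕ) : ℝ)) (netVec η x.1) (netMat η x.1) x.2
      have h1 := (EpisodicMDP.measurable_uncurry (measurable_linFun hφ (netDir η x.1))).comp
        (hc (⟨h, by omega⟩ : Fin H))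
      have h2 := hG.comp (measurable_fst.comp (hc (⟨h + 1, hh⟩ : Fin H)))
      have h3 := (EpisodicMDP.measurable_uncurry fun a => M.measurable_transition h hG a).comp
        (hc (⟨h, by omega⟩ : Fin H))
      exact ((h1.mul (h2.sub h3)).div_const _).sub ((h1.pow_const 2).div_const _)
    · have hx2 : x.2 ∈ Θ := hI (Finset.mem_product.1 hx).2
      exact M.lintegral_exp_noise_le_one (M.behavior γ) (measurable_valueDiff hφ _ _ _ _) hH'
        (fun s => valueDiff_mem_Icc hrange hγ hb _ _ hx2 s) (measurable_linFun hφ _) hh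
  refine (measure_mono hsub).trans ((measure_union_le _ _).trans ?_)
  have h6 : (0 : ℝ) ≤ δ / 6 := by positivity
  calc _ ≤ (ENNReal.ofReal (δ / 6) + ENNReal.ofReal (δ / 6)) + ENNReal.ofReal (δ / 6) :=
        add_le_add ((measure_union_le _ _).trans (add_le_add (measure_iUnion_fin_le hH hm₁)
          (measure_iUnion_fin_le hH hm₂))) (measure_iUnion_fin_le hH hm₃)
    _ = ENNReal.ofReal (δ / 2) := by
        rw [← ENNReal.ofReal_add h6 h6, ← ENNReal.ofReal_add (by positivity) h6]
        congr 1
        ring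

end Probability

/-! ### Numerical constants -/

section Constants

theorem log_le_log_div {H n : ℕ} (hH : 0 < H) {δ : ℝ} (hδ : δ ∈ Set.Ioo (0 : ℝ) 1) (hn : 0 < n) :
    Real.log n ≤ Real.log (n * H / δ) := by
  have hn0 : (0 : ℝ) < n := by exact_mod_cast hn
  have hH1 : (1 : ℝ) ≤ H := by exact_mod_cast hH
  refine Real.log_le_log hn0 ((le_div_iff₀ hδ.1).2 ?_)
  exact mul_le_mul_of_nonneg_left (hδ.2.le.trans hH1) hn0.le

theorem log_two_mul_pow_le {H n : ℕ} (hH : 0 < H) {δ : ℝ} (hδ : δ ∈ Set.Ioo (0 : ℝ) 1)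
    (hn : 2 ≤ n) : Real.log ((2 * n ^ 3 : ℕ) : ℝ) ≤ 4 * Real.log (n * H / δ) := by
  have hn0 : (0 : ℝ) < n := by exact_mod_cast (by omega : 0 < n)
  have h1 := log_le_log_div hH hδ (by omega : 0 < n)
  have h2 : Real.log 2 ≤ Real.log n := Real.log_le_log two_pos (by exact_mod_cast hn)
  push_cast
  rw [Real.log_mul two_ne_zero (by positivity), Real.log_pow]
  push_cast
  linarith

/-- The contribution of the confidence level `δ / (6 H)` of each exponential inequality. -/
theorem log_confidence {H n : ℕ} (hH : 0 < H) {δ : ℝ} (hδ : δ ∈ Set.Ioo (0 : ℝ) 1) (hn : 2 ≤ n) :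
    Real.log (δ / 6 / H) = -Real.log (6 * H / δ) ∧ 0 ≤ Real.log (6 * H / δ) ∧
      Real.log (6 * H / δ) ≤ 3 * Real.log (n * H / δ) := by
  have hδ0 := hδ.1
  have hn2 : (2 : ℝ) ≤ n := by exact_mod_cast hn
  have hH1 : (1 : ℝ) ≤ H := by exact_mod_cast hH
  have h1 := log_le_log_div hH hδ (by omega : 0 < n)
  have h2 : Real.log 2 ≤ Real.log n := Real.log_le_log two_pos hn2
  refine ⟨?_, Real.log_nonneg ((le_div_iff₀ hδ.1).2 (by linarith [hδ.2])), ?_⟩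
  · rw [← Real.log_inv, inv_div, div_div, mul_comm]
  · have h3 : 6 * H / δ ≤ 2 ^ 2 * (n * H / δ) := by
      rw [← mul_div_assoc]
      refine div_le_div_of_nonneg_right ?_ hδ0.le
      nlinarith
    refine (Real.log_le_log (by positivity) h3).trans ?_
    rw [Real.log_mul (by norm_num) (by positivity), Real.log_pow]
    push_cast
    linarith

/-- The logarithm of the number of grid points, up to the exponent: the number `4 H n ^ 7 β ^ 2` is
the ratio of the radius `4 H n` to the mesh `(1 / (β n³))²`. -/
theorem log_grid_le {H K d n : ℕ} (hH : 0 < H) (hK : 0 < K) (hd : 0 < d) (hdn : d ≤ n)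
    {C δ : ℝ} (hC : 1 ≤ C) (hδ : δ ∈ Set.Ioo (0 : ℝ) 1) (hn : 2 ≤ n)
    (hβ : 1 ≤ dcppoBeta C H K d n δ) :
    Real.log (2 * ⌈4 * H * (n : ℝ) ^ 7 * dcppoBeta C H K d n δ ^ 2⌉₊ + 1) ≤
      14 * Real.log (n * H / δ) + 5 * H + 2 * Real.log C + 2 * Real.log K := by
  set β := dcppoBeta C H K d n δ with hβdef
  set L := Real.log (n * H / δ) with hL
  have hn2 : (2 : ℝ) ≤ n := by exact_mod_cast hn
  have hH1 : (1 : ℝ) ≤ H := by exact_mod_cast hH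
  have hK1 : (1 : ℝ) ≤ K := by exact_mod_cast hK
  have hd1 : (1 : ℝ) ≤ d := by exact_mod_cast hd
  have hdn' : (d : ℝ) ≤ n := by exact_mod_cast hdn
  have hnL : Real.log n ≤ L := log_le_log_div hH hδ (by omega)
  have h2L : Real.log 2 ≤ L := (Real.log_le_log two_pos hn2).trans hnL
  have hL0 : 0 < L := (Real.log_pos one_lt_two).trans_le h2L
  have hdL : Real.log d ≤ L := (Real.log_le_log (by linarith) hdn').trans hnL
  have hHH : Real.log H ≤ H := Real.log_le_self (by linarith)
  have hlogβ : Real.log β = Real.log C + (Real.log H + H + Real.log K + Real.log d +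
      Real.log L / 2) := by
    rw [hβdef, dcppoBeta, ← hL, Real.log_mul (by positivity) (by positivity),
      Real.log_mul (by positivity) (by positivity), Real.log_mul (by positivity) (by positivity),
      Real.log_mul (by positivity) (by positivity), Real.log_mul (by positivity) (by positivity),
      Real.log_exp, Real.log_sqrt hL0.le]
  have hlogL : Real.log L ≤ L := Real.log_le_self hL0.le
  set x := (H : ℝ) * (n : ℝ) ^ 7 * β ^ 2 with hx
  have hx1 : 1 ≤ x := one_le_mul_of_one_le_of_one_le (one_le_mul_of_one_le_of_one_le hH1
    (one_le_pow₀ (by linarith))) (one_le_pow₀ hβ)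
  have hceil : 2 * (⌈4 * H * (n : ℝ) ^ 7 * β ^ 2⌉₊ : ℝ) + 1 ≤ 16 * x := by
    have h1 := (Nat.ceil_lt_add_one (a := 4 * H * (n : ℝ) ^ 7 * β ^ 2) (by positivity)).le
    have h2 : 4 * H * (n : ℝ) ^ 7 * β ^ 2 = 4 * x := by rw [hx]; ring
    rw [h2] at h1 ⊢
    linarith
  refine (Real.log_le_log (by positivity) hceil).trans ?_
  rw [show (16 : ℝ) = 2 ^ 4 by norm_num, Real.log_mul (by norm_num) (by positivity), hx,
    Real.log_mul (by positivity) (by positivity), Real.log_mul (by positivity) (by positivity),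
    Real.log_pow, Real.log_pow, Real.log_pow, hlogβ]
  push_cast
  linarith

/-- The inequality between the constants: `a`, `g`, `q` stand for `|A|² e^{2H}`, `H²` and
`d²`. -/
theorem constant_le {κ C L a g q H d l₁ l₂ lK : ℝ} (hκ : 0 < κ) (hC : 100 * (1 + κ) ≤ C)
    (hL : 2 / 3 ≤ L) (ha : 1 ≤ a) (hg : 1 ≤ g) (hq : 1 ≤ q) (hdq : d ≤ q)
    (hHa : H ≤ a) (hlK : lK ≤ a) (hl₁ : l₁ ≤ 4 * κ * d * L + 3 * L)
    (hl₂ : l₂ ≤ 3 * q * (14 * L + 5 * H + 2 * Real.log C + 2 * lK) + l₁) :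
    20 * (a * (48 + 16 * l₁)) + 4 * g * l₂ + 128 * g + 4 * g * d ≤ C ^ 2 * (g * a * q * L) := by
  have hL0 : 0 < L := by linarith
  have hC0 : 100 < C := by linarith
  have hlC : Real.log C ≤ C := Real.log_le_self (by linarith)
  obtain ⟨Z, hZ⟩ : ∃ Z, Z = g * a * q := ⟨_, rfl⟩
  have hag : a ≤ g * a := le_mul_of_one_le_left (by linarith) hg
  have hgq : g ≤ g * q := le_mul_of_one_le_right (by linarith) hq
  have hgqZ : g * q ≤ Z := by
    rw [hZ, mul_right_comm]
    exact le_mul_of_one_le_right (by positivity) ha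
  have hgZ : g ≤ Z := hgq.trans hgqZ
  have hgdZ : g * d ≤ Z := (mul_le_mul_of_nonneg_left hdq (by linarith)).trans hgqZ
  have haqZ : a * q ≤ Z := by
    rw [hZ]
    exact mul_le_mul_of_nonneg_right hag (by linarith)
  have haZ : a ≤ Z := (le_mul_of_one_le_right (by linarith) hq).trans haqZ
  have hadZ : a * d ≤ Z := (mul_le_mul_of_nonneg_left hdq (by linarith)).trans haqZ
  have hgqa : g * q * a = Z := by rw [hZ]; ring
  have hgqH : g * q * H ≤ Z := by
    rw [← hgqa]
    exact mul_le_mul_of_nonneg_left hHa (by positivity)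
  have hgqK : g * q * lK ≤ Z := by
    rw [← hgqa]
    exact mul_le_mul_of_nonneg_left hlK (by positivity)
  have hZ0 : 0 < Z := by linarith
  have hgqC : g * q * Real.log C ≤ Z * C :=
    (mul_le_mul_of_nonneg_left hlC (by positivity)).trans
      (mul_le_mul_of_nonneg_right hgqZ (by linarith))
  have hZL : Z ≤ 3 / 2 * (Z * L) := by nlinarith
  have hZCL : Z * C ≤ 3 / 2 * (Z * L * C) := by nlinarith
  have hκL : 0 ≤ 4 * κ * L := by positivity
  have e1 : a * l₁ ≤ (4 * κ + 3) * (Z * L) := by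
    refine (mul_le_mul_of_nonneg_left hl₁ (by linarith)).trans ?_
    have h1 := mul_le_mul_of_nonneg_left hadZ hκL
    have h2 := mul_le_mul_of_nonneg_left haZ hL0.le
    linarith
  have e2 : g * l₁ ≤ (4 * κ + 3) * (Z * L) := by
    refine (mul_le_mul_of_nonneg_left hl₁ (by linarith)).trans ?_
    have h1 := mul_le_mul_of_nonneg_left hgdZ hκL
    have h2 := mul_le_mul_of_nonneg_left hgZ hL0.le
    linarith
  have e3 : g * l₂ ≤ 42 * (Z * L) + 15 * Z + 6 * (Z * C) + 6 * Z + (4 * κ + 3) * (Z * L) := by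
    refine (mul_le_mul_of_nonneg_left hl₂ (by linarith)).trans ?_
    have h1 := mul_le_mul_of_nonneg_right hgqZ hL0.le
    linarith
  have e4 : (5000 + 5000 * κ + 36 * C) * (Z * L) ≤ C ^ 2 * (Z * L) := by
    refine mul_le_mul_of_nonneg_right ?_ (by positivity)
    nlinarith
  have e5 : 0 ≤ κ * (Z * L) := by positivity
  rw [← hZ]
  linarith

end Constants

/-! ### The high-probability event -/

section Conclusion

variable {S A : Type*} [MeasurableSpace S] [MeasurableSpace A] [MeasurableSingletonClass A]
  [Fintype A] [Nonempty A] {H d n : ℕ} {φ : S → A → EuclideanSpace ℝ (Fin d)}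
  {Θ : Set (EuclideanSpace ℝ (Fin d))} {γ κ C δ : ℝ} {Ω : Type*} [MeasurableSpace Ω]
  {μ : Measure Ω} [IsProbabilityMeasure μ] {D : Ω → Fin n → Fin H → S × A}

theorem two_thirds_le_log (hδ : 0 < δ) (hnH : 2 * δ ≤ n * H) :
    2 / 3 ≤ Real.log (n * H / δ) :=
  (by linarith [Real.log_two_gt_d9] : (2 / 3 : ℝ) ≤ Real.log 2).trans
    (Real.log_le_log two_pos ((le_div_iff₀ hδ).2 hnH))

theorem sq_dcppoBeta {H K d n : ℕ} (hL : 0 ≤ Real.log (n * H / δ)) :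
    dcppoBeta C H K d n δ ^ 2 = C ^ 2 * ((H : ℝ) ^ 2 * (K * Real.exp H) ^ 2 * (d : ℝ) ^ 2 *
      Real.log (n * H / δ)) := by
  rw [dcppoBeta, mul_pow, mul_pow, Real.sq_sqrt hL]
  ring

theorem one_le_dcppoBeta {H K d n : ℕ} (hH : 0 < H) (hK : 0 < K) (hd : 0 < d) (hC : 2 ≤ C)
    (hL : 2 / 3 ≤ Real.log (n * H / δ)) : 1 ≤ dcppoBeta C H K d n δ := by
  have hH1 : (1 : ℝ) ≤ H := by exact_mod_cast hH
  have hK1 : (1 : ℝ) ≤ K := by exact_mod_cast hK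
  have hd1 : (1 : ℝ) ≤ d := by exact_mod_cast hd
  have h1 : 1 / 2 ≤ √(Real.log (n * H / δ)) := Real.le_sqrt_of_sq_le (by linarith)
  have h2 : 1 ≤ H * Real.exp H * K * (d : ℝ) :=
    one_le_mul_of_one_le_of_one_le (one_le_mul_of_one_le_of_one_le
      (one_le_mul_of_one_le_of_one_le hH1 (Real.one_le_exp (by linarith))) hK1) hd1
  have h3 : 1 / 2 ≤ H * Real.exp H * K * d * √(Real.log (n * H / δ)) := by nlinarith
  rw [dcppoBeta]
  nlinarith

/-- With probability at least `1 - δ / 2` the penalties are uncertainty quantifiers, for all outputs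
of the algorithm. If `n ≤ d²` this holds for every dataset; otherwise it holds for the regular
ones, and the size of the net is at most polynomial in `n`. -/
theorem measure_not_isUncertaintyQuantifier_le (M : EpisodicMDP S A H)
    (hφ : ∀ a, Measurable fun s => φ s a) (hd : 0 < d) (hγ : γ ∈ Set.Icc (0 : ℝ) 1)
    (hδ : δ ∈ Set.Ioo (0 : ℝ) 1) (hnH : 2 * δ ≤ n * H) (hκ : 0 < κ) (hC : 100 * (1 + κ) ≤ C)
    (hlin : LinearClass M φ Θ γ) (hid : Identified φ Θ) (hreg : Regular M φ Θ κ)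
    (htrans : LinearTransition M φ) (hD : M.IsIIDSample (M.behavior γ) μ D) :
    μ {ω | ¬ ∀ (θhat what utilde : Fin H → EuclideanSpace ℝ (Fin d)) (π : Policy S A),
      IsDCPPOOutput φ Θ γ 1 (dcppoBeta C H (Fintype.card A) d n δ) (D ω) θhat what utilde π →
      IsUncertaintyQuantifier M φ 1 (dcppoBeta C H (Fintype.card A) d n δ) (D ω) what utilde π} ≤
      ENNReal.ofReal (δ / 2) := by
  classical
  have hnH0 : (0 : ℝ) < n * H := by linarith [hδ.1]
  have hn : 0 < n := by
    rcases Nat.eq_zero_or_pos n with rfl | h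
    · simp at hnH0
    · exact h
  have hH : 0 < H := by
    rcases Nat.eq_zero_or_pos H with rfl | h
    · simp at hnH0
    · exact h
  have hn1 : (1 : ℝ) ≤ n := by exact_mod_cast hn
  have hH1 : (1 : ℝ) ≤ H := by exact_mod_cast hH
  have hd1 : (1 : ℝ) ≤ d := by exact_mod_cast hd
  have hK1 : (1 : ℝ) ≤ Fintype.card A := by exact_mod_cast Fintype.card_pos
  have hL := two_thirds_le_log hδ.1 hnH
  set L := Real.log (n * H / δ) with hLdef
  have hβ1 := one_le_dcppoBeta (C := C) hH (Fintype.card_pos (α := A)) hd (by linarith) hL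
  have hβsq := sq_dcppoBeta (C := C) (K := Fintype.card A) (d := d) (by linarith : 0 ≤ L)
  rw [← hLdef] at hβsq
  set β := dcppoBeta C H (Fintype.card A) d n δ with hβdef
  have hq : (1 : ℝ) ≤ (d : ℝ) ^ 2 := one_le_pow₀ hd1
  have hdq : (d : ℝ) ≤ (d : ℝ) ^ 2 := le_self_pow₀ hd1 two_ne_zero
  have hg : (1 : ℝ) ≤ (H : ℝ) ^ 2 := one_le_pow₀ hH1
  have hexp : (H : ℝ) ≤ Real.exp H := by linarith [Real.add_one_le_exp (H : ℝ)]
  have hKE : (1 : ℝ) ≤ Fintype.card A * Real.exp H :=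
    one_le_mul_of_one_le_of_one_le hK1 (by linarith)
  have hKEsq : Fintype.card A * Real.exp H ≤ (Fintype.card A * Real.exp H) ^ 2 :=
    le_self_pow₀ hKE two_ne_zero
  have ha : (1 : ℝ) ≤ (Fintype.card A * Real.exp H) ^ 2 := one_le_pow₀ hKE
  rcases le_or_gt n (d ^ 2) with hnd | hnd
  · refine le_trans (le_of_eq ?_) zero_le
    convert measure_empty (μ := μ)
    refine Set.eq_empty_of_forall_notMem fun ω hω => hω fun θhat what utilde π hout => ?_
    refine isUncertaintyQuantifier_of_few M hφ hlin hreg.reward htrans hγ (by linarith) hout ?_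
    rw [hβsq]
    have hnd' : (n : ℝ) ≤ (d : ℝ) ^ 2 := by exact_mod_cast hnd
    have h1 : 4 * (H : ℝ) ^ 2 * n + 4 * (H : ℝ) ^ 2 * d ≤ 8 * ((H : ℝ) ^ 2 * (d : ℝ) ^ 2) := by
      nlinarith
    have h2 : (H : ℝ) ^ 2 * (d : ℝ) ^ 2 ≤
        (H : ℝ) ^ 2 * (Fintype.card A * Real.exp H) ^ 2 * (d : ℝ) ^ 2 := by
      rw [mul_right_comm]
      exact le_mul_of_one_le_right (by positivity) ha
    set Z := (H : ℝ) ^ 2 * (Fintype.card A * Real.exp H) ^ 2 * (d : ℝ) ^ 2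
    have hZ : 0 ≤ Z := by positivity
    have h3 : 12 ≤ C ^ 2 := by nlinarith
    have h4 : 8 ≤ C ^ 2 * L := by nlinarith
    nlinarith
  have hdn : d ≤ n := (Nat.le_self_pow two_ne_zero d).trans hnd.le
  have hn2 : 2 ≤ n := by
    have : 1 ≤ d ^ 2 := Nat.one_le_pow _ _ hd
    omega
  have hdn' : (d : ℝ) ≤ n := by exact_mod_cast hdn
  -- `d ≤ n`, so the Euclidean radius `√d * (2 / m)` is at most `1 / n ^ 2` for `m = 2 * n ^ 3`
  obtain ⟨I, hI, hIcard, hInet⟩ := exists_net_of_log_externalCoveringNumber_le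
    (hreg.covering (2 * n ^ 3) (by have := Nat.one_le_pow 3 n hn; omega))
  have hIΘ : ∀ θ ∈ Θ, ∃ θ₀ ∈ I, ‖θ - θ₀‖ ≤ 1 / (n : ℝ) ^ 2 := by
    intro θ hθ
    obtain ⟨θ₀, hθ₀, h1⟩ := hInet θ hθ
    refine ⟨θ₀, hθ₀, h1.trans ?_⟩
    have h2 : √(d : ℝ) ≤ n := Real.sqrt_le_iff.2 ⟨by linarith, by nlinarith⟩
    calc √(d : ℝ) * (2 * (((2 * n ^ 3 : ℕ) : ℝ≥0)⁻¹ : ℝ≥0)) ≤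
          n * (2 * (((2 * n ^ 3 : ℕ) : ℝ≥0)⁻¹ : ℝ≥0)) := by gcongr
      _ = 1 / (n : ℝ) ^ 2 := by
        push_cast
        field_simp
  set B := κ * d * Real.log ((2 * n ^ 3 : ℕ) : ℝ) with hB
  -- the grid of mesh `(1 / (β * n ^ 3)) ^ 2` has to cover the cube of radius `4 * H * n`
  set k := ⌈4 * H * (n : ℝ) ^ 7 * β ^ 2⌉₊ with hkdef
  have hk : 4 * H * n ≤ (1 / (β * (n : ℝ) ^ 3)) ^ 2 * (k : ℝ) := by
    calc 4 * H * (n : ℝ) = (1 / (β * (n : ℝ) ^ 3)) ^ 2 * (4 * H * (n : ℝ) ^ 7 * β ^ 2) := by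
          field_simp
      _ ≤ _ := by
          gcongr
          exact Nat.le_ceil _
  set N₂ := (2 * k + 1 : ℝ) ^ (d + (d + d * d)) * Real.exp B with hN₂
  have hcard : ((intCube (NetIndex d) k ×ˢ I).card : ℝ) ≤ N₂ := by
    rw [Finset.card_product, Nat.cast_mul, card_intCube]
    simp only [Fintype.card_sum, Fintype.card_prod, Fintype.card_fin]
    exact mul_le_mul_of_nonneg_left hIcard (by positivity)
  have hgood := measure_not_goodData_le (β := β) M hφ hlin.range hγ hD hH
    ((1 / (β * (n : ℝ) ^ 3)) ^ 2) hI k hIcard (Real.exp_pos _) hcard (by positivity) hδ.1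
  refine le_trans (measure_mono fun ω hω => ?_) hgood
  rw [Set.mem_ofPred_eq] at hω ⊢
  intro hG
  refine hω fun θhat what utilde π hout => ?_
  -- the logarithms of the sizes of the nets
  have hBle : B ≤ 4 * κ * d * L := by
    have h2 := mul_le_mul_of_nonneg_left (log_two_mul_pow_le hH hδ hn2) (by positivity : 0 ≤ κ * d)
    linarith
  obtain ⟨hδ6, h60, h6⟩ := log_confidence hH hδ hn2
  have hδ0 : δ / 6 / H ≠ 0 := by
    have := hδ.1
    positivity
  have hl₁ : Real.log (Real.exp B / (δ / 6 / H)) = B + Real.log (6 * H / δ) := by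
    rw [Real.log_div (Real.exp_pos _).ne' hδ0, Real.log_exp, hδ6, sub_neg_eq_add]
  have hl₂ : Real.log (N₂ / (δ / 6 / H)) = (d + (d + d * d) : ℕ) * Real.log (2 * k + 1) +
      (B + Real.log (6 * H / δ)) := by
    rw [Real.log_div (by positivity) hδ0, hN₂, Real.log_mul (by positivity) (by positivity),
      Real.log_pow, Real.log_exp, hδ6]
    ring
  have hB0 : 0 ≤ B := by
    have : 0 ≤ Real.log ((2 * n ^ 3 : ℕ) : ℝ) := Real.log_natCast_nonneg _
    positivity
  have hk0 : 0 ≤ Real.log (2 * (k : ℝ) + 1) :=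
    Real.log_nonneg (by linarith [(Nat.cast_nonneg k : (0 : ℝ) ≤ k)])
  have hgrid := log_grid_le hH (Fintype.card_pos (α := A)) hd hdn (by linarith : 1 ≤ C) hδ hn2 hβ1
  have hdim : ((d + (d + d * d) : ℕ) : ℝ) ≤ 3 * (d : ℝ) ^ 2 := by
    push_cast
    linarith only [hdq, sq (d : ℝ)]
  refine isUncertaintyQuantifier_of_goodData M hφ hlin hid hreg.norm_feature hreg.reward htrans hγ
    hβ1 hn hdn (by rw [hl₁]; positivity) (by rw [hl₂]; positivity) hI hIΘ hk hG hout ?_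
  rw [hβsq]
  refine constant_le (κ := κ) (H := H) (lK := Real.log (Fintype.card A)) hκ hC hL ha hg hq hdq
    ?_ ?_ ?_ ?_
  · exact (hexp.trans (le_mul_of_one_le_left (Real.exp_pos _).le hK1)).trans hKEsq
  · refine (Real.log_le_self (by linarith)).trans (le_trans ?_ hKEsq)
    exact le_mul_of_one_le_right (by linarith) (by linarith)
  · rw [hl₁]
    linarith
  · rw [hl₁, hl₂]
    refine add_le_add_left ((mul_le_mul_of_nonneg_left hgrid (Nat.cast_nonneg _)).trans
      (mul_le_mul_of_nonneg_right hdim (hk0.trans hgrid))) _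

/-- Substitution of the value of `β`; the factors `1 + γ ≥ 1` and `d ≥ 1`, the latter inside the
logarithm, only weaken the bound. -/
theorem subOpt_bound_le {H K d n r : ℕ} {cdag : ℝ} (hC : 0 ≤ C) (hγ : 0 ≤ γ)
    (hd : 0 < d) (hn : 0 < n) (hH : 0 < H) (hδ : 0 < δ) :
    2 * H * dcppoBeta C H K d n δ * √(r / (cdag * n)) ≤
      2 * C / √cdag * (1 + γ) * K * (r : ℝ) ^ (1 / 2 : ℝ) * d * (H : ℝ) ^ 2 * Real.exp H *
        (n : ℝ) ^ (-(1 / 2) : ℝ) * √(Real.log (d * H * n / δ)) := by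
  have hn0 : (0 : ℝ) < n := by exact_mod_cast hn
  have hH0 : (0 : ℝ) < H := by exact_mod_cast hH
  have hd1 : (1 : ℝ) ≤ d := by exact_mod_cast hd
  have hlog : √(Real.log (n * H / δ)) ≤ √(Real.log (d * H * n / δ)) := by
    refine Real.sqrt_le_sqrt (Real.log_le_log (by positivity) ?_)
    refine div_le_div_of_nonneg_right ?_ hδ.le
    nlinarith [mul_pos hn0 hH0]
  rw [Real.rpow_neg hn0.le, ← Real.sqrt_eq_rpow, ← Real.sqrt_eq_rpow,
    Real.sqrt_div (Nat.cast_nonneg _), Real.sqrt_mul' _ hn0.le, dcppoBeta]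
  set X := 2 * C * K * d * (H : ℝ) ^ 2 * Real.exp H * (√r / (√cdag * √n)) with hX
  have hX0 : 0 ≤ X := by positivity
  calc _ = X * √(Real.log (n * H / δ)) := by rw [hX]; ring
    _ ≤ X * √(Real.log (d * H * n / δ)) := mul_le_mul_of_nonneg_left hlog hX0
    _ ≤ (1 + γ) * (X * √(Real.log (d * H * n / δ))) :=
        le_mul_of_one_le_left (by positivity) (by linarith)
    _ = _ := by
        rw [hX]
        field_simp

end Conclusion

theorem theorem3 (κ : ℝ) (hκ : 0 < κ) :
    ∃ C₀ : ℝ, 0 < C₀ ∧ ∀ C : ℝ, C₀ ≤ C → ∀ cdag : ℝ, 0 < cdag → ∃ c : ℝ, 0 < c ∧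
      ∀ (S A Ω : Type*) [MeasurableSpace S] [MeasurableSpace A] [MeasurableSingletonClass A]
        [Fintype A] [Nonempty A] [MeasurableSpace Ω] (H d n : ℕ) (M : EpisodicMDP S A H)
        (φ : S → A → EuclideanSpace ℝ (Fin d)) (Θ : Set (EuclideanSpace ℝ (Fin d)))
        (γ δ : ℝ) (πstar : Policy S A) (μ : Measure Ω) [IsProbabilityMeasure μ]
        (D : Ω → Fin n → Fin H → S × A),
        0 < d → γ ∈ Set.Icc (0 : ℝ) 1 → δ ∈ Set.Ioo (0 : ℝ) 1 → 2 * δ ≤ n * H →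
        (∀ a, Measurable fun s => φ s a) →
        LinearClass M φ Θ γ → Identified φ Θ → Regular M φ Θ κ → LinearTransition M φ →
        M.IsOptimal πstar →
        M.IsIIDSample (M.behavior γ) μ D →
        Coverage M φ πstar μ D cdag δ →
        μ {ω | ¬ ∀ (θhat what utilde : Fin H → EuclideanSpace ℝ (Fin d)) (π : Policy S A),
          IsDCPPOOutput φ Θ γ 1 (dcppoBeta C H (Fintype.card A) d n δ) (D ω)
            θhat what utilde π →
          IsUncertaintyQuantifier M φ 1 (dcppoBeta C H (Fintype.card A) d n δ) (D ω)
            what utilde π ∧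
          M.subOpt πstar π ≤ c * (1 + γ) * Fintype.card A * (d : ℝ) ^ (3 / 2 : ℝ) * (H : ℝ) ^ 2 *
            Real.exp H * (n : ℝ) ^ (-(1 / 2) : ℝ) * √(Real.log (d * H * n / δ)) ∧
          ∀ r : ℕ, (∀ h : Fin H, (M.featureCov φ (M.behavior γ) h).rank ≤ r) →
            M.subOpt πstar π ≤ c * (1 + γ) * Fintype.card A * (r : ℝ) ^ (1 / 2 : ℝ) * d *
              (H : ℝ) ^ 2 * Real.exp H * (n : ℝ) ^ (-(1 / 2) : ℝ) *
              √(Real.log (d * H * n / δ))} ≤ ENNReal.ofReal δ := by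
  -- `C₀` is dictated by `constant_le`, and `c` by the trace bound under coverage
  refine ⟨100 * (1 + κ), by positivity, fun C hC cdag hcdag => ?_⟩
  have hC0 : 0 < C := by linarith
  refine ⟨2 * C / √cdag, by positivity, ?_⟩
  intro S A Ω _ _ _ _ _ _ H d n M φ Θ γ δ πstar μ _ D hd hγ hδ hnH hφ hlin hid hreg htrans _ hD hcov
  have hUQ := measure_not_isUncertaintyQuantifier_le M hφ hd hγ hδ hnH hκ hC hlin hid hreg
    htrans hD
  have hnH0 : (0 : ℝ) < n * H := by linarith [hδ.1]
  have hn : 0 < n := by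
    rcases Nat.eq_zero_or_pos n with rfl | h
    · simp at hnH0
    · exact h
  have hH : 0 < H := by
    rcases Nat.eq_zero_or_pos H with rfl | h
    · simp at hnH0
    · exact h
  have hβ : 0 ≤ dcppoBeta C H (Fintype.card A) d n δ := by
    unfold dcppoBeta
    positivity
  have hrank : ∀ h, (M.featureCov φ πstar h).rank ≤ (M.featureCov φ (M.behavior γ) h).rank :=
    M.rank_featureCov_le hφ hreg.norm_feature πstar (M.behavior γ)
      fun h _ s a => softmax_pos _ a
  refine (measure_mono fun ω hω => ?_).trans ((measure_union_le _ _).trans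
    ((add_le_add hUQ hcov).trans_eq ?_))
  swap
  · rw [← ENNReal.ofReal_add (by linarith [hδ.1]) (by linarith [hδ.1]), add_halves]
  by_contra hcon
  simp only [Set.mem_union, Set.mem_ofPred_eq, not_or, not_not] at hcon
  obtain ⟨h1, h2⟩ := hcon
  refine hω fun θhat what utilde π hout => ?_
  have h3 := h1 θhat what utilde π hout
  have h4 : ∀ r : ℕ, (∀ h : Fin H, (M.featureCov φ πstar h).rank ≤ r) →
      M.subOpt πstar π ≤ 2 * C / √cdag * (1 + γ) * Fintype.card A * (r : ℝ) ^ (1 / 2 : ℝ) * d *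
        (H : ℝ) ^ 2 * Real.exp H * (n : ℝ) ^ (-(1 / 2) : ℝ) * √(Real.log (d * H * n / δ)) :=
    fun r hr => (subOpt_le_of_isUncertaintyQuantifier M hφ hreg.norm_feature hβ hn hout h3 hcdag
      h2 hr).trans (subOpt_bound_le hC0.le hγ.1 hd hn hH hδ.1)
  refine ⟨h3, ?_, fun r hr => h4 r fun h => (hrank h).trans (hr h)⟩
  have h5 := h4 d fun h => (Matrix.rank_le_width _)
  have h6 : (d : ℝ) ^ (3 / 2 : ℝ) = (d : ℝ) ^ (1 / 2 : ℝ) * d := by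
    rw [← Real.rpow_add_one (by positivity)]
    norm_num
  rwa [h6, ← mul_assoc]
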